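/- Let $V,\beta,g,\mu,\omega,\lambda$ be real parameters with $0<|V|<1$, $\beta\neq0$, $\lambda\ne 0$, and put $\gamma=(1-V^2)^{-1/2}$, $\tilde\beta=\beta/\gamma$, $G=\frac g{2\tilde\beta}$, $M=\frac\mu{2\tilde\beta}$, $\Omega=\frac\omega{2\tilde\beta}$, $\Lambda=\frac{\lambda}{4\tilde\beta^2}$. With $\theta=z\frac{d}{dz}$, consider the fourth-order linear equation on the Riemann sphere $$\gamma^4(V\theta+i\Omega)^4f+\gamma^2(V\theta+i\Omega)^2\Big[\Big(\frac{\Lambda}{1-z}-M^2\Big)f\Big]+\gamma^2G^2(\theta+iV\Omega)^2f=0 \qquad(\ast)$$ (the linearized equation of the model with background $1-\tanh(\tilde\beta x)$ and time dependence $e^{-i\omega t}$, in the variable $z=-e^{2\tilde\beta x}$), and the dispersion relations $$\mathrm{DR}(k)=\gamma^2\big(\mu^2(kV+\omega)^2-g^2(k+V\omega)^2+\gamma^2(kV+\omega)^4\big),$$ $$\mathrm{DR}_0(k)=\gamma^2\big((\mu^2-\lambda)(kV+\omega)^2-g^2(k+V\omega)^2+\gamma^2(kV+\omega)^4\big).$$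 Let $k_1,\dots,k_4$ and $\tilde k_1,\dots,\tilde k_4$ be the complex roots of $\mathrm{DR}$ and $\mathrm{DR}_0$, with multiplicity. (1) $z=0,1,\infty$ are regular singular points of $(\ast)$, and every other point is ordinary. (2) The local exponents are: at $z=0$, $\frac{i\tilde k_j}{2\tilde\beta}$ ($1\le j\le4$); at $z=\infty$ (local coordinate $t=1/z$), $-\frac{ik_j}{2\tilde\beta}$ ($1\le j\le 4$); at $z=1$, $0,1,2,3$. Call $z=0$ (resp. $z=\infty$) nonresonant if its four exponents are distinct and no two of them differ by an integer. (3) If $z=0$ is nonresonant, then for each exponent $\rho$ at $0$ there is a solution $z^{\rho}h(z)$ near $0$ with $h$ holomorphic and $h(0)=1$; likewise at $\infty$ in the coordinate $t=1/z$. At the resonant point $z=1$ there are holomorphic solutions $(z-1)^mh_m(z)$, $h_m(1)=1$, for $m=1,2,3$; every solution holomorphic at $1$ vanishes at $1$; and there is one logarithmic solution $v(z)+\log(z-1)\,w(z)$, where $v,w$ are holomorphic at $1$, $v(1)=1$, and $w$ is a solution with $w(1)=0$, $w'(1)=\frac{\Lambda}{V^2\gamma^2}\neq0$. (4) Take the base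 point $b=\frac12+\frac34i$ and the loops through $b$ that are the counterclockwise circle about $0$, the counterclockwise circle about $1$, and the clockwise circle about $\frac12$ (which goes once around $\infty$). A basis $u=(u_0,\dots,u_3)$ of the germs of solutions at $b$ exists, and for each basis analytic continuation along these loops transforms the row $u$ to $uM_0$, $uM_1$, $uM_\infty$ with uniquely determined matrices. They satisfy $M_\infty M_1M_0=I$, and $M_1$ is conjugate to the Jordan matrix with eigenvalue $1$ and blocks of sizes $1,1,2$. (5) Suppose that $z=0$ and $z=\infty$ are nonresonant. Then $M_0$ and $M_\infty$ are diagonalizable with four distinct eigenvalues, namely the numbers $e^{2\pi i\rho}$, with $\rho$ the exponents at $0$ and at $\infty$ respectively. For a square matrix $A$ let its spectral type be the collection of the non-zero numbers $\dim\ker(A-\nu)^{k+1}-\dim\ker(A-\nu)^{k}$, over all eigenvalues $\nu$ and $k\ge0$. The spectral types of $(M_0,M_1,M_\infty)$ are $((1111),(31),(1111))$. The spaces $Z(M_j)$ of matrices commuting with $M_j$ have dimensions $4,10,4$, so the index of rigidity is $\dim Z(M_0)+\dim Z(M_1)+\dim Z(M_\infty)-4^2=4+10+4-16=2$. If moreover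 $\rho+\sigma\notin\mathbb Z$ for all exponents $\rho$ at $0$ and $\sigma$ at $\infty$, then the equation is rigid: any triple $(N_0,N_1,N_\infty)$ of complex $4\times4$ matrices with $N_\infty N_1N_0=I$ and with $N_j$ conjugate to $M_j$ for each $j$ is simultaneously conjugate to $(M_0,M_1,M_\infty)$. (6) The conditions in (5) (nonresonance at $0$ and at $\infty$, and $\rho+\sigma\notin\mathbb Z$) are generic: the parameters $(V,\beta,g,\mu,\omega,\lambda)$ as above that violate one of them form a set of Lebesgue measure zero in $\mathbb R^6$. -/

import Mathlib

open Filter Topology Polynomial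

noncomputable section

/-! ### Linear differential equations of order four on the Riemann sphere -/

/-- The coefficients `a 0, …, a 3` of the monic equation
`f⁗ + a 3 f‴ + a 2 f″ + a 1 f′ + a 0 f = 0`. -/
abbrev ODE4 : Type := Fin 4 → ℂ → ℂ

namespace ODE4

/-- `f` is holomorphic near `z` and satisfies the equation at `z`. -/
def SolvesAt (a : ODE4) (f : ℂ → ℂ) (z : ℂ) : Prop :=
  AnalyticAt ℂ f z ∧ iteratedDeriv 4 f z + ∑ k : Fin 4, a k z * iteratedDeriv k f z = 0

/-- `z₀` is an ordinary point: every coefficient extends holomorphically to `z₀`. -/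
def IsOrdinary (a : ODE4) (z₀ : ℂ) : Prop :=
  ∀ k, ∃ h : ℂ → ℂ, AnalyticAt ℂ h z₀ ∧ a k =ᶠ[𝓝[≠] z₀] h

/-- `z₀` is a regular singular (Fuchsian) point: it is not ordinary, and `a k` has at `z₀` at most
a pole of order `4 - k`. -/
def IsRegularSingular (a : ODE4) (z₀ : ℂ) : Prop :=
  ¬ a.IsOrdinary z₀ ∧
    ∀ k : Fin 4, ∃ h : ℂ → ℂ, AnalyticAt ℂ h z₀ ∧
      (fun z => (z - z₀) ^ (4 - (k : ℕ)) * a k z) =ᶠ[𝓝[≠] z₀] h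

/-- The equation written in the coordinate `t = 1/z`: the point `z = ∞` of `a` is the point `t = 0`
of `a.atInfinity`. -/
def atInfinity (a : ODE4) : ODE4 :=
  ![fun t => a 0 t⁻¹ / t ^ 8,
    fun t => 24 / t ^ 3 - 6 * a 3 t⁻¹ / t ^ 4 + 2 * a 2 t⁻¹ / t ^ 5 - a 1 t⁻¹ / t ^ 6,
    fun t => 36 / t ^ 2 - 6 * a 3 t⁻¹ / t ^ 3 + a 2 t⁻¹ / t ^ 4,
    fun t => 12 / t - a 3 t⁻¹ / t ^ 2]

/-- `s` is the multiset of local exponents at `z₀`: the roots `ρ`, with multiplicity, of the indicial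
polynomial `ρ(ρ-1)(ρ-2)(ρ-3) + ∑ₖ cₖ ρ(ρ-1)⋯(ρ-k+1)`, where `cₖ = lim (z - z₀)^(4-k) a k z`. -/
def HasExponents (a : ODE4) (z₀ : ℂ) (s : Multiset ℂ) : Prop :=
  ∃ c : Fin 4 → ℂ,
    (∀ k : Fin 4, Tendsto (fun z => (z - z₀) ^ (4 - (k : ℕ)) * a k z) (𝓝[≠] z₀) (𝓝 (c k))) ∧
    s = (descPochhammer ℂ 4 + ∑ k : Fin 4, C (c k) * descPochhammer ℂ k).roots

/-- Near `z₀` there is a solution `(z - z₀)^ρ h(z)` with `h` holomorphic at `z₀`, `h(z₀) = 1`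
(principal branch, off the cut). -/
def HasPowerSolution (a : ODE4) (z₀ ρ : ℂ) : Prop :=
  ∃ h : ℂ → ℂ, AnalyticAt ℂ h z₀ ∧ h z₀ = 1 ∧
    ∀ᶠ z in 𝓝 z₀, z - z₀ ∈ Complex.slitPlane →
      a.SolvesAt (fun ζ => (ζ - z₀) ^ ρ * h ζ) z

/-- Near `z₀` there is a single-valued solution `(z - z₀)^m h(z)` with `h` holomorphic at `z₀`,
`h(z₀) = 1`. -/
def HasHolomorphicSolution (a : ODE4) (z₀ : ℂ) (m : ℕ) : Prop :=
  ∃ h : ℂ → ℂ, AnalyticAt ℂ h z₀ ∧ h z₀ = 1 ∧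
    ∀ᶠ z in 𝓝[≠] z₀, a.SolvesAt (fun ζ => (ζ - z₀) ^ m * h ζ) z

/-- Near `z₀` there is a solution `v(z) + log(z - z₀) w(z)` with `v, w` holomorphic at `z₀`,
`v(z₀) = 1`, and `w` itself a solution with `w(z₀) = 0`, `w′(z₀) = R`
(principal branch, off the cut). -/
def HasLogSolution (a : ODE4) (z₀ R : ℂ) : Prop :=
  ∃ v w : ℂ → ℂ, AnalyticAt ℂ v z₀ ∧ AnalyticAt ℂ w z₀ ∧ v z₀ = 1 ∧ w z₀ = 0 ∧ deriv w z₀ = R ∧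
    (∀ᶠ z in 𝓝[≠] z₀, a.SolvesAt w z) ∧
    ∀ᶠ z in 𝓝 z₀, z - z₀ ∈ Complex.slitPlane →
      a.SolvesAt (fun ζ => v ζ + Complex.log (ζ - z₀) * w ζ) z

/-! ### Analytic continuation and monodromy -/

/-- `u` is a basis of the space of germs of solutions at `b`. -/
def IsLocalBasis (a : ODE4) (b : ℂ) (u : Fin 4 → ℂ → ℂ) : Prop :=
  (∀ i, ∀ᶠ z in 𝓝 b, a.SolvesAt (u i) z) ∧
    ∀ f : ℂ → ℂ, (∀ᶠ z in 𝓝 b, a.SolvesAt f z) →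
      ∃! c : Fin 4 → ℂ, f =ᶠ[𝓝 b] fun z => ∑ i, c i * u i z

/-- `F t`, for `t ∈ [0,1]`, is an analytic continuation of solutions along the path `γ`: the germ
of `F t` at `γ t` is a solution, and for `s` near `t` the germ of `F s` at `γ s` is that of `F t`. -/
def IsContinuation (a : ODE4) (γ : ℝ → ℂ) (F : ℝ → ℂ → ℂ) : Prop :=
  ∀ t ∈ Set.Icc (0 : ℝ) 1, (∀ᶠ z in 𝓝 (γ t), a.SolvesAt (F t) z) ∧
    ∀ᶠ s in 𝓝[Set.Icc 0 1] t, F s =ᶠ[𝓝 (γ s)] F t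

/-- `M` is the monodromy matrix of `u = (u₀, …, u₃)` along the loop `γ`: continuation along `γ`
turns the row `u` into the row `u M`. -/
def IsMonodromyMatrix (a : ODE4) (γ : ℝ → ℂ) (u : Fin 4 → ℂ → ℂ) (M : Matrix (Fin 4) (Fin 4) ℂ) :
    Prop :=
  ∀ j, ∃ F : ℝ → ℂ → ℂ, a.IsContinuation γ F ∧ F 0 =ᶠ[𝓝 (γ 0)] u j ∧
    F 1 =ᶠ[𝓝 (γ 1)] fun z => ∑ i, M i j * u i z

end ODE4

/-- The common base point of the three loops below. -/
def basePoint : ℂ := 1 / 2 + 3 / 4 * Complex.I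

/-- Three loops at `basePoint` in `ℂ ∖ {0, 1}`: the counterclockwise circle with centre `0` (it
encloses `0` and not `1`), the counterclockwise circle with centre `1` (it encloses `1` and not
`0`), and the clockwise circle with centre `1/2` (it encloses both `0` and `1`, so it goes once
around `∞`, counterclockwise in the coordinate `1/z`). The first followed by the second is the
reverse of the third, up to homotopy. -/
def loops : Fin 3 → ℝ → ℂ :=
  ![fun t => basePoint * Complex.exp (2 * Real.pi * Complex.I * t),
    fun t => 1 + (basePoint - 1) * Complex.exp (2 * Real.pi * Complex.I * t),
    fun t => 1 / 2 + (basePoint - 1 / 2) * Complex.exp (-(2 * Real.pi * Complex.I * t))]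

/-- `M 0, M 1, M 2` are the monodromy matrices of `u` around `0, 1, ∞`. -/
def ODE4.IsMonodromyTriple (a : ODE4) (u : Fin 4 → ℂ → ℂ)
    (M : Fin 3 → Matrix (Fin 4) (Fin 4) ℂ) : Prop :=
  ∀ j, a.IsMonodromyMatrix (loops j) u (M j)

/-! ### Local data and rigidity of a tuple of matrices -/

/-- The spectral type of a matrix: for every eigenvalue `μ`, the non-zero numbers among
`dim ker (A - μ)^(k+1) - dim ker (A - μ)^k = rank (A - μ)^k - rank (A - μ)^(k+1)`, all put
together. -/
def spectralType {n : ℕ} (A : Matrix (Fin n) (Fin n) ℂ) : Multiset ℕ :=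
  ∑ μ ∈ A.charpoly.roots.toFinset,
    ((Multiset.range n).map fun k =>
      ((A - Matrix.scalar (Fin n) μ) ^ k).rank -
        ((A - Matrix.scalar (Fin n) μ) ^ (k + 1)).rank).filter (0 < ·)

/-- The dimension of the space of matrices that commute with `A`. -/
def centralizerDim {n : ℕ} (A : Matrix (Fin n) (Fin n) ℂ) : ℕ :=
  Module.finrank ℂ (Subalgebra.centralizer ℂ {A})

/-- The index of rigidity `∑ⱼ dim Z(Mⱼ) - (m - 2) n²` of `m` matrices of size `n`. -/
def rigidityIndex {m n : ℕ} (M : Fin m → Matrix (Fin n) (Fin n) ℂ) : ℤ :=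
  ∑ j, (centralizerDim (M j) : ℤ) - ((m : ℤ) - 2) * (n : ℤ) ^ 2

/-- The local monodromy classes determine the global monodromy: every triple of matrices with the
same relation and with entries conjugate, one by one, to those of `M` is simultaneously conjugate
to `M`. -/
def IsRigidTriple {n : ℕ} (M : Fin 3 → Matrix (Fin n) (Fin n) ℂ) : Prop :=
  ∀ N : Fin 3 → Matrix (Fin n) (Fin n) ℂ, N 2 * N 1 * N 0 = 1 → (∀ j, IsConj (M j) (N j)) →
    ∃ P : (Matrix (Fin n) (Fin n) ℂ)ˣ, ∀ j, SemiconjBy (P : Matrix (Fin n) (Fin n) ℂ) (M j) (N j)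

/-- The Jordan matrix with eigenvalue `1` and blocks of sizes `1, 1, 2`. -/
def jordan112 : Matrix (Fin 4) (Fin 4) ℂ :=
  !![1, 0, 0, 0;
     0, 1, 0, 0;
     0, 0, 1, 1;
     0, 0, 0, 1]

/-- The exponents are distinct, even modulo the integers. -/
def Nonresonant (s : Multiset ℂ) : Prop :=
  s.Nodup ∧ ∀ x ∈ s, ∀ y ∈ s, ∀ n : ℤ, x - y = n → x = y

/-- No sum of an exponent at `0` and an exponent at `∞` is an integer. -/
def NonresonantPair (s₀ sInf : Multiset ℂ) : Prop :=
  ∀ x ∈ s₀, ∀ y ∈ sInf, ∀ n : ℤ, x + y ≠ n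

/-! ### The model -/

/-- The parameters of the model: velocity `V`, steepness `β` of the background, the constants `g`,
`μ` of the medium, the frequency `ω`, and the strength `lam` of the nonlinearity. -/
structure Medium where
  V : ℝ
  β : ℝ
  g : ℝ
  μ : ℝ
  ω : ℝ
  lam : ℝ

namespace Medium

variable (p : Medium)

/-- The medium moves (slower than light), the background is not constant and does couple. -/
structure Admissible : Prop where
  V_ne : p.V ≠ 0
  V_lt : |p.V| < 1
  β_ne : p.β ≠ 0
  lam_ne : p.lam ≠ 0

def γ : ℝ := 1 / √(1 - p.V ^ 2)
def βt : ℝ := p.β / p.γ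
def G : ℝ := p.g / (2 * p.βt)
def M : ℝ := p.μ / (2 * p.βt)
def Ω : ℝ := p.ω / (2 * p.βt)
def Λ : ℝ := p.lam / (4 * p.βt ^ 2)

/-- The left-hand side of the fourth-order equation of the model in the comoving coordinate `x`. -/
def modelLHS (F : ℂ → ℂ) (x : ℂ) : ℂ :=
  let V : ℂ := p.V; let γ : ℂ := p.γ; let b : ℂ := p.βt; let g : ℂ := p.g
  let μ : ℂ := p.μ; let ω : ℂ := p.ω; let l : ℂ := p.lam; let i := Complex.I
  let T := Complex.tanh (b * x); let S := 1 / Complex.cosh (b * x) ^ 2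
  V ^ 4 * γ ^ 4 * iteratedDeriv 4 F x + 4 * i * V ^ 3 * ω * γ ^ 4 * iteratedDeriv 3 F x
    + 1 / 2 * γ ^ 2 * iteratedDeriv 2 F x *
        (-l * V ^ 2 * T + 2 * g ^ 2 + l * V ^ 2 - 2 * μ ^ 2 * V ^ 2 - 12 * V ^ 2 * ω ^ 2 * γ ^ 2)
    + i * γ ^ 2 * V * iteratedDeriv 1 F x *
        (i * b * l * V * S + ω * (-l * T + 2 * g ^ 2 + l - 2 * μ ^ 2 - 4 * ω ^ 2 * γ ^ 2))
    + 1 / 2 * γ ^ 2 * F x *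
        (ω ^ 2 * (l * T - 2 * g ^ 2 * V ^ 2 - l + 2 * μ ^ 2 + 2 * ω ^ 2 * γ ^ 2)
          + 2 * b * l * V * S * (b * V * T - i * ω))

/-- The coefficients of `f, f′, f″, f‴, f⁗` in the Fuchsian equation, which is the equation of the
model in the variable `z = -e^{2 β̃ x}`. -/
def fuchsCoeff : Fin 5 → ℂ → ℂ :=
  let V : ℂ := p.V; let γ : ℂ := p.γ; let G : ℂ := p.G; let M : ℂ := p.M
  let Ω : ℂ := p.Ω; let Λ : ℂ := p.Λ; let i := Complex.I
  ![fun z => -G ^ 2 * V ^ 2 * Ω ^ 2 * γ ^ 2 - Ω ^ 2 * γ ^ 2 * (Λ / (1 - z) - M ^ 2)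
      + 2 * Λ * V ^ 2 * γ ^ 2 * z ^ 2 / (1 - z) ^ 3 + Λ * V ^ 2 * γ ^ 2 * z / (1 - z) ^ 2
      + 2 * i * Λ * V * Ω * γ ^ 2 * z / (1 - z) ^ 2 + Ω ^ 4 * γ ^ 4,
    fun z => (2 * i * G ^ 2 * V * Ω * γ ^ 2 + G ^ 2 * γ ^ 2
      + V ^ 2 * γ ^ 2 * (Λ / (1 - z) - M ^ 2) + 2 * i * V * Ω * γ ^ 2 * (Λ / (1 - z) - M ^ 2)
      + 2 * Λ * V ^ 2 * γ ^ 2 * z / (1 - z) ^ 2 - 6 * V ^ 2 * Ω ^ 2 * γ ^ 4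
      + 4 * i * V ^ 3 * Ω * γ ^ 4 + V ^ 4 * γ ^ 4 - 4 * i * V * Ω ^ 3 * γ ^ 4) * z,
    fun z => (G ^ 2 * γ ^ 2 + V ^ 2 * γ ^ 2 * (Λ / (1 - z) - M ^ 2) - 6 * V ^ 2 * Ω ^ 2 * γ ^ 4
      + 12 * i * V ^ 3 * Ω * γ ^ 4 + 7 * V ^ 4 * γ ^ 4) * z ^ 2,
    fun z => (6 * V ^ 4 * γ ^ 4 + 4 * i * V ^ 3 * Ω * γ ^ 4) * z ^ 3,
    fun z => V ^ 4 * γ ^ 4 * z ^ 4]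

/-- The Fuchsian equation, divided by its leading coefficient. -/
def equation : ODE4 := fun k z => p.fuchsCoeff k.castSucc z / p.fuchsCoeff 4 z

/-- `γ² (m (k V + ω)² - g² (k + V ω)² + γ² (k V + ω)⁴)` as a polynomial in the wave number `k`. -/
def dispersion (m : ℝ) : ℂ[X] :=
  C (p.γ ^ 2 : ℂ) *
    (C (m : ℂ) * (X * C (p.V : ℂ) + C (p.ω : ℂ)) ^ 2
      - C (p.g ^ 2 : ℂ) * (X + C (p.V * p.ω : ℂ)) ^ 2
      + (X * C (p.V : ℂ) + C (p.ω : ℂ)) ^ 4 * C (p.γ ^ 2 : ℂ))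

/-- The dispersion relation of the unperturbed medium, `x → +∞`. -/
def DR : ℂ[X] := p.dispersion (p.μ ^ 2)

/-- The dispersion relation of the perturbed medium, `x → -∞`, where the background contributes
`lam` to the equation of motion. -/
def DR₀ : ℂ[X] := p.dispersion (p.μ ^ 2 - p.lam)

/-- The numbers `i k̃ / (2 β̃)`, `k̃` a root of `DR₀`, with multiplicity. -/
def exponentsZero : Multiset ℂ := p.DR₀.roots.map fun k => Complex.I * k / (2 * p.βt)

/-- The numbers `-i k / (2 β̃)`, `k` a root of `DR`, with multiplicity. -/
def exponentsInfinity : Multiset ℂ := p.DR.roots.map fun k => -(Complex.I * k / (2 * p.βt))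

/-- The parameter space is (a part of) `ℝ⁶`. -/
def ofVector (x : Fin 6 → ℝ) : Medium := ⟨x 0, x 1, x 2, x 3, x 4, x 5⟩

end Medium

/-! ### The Fuchsian equation is the equation of the model -/

/-- Chain rule for the `k`-th derivative of `f`. -/
theorem hasDerivAt_iteratedDeriv_comp {f φ : ℂ → ℂ} {φ' y : ℂ} (hf : AnalyticAt ℂ f (φ y))
    (hφ : HasDerivAt φ φ' y) (k : ℕ) :
    HasDerivAt (fun s => iteratedDeriv k f (φ s)) (iteratedDeriv (k + 1) f (φ y) * φ') y := by
  have h1 : HasDerivAt (iteratedDeriv k f) (iteratedDeriv (k + 1) f (φ y)) (φ y) := by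
    rw [iteratedDeriv_succ]
    have : AnalyticAt ℂ (iteratedDeriv k f) (φ y) := by
      rw [iteratedDeriv_eq_iterate]; exact hf.iterated_deriv k
    exact this.differentiableAt.hasDerivAt
  exact h1.comp y hφ

/-- Derivatives of `y ↦ f (-e^{c y})`. -/
theorem iteratedDeriv_comp_neg_exp {f : ℂ → ℂ} (c x : ℂ)
    (hf : AnalyticAt ℂ f (-Complex.exp (c * x))) :
    let z := -Complex.exp (c * x)
    let F := fun y => f (-Complex.exp (c * y))
    let d := fun k => iteratedDeriv k f z
    F x = d 0 ∧ iteratedDeriv 1 F x = c * (z * d 1) ∧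
    iteratedDeriv 2 F x = c ^ 2 * (z * d 1 + z ^ 2 * d 2) ∧
    iteratedDeriv 3 F x = c ^ 3 * (z * d 1 + 3 * z ^ 2 * d 2 + z ^ 3 * d 3) ∧
    iteratedDeriv 4 F x =
      c ^ 4 * (z * d 1 + 7 * z ^ 2 * d 2 + 6 * z ^ 3 * d 3 + z ^ 4 * d 4) := by
  intro z F d
  set φ : ℂ → ℂ := fun y => -Complex.exp (c * y) with hφ
  have hφd : ∀ y, HasDerivAt φ (c * φ y) y := by
    intro y
    have h := (((hasDerivAt_id y).const_mul c).cexp).neg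
    refine h.congr_deriv ?_
    change -(Complex.exp (c * y) * (c * 1)) = c * -Complex.exp (c * y)
    ring
  have hcont : Continuous φ := by fun_prop
  have hev : ∀ᶠ y in 𝓝 x, AnalyticAt ℂ f (φ y) :=
    hcont.continuousAt.eventually hf.eventually_analyticAt
  have hD : ∀ y, AnalyticAt ℂ f (φ y) → ∀ k,
      HasDerivAt (fun s => iteratedDeriv k f (φ s)) (iteratedDeriv (k + 1) f (φ y) * (c * φ y)) y :=
    fun y hy k => hasDerivAt_iteratedDeriv_comp hy (hφd y) k
  have e1 : iteratedDeriv 1 F =ᶠ[𝓝 x] fun y => c * (φ y * iteratedDeriv 1 f (φ y)) := by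
    filter_upwards [hev] with y hy
    rw [iteratedDeriv_one]
    have := hD y hy 0
    simp only [iteratedDeriv_zero] at this
    rw [show F = fun s => f (φ s) from rfl, this.deriv]; ring
  have e2 : iteratedDeriv 2 F =ᶠ[𝓝 x] fun y => c ^ 2 * (φ y * iteratedDeriv 1 f (φ y)
      + φ y ^ 2 * iteratedDeriv 2 f (φ y)) := by
    filter_upwards [e1.eventuallyEq_nhds, hev] with y hy hy'
    rw [iteratedDeriv_succ, hy.deriv_eq]
    refine (((hφd y).mul (hD y hy' 1)).const_mul c).deriv.trans ?_
    ring
  have e3 : iteratedDeriv 3 F =ᶠ[𝓝 x] fun y => c ^ 3 * (φ y * iteratedDeriv 1 f (φ y)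
      + 3 * φ y ^ 2 * iteratedDeriv 2 f (φ y) + φ y ^ 3 * iteratedDeriv 3 f (φ y)) := by
    filter_upwards [e2.eventuallyEq_nhds, hev] with y hy hy'
    rw [iteratedDeriv_succ, hy.deriv_eq]
    refine ((((hφd y).mul (hD y hy' 1)).add (((hφd y).pow 2).mul (hD y hy' 2))).const_mul
      (c ^ 2)).deriv.trans ?_
    simp only [Pi.pow_apply]; push_cast; ring
  have e4 : iteratedDeriv 4 F x = c ^ 4 * (φ x * iteratedDeriv 1 f (φ x)
      + 7 * φ x ^ 2 * iteratedDeriv 2 f (φ x) + 6 * φ x ^ 3 * iteratedDeriv 3 f (φ x)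
      + φ x ^ 4 * iteratedDeriv 4 f (φ x)) := by
    have hx := hev.self_of_nhds
    rw [iteratedDeriv_succ, e3.deriv_eq]
    refine ((((hφd x).mul (hD x hx 1)).add ((((hφd x).pow 2).const_mul 3).mul (hD x hx 2))).add
      (((hφd x).pow 3).mul (hD x hx 3)) |>.const_mul (c ^ 3)).deriv.trans ?_
    simp only [Pi.pow_apply]; push_cast; ring
  exact ⟨by simp [F, d, z], e1.eq_of_nhds, e2.eq_of_nhds, e3.eq_of_nhds, e4⟩

namespace Medium

/-- The change of variable `z = -e^{2 β̃ x}` turns the equation of the model into the Fuchsian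
equation. -/
theorem modelLHS_comp (p : Medium) (hp : p.Admissible) (f : ℂ → ℂ) (x : ℂ)
    (hx : Complex.exp (2 * p.βt * x) ≠ -1)
    (hf : AnalyticAt ℂ f (-Complex.exp (2 * p.βt * x))) :
    p.modelLHS (fun y => f (-Complex.exp (2 * p.βt * y))) x =
      (2 * p.βt) ^ 4 * ∑ k : Fin 5, p.fuchsCoeff k (-Complex.exp (2 * p.βt * x)) *
        iteratedDeriv k f (-Complex.exp (2 * p.βt * x)) := by
  obtain ⟨h0, h1, h2, h3, h4⟩ := iteratedDeriv_comp_neg_exp (2 * (p.βt : ℂ)) x hf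
  have hb : (p.βt : ℂ) ≠ 0 := by
    have hV := (abs_lt.mp hp.V_lt)
    have : 0 < 1 - p.V ^ 2 := by nlinarith [hV.1, hV.2]
    have h : p.βt ≠ 0 := by
      unfold βt γ; exact div_ne_zero hp.β_ne (by positivity)
    exact_mod_cast h
  have hE : Complex.exp (2 * p.βt * x) = Complex.exp (p.βt * x) ^ 2 := by
    rw [← Complex.exp_nat_mul]; congr 1; push_cast; ring
  have hw : Complex.exp (p.βt * x) ≠ 0 := Complex.exp_ne_zero _
  have hz1 : Complex.exp (p.βt * x) ^ 2 + 1 ≠ 0 := by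
    rw [hE] at hx
    intro h; exact hx (by linear_combination h)
  have hS : 1 / Complex.cosh (p.βt * x) ^ 2 =
      4 * Complex.exp (p.βt * x) ^ 2 / (Complex.exp (p.βt * x) ^ 2 + 1) ^ 2 := by
    rw [Complex.cosh, Complex.exp_neg]; field_simp; norm_num
  have hT : Complex.tanh (p.βt * x) =
      (Complex.exp (p.βt * x) ^ 2 - 1) / (Complex.exp (p.βt * x) ^ 2 + 1) := by
    rw [Complex.tanh_eq_sinh_div_cosh, Complex.sinh, Complex.cosh, Complex.exp_neg]
    field_simp
  unfold modelLHS
  simp only at h0 h1 h2 h3 h4 ⊢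
  rw [h1, h2, h3, h4, hS, hT]
  simp only [Fin.sum_univ_five, fuchsCoeff, G, M, Ω, Λ, hE]
  generalize Complex.exp (p.βt * x) = w at *
  have hz2 : 1 - -w ^ 2 ≠ 0 := by
    intro h; exact hz1 (by linear_combination h)
  have hz3 : 1 - -w ^ 2 = w ^ 2 + 1 := by ring
  simp [hz3]
  field_simp
  ring_nf
  simp [Complex.I_sq]
  ring

end Medium

end

noncomputable section

/-! ### Power series of one complex variable -/

/-! The proof has four independent ingredients.

Local theory. At each of `0`, `1`, `∞` the equation has the form `∑ (z - z₀)^k b k f⁽ᵏ⁾ = 0` with `b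
k` holomorphic and `b 4 = 1` (`ODE4.HasFuchsianForm`). Its exponents are the roots of `fallingSum (b
· z₀)`; at `0` and `∞` a linear substitution turns this polynomial into the dispersion relations.
Conjugation by `(z - z₀)^ρ` shifts the indicial polynomial by `ρ`, so the whole Frobenius method
reduces to one statement: an inhomogeneous Fuchsian equation without natural exponents is solvable
by a convergent series (`exists_analytic_fuchsOp_eq`). At `1` the exponents are `0, 1, 2, 3`. The
only singular term of the equation there is `Λ/(1 - z)` multiplied by `f`, and this product is
holomorphic as soon as `f` vanishes at `1`; hence the powers `(z - 1)^m`, `m = 1, 2, 3`, meet no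
obstruction. The constant `1` does meet one, of size `-2Λ/(V²γ²) ≠ 0`, and a logarithm is needed to
remove it (`exists_log_solution`).

Monodromy. The plane slit along `[0, ∞)`, along `(-∞, 0] ∪ [1, ∞)` or along `(-∞, 1]` is
star-shaped, so by Picard iteration a basis of germs at the base point extends to each of the three.
The extensions coincide in the upper half-plane, and the matrices that relate them in the lower
half-plane are the three monodromy matrices: each loop spends its first half in one slit plane, its
second half in the next one, and changes over below the real axis (`ODE4.Crossing`). The relation `M
2 * M 1 * M 0 = 1` is then the cocycle identity of three changes of basis, with no appeal to
homotopy. A local solution `z^ρ h` gives an eigenvector, because the two branches of `z^ρ` that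
agree above the axis differ by `e^{2πiρ}` below it; the logarithmic solution gives the Jordan block.

Rigidity. `M 1 - 1` has rank one, so in an eigenbasis of `M 0` the product `M 1 * M 0` is `diag α +
x yᵀ`. It is inverse to `M 2`, so its characteristic polynomial is known, and evaluation at `α i`
yields `x i * y i`. If `α i * δ j ≠ 1` for all eigenvalues `δ j` of `M 2`, these products do not
vanish, and then they determine `(x, y)` up to a diagonal change of basis
(`isRigidTriple_of_isConj`).

Genericity. Up to a factor both dispersion relations are `m P(k) - Q(k)`, linear in `m = μ²` or `m =
μ² - λ`, and `P`, `Q` have no common zero when `g ω ≠ 0`. Each single resonance imposes two such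
equations on `k`; eliminating `m` leaves a non-zero polynomial in `k`, hence finitely many `m`. The
exceptional set meets every line in the direction of `μ` or `λ` in a countable set, and Fubini's
theorem concludes (`Medium.ae_generic`). -/

theorem HasSum.of_eq_terms {u v : ℕ → ℂ} {a : ℂ} (h : HasSum u a) (e : ∀ n, u n = v n) :
    HasSum v a := (funext e : u = v) ▸ h

/-- `f` is the sum of the power series with coefficients `c` on the ball of radius `r`. -/
def IsTaylor (z₀ : ℂ) (r : ℝ) (c : ℕ → ℂ) (f : ℂ → ℂ) : Prop :=
  ∀ z ∈ Metric.ball z₀ r, HasSum (fun n => c n * (z - z₀) ^ n) (f z)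

namespace IsTaylor

variable {z₀ : ℂ} {r : ℝ} {c d : ℕ → ℂ} {f g : ℂ → ℂ}

theorem mono {r' : ℝ} (h : IsTaylor z₀ r c f) (hr : r' ≤ r) : IsTaylor z₀ r' c f :=
  fun z hz => h z (Metric.ball_subset_ball hr hz)

theorem summable_norm (h : IsTaylor z₀ r c f) {x : ℝ} (h0 : 0 ≤ x) (hx : x < r) :
    Summable fun n => ‖c n‖ * x ^ n := by
  have := (h (z₀ + x) (by simp [abs_of_nonneg h0, hx])).summable.norm
  simpa [abs_of_nonneg h0] using this

theorem apply_center (h : IsTaylor z₀ r c f) (hr : 0 < r) : f z₀ = c 0 := by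
  have h1 := h z₀ (Metric.mem_ball_self hr)
  have h2 : HasSum (fun n => c n * (z₀ - z₀) ^ n) (c 0) := by
    have := hasSum_single (f := fun n => c n * (z₀ - z₀) ^ n) 0 (by
      intro n hn; simp [hn])
    simpa using this
  exact h1.unique h2

theorem eqOn_tsum (h : IsTaylor z₀ r c f) :
    Set.EqOn f (fun z => ∑' n, c n * (z - z₀) ^ n) (Metric.ball z₀ r) :=
  fun z hz => (h z hz).tsum_eq.symm

/-- Termwise differentiation by the Weierstrass test: on a ball of radius `x` with `dist z z₀ < x <
r` the terms are dominated by the summable `‖c n‖ * x ^ n`. -/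
theorem deriv_aux (h : IsTaylor z₀ r c f) {z : ℂ} (hz : z ∈ Metric.ball z₀ r) :
    HasSum (fun n => c n * (n * (z - z₀) ^ (n - 1))) (deriv f z) ∧ DifferentiableAt ℂ f z := by
  obtain ⟨x, hx1, hx2⟩ := exists_between (Metric.mem_ball.1 hz)
  have hx0 : 0 ≤ x := dist_nonneg.trans hx1.le
  have hu := h.summable_norm hx0 hx2
  have hle : ∀ (i : ℕ) (w : ℂ), w ∈ Metric.ball z₀ x → ‖c i * (w - z₀) ^ i‖ ≤ ‖c i‖ * x ^ i := by
    intro i w hw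
    rw [norm_mul, norm_pow]
    gcongr
    simpa [dist_eq_norm] using (Metric.mem_ball.1 hw).le
  have hd : ∀ i : ℕ, DifferentiableOn ℂ (fun w => c i * (w - z₀) ^ i) (Metric.ball z₀ x) := by
    intro i; fun_prop
  have hzx : z ∈ Metric.ball z₀ x := hx1
  have h1 := Complex.hasSum_deriv_of_summable_norm hu hd Metric.isOpen_ball hle hzx
  have h2 := Complex.differentiableOn_tsum_of_summable_norm hu hd Metric.isOpen_ball hle
  have he : f =ᶠ[𝓝 z] fun z => ∑' n, c n * (z - z₀) ^ n :=
    (h.eqOn_tsum).eventuallyEq_of_mem (Metric.isOpen_ball.mem_nhds hz)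
  refine ⟨?_, ?_⟩
  · rw [he.deriv_eq]
    refine h1.of_eq_terms fun n => ?_
    have : HasDerivAt (fun w : ℂ => c n * (w - z₀) ^ n) (c n * (n * (z - z₀) ^ (n - 1) * 1)) z :=
      (((hasDerivAt_id z).sub_const z₀).pow n).const_mul _
    rw [this.deriv]; ring
  · exact he.differentiableAt_iff.2 (h2.differentiableAt (Metric.isOpen_ball.mem_nhds hzx))

theorem analyticOnNhd (h : IsTaylor z₀ r c f) : AnalyticOnNhd ℂ f (Metric.ball z₀ r) :=
  DifferentiableOn.analyticOnNhd (fun _ hz => (h.deriv_aux hz).2.differentiableWithinAt)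
    Metric.isOpen_ball

/-- The Euler operator is diagonal on power series; this is what makes Fuchsian operators act on
coefficients. -/
theorem euler (h : IsTaylor z₀ r c f) :
    IsTaylor z₀ r (fun n => n * c n) (fun z => (z - z₀) * deriv f z) := by
  intro z hz
  have := (h.deriv_aux hz).1.mul_left (z - z₀)
  refine this.of_eq_terms fun n => ?_
  cases n with
  | zero => simp
  | succ n => simp only [Nat.add_sub_cancel]; ring

theorem add (hf : IsTaylor z₀ r c f) (hg : IsTaylor z₀ r d g) :
    IsTaylor z₀ r (fun n => c n + d n) (fun z => f z + g z) := by
  intro z hz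
  simpa [add_mul] using (hf z hz).add (hg z hz)

theorem const_mul (hf : IsTaylor z₀ r c f) (a : ℂ) :
    IsTaylor z₀ r (fun n => a * c n) (fun z => a * f z) := by
  intro z hz
  simpa [mul_assoc] using (hf z hz).mul_left a

theorem sum {ι : Type*} (s : Finset ι) {c : ι → ℕ → ℂ} {f : ι → ℂ → ℂ}
    (h : ∀ i ∈ s, IsTaylor z₀ r (c i) (f i)) :
    IsTaylor z₀ r (fun n => ∑ i ∈ s, c i n) (fun z => ∑ i ∈ s, f i z) := by
  intro z hz
  simpa [Finset.sum_mul] using hasSum_sum fun i hi => h i hi z hz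

theorem mul (hf : IsTaylor z₀ r c f) (hg : IsTaylor z₀ r d g) :
    IsTaylor z₀ r (fun n => ∑ p ∈ Finset.HasAntidiagonal.antidiagonal n, c p.1 * d p.2) (fun z => f z * g z) := by
  intro z hz
  have h1 := (hf z hz).summable.norm
  have h2 := (hg z hz).summable.norm
  have h3 := summable_norm_sum_mul_antidiagonal_of_summable_norm h1 h2
  have h4 := tsum_mul_tsum_eq_tsum_sum_antidiagonal_of_summable_norm h1 h2
  rw [(hf z hz).tsum_eq, (hg z hz).tsum_eq] at h4
  dsimp only
  rw [h4]
  refine h3.of_norm.hasSum.of_eq_terms fun n => ?_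
  rw [Finset.sum_mul]
  refine Finset.sum_congr rfl fun p hp => ?_
  rw [← Finset.HasAntidiagonal.mem_antidiagonal.1 hp, pow_add]; ring

/-- With `θ` the Euler operator at `z₀`, `(z - z₀)^(k+1) D^(k+1) = (θ - k) (z - z₀)^k D^k`; the
induction turns the eigenvalue `n` of `θ` into the falling factorial of `n`. -/
theorem iteratedDeriv (h : IsTaylor z₀ r c f) (k : ℕ) :
    IsTaylor z₀ r (fun n => (descPochhammer ℂ k).eval (n : ℂ) * c n)
      (fun z => (z - z₀) ^ k * _root_.iteratedDeriv k f z) := by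
  induction k with
  | zero => simpa using h
  | succ k ih =>
    have h1 := ih.euler.add (ih.const_mul (-k))
    intro z hz
    have e : ∀ n : ℕ, (n : ℂ) * ((descPochhammer ℂ k).eval (n : ℂ) * c n)
        + -k * ((descPochhammer ℂ k).eval (n : ℂ) * c n)
        = (descPochhammer ℂ (k + 1)).eval (n : ℂ) * c n := by
      intro n
      rw [descPochhammer_succ_right, eval_mul, eval_sub, eval_X, eval_natCast]; ring
    have h2 := h1 z hz
    simp only [e] at h2
    suffices hs : (z - z₀) ^ (k + 1) * _root_.iteratedDeriv (k + 1) f z = (z - z₀) * deriv (fun z => (z - z₀) ^ k * _root_.iteratedDeriv k f z) z +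
        -↑k * ((z - z₀) ^ k * _root_.iteratedDeriv k f z) by rwa [← hs] at h2
    · have hf : AnalyticAt ℂ f z := h.analyticOnNhd z hz
      have hk : DifferentiableAt ℂ (_root_.iteratedDeriv k f) z := by
        rw [iteratedDeriv_eq_iterate]; exact (hf.iterated_deriv k).differentiableAt
      have hd := (((hasDerivAt_id z).sub_const z₀).pow k).mul hk.hasDerivAt
      have hd' : deriv (fun z => (z - z₀) ^ k * _root_.iteratedDeriv k f z) z = _ := hd.deriv
      rw [hd', iteratedDeriv_succ]
      cases k with
      | zero => simp
      | succ k => simp; ring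

end IsTaylor

theorem AnalyticAt.exists_isTaylor {f : ℂ → ℂ} {z₀ : ℂ} (hf : AnalyticAt ℂ f z₀) :
    ∃ c : ℕ → ℂ, ∃ r > 0, IsTaylor z₀ r c f := by
  obtain ⟨p, hp⟩ := hf
  have h := hasFPowerSeriesAt_iff'.1 hp
  obtain ⟨r, hr, h⟩ := Metric.eventually_nhds_iff_ball.1 h
  exact ⟨fun n => p.coeff n, r, hr, fun z hz => by simpa [mul_comm] using h z hz⟩

theorem exists_isTaylor_of_norm_le {c : ℕ → ℂ} {K R : ℝ} (hR : 0 < R)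
    (h : ∀ n, ‖c n‖ ≤ K * R ^ n) (z₀ : ℂ) : ∃ f, IsTaylor z₀ R⁻¹ c f := by
  refine ⟨fun z => ∑' n, c n * (z - z₀) ^ n, fun z hz => Summable.hasSum ?_⟩
  have hz' : R * ‖z - z₀‖ < 1 := by
    have := Metric.mem_ball.1 hz
    rw [dist_eq_norm] at this
    calc R * ‖z - z₀‖ < R * R⁻¹ := by gcongr
      _ = 1 := mul_inv_cancel₀ hR.ne'
  refine Summable.of_norm_bounded
    (g := fun n => K * (R * ‖z - z₀‖) ^ n)
    ((summable_geometric_of_lt_one (by positivity) hz').mul_left K) fun n => ?_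
  rw [norm_mul, norm_pow, mul_pow, ← mul_assoc]
  gcongr
  exact h n

/-- A discrete Grönwall bound. -/
theorem exists_geometric_bound {x : ℕ → ℝ} {K : ℝ} (hK : 0 ≤ K) (h : ∀ n, x n ≤ K * (1 + ∑ j ∈ Finset.range n, x j)) (n : ℕ) : x n ≤ K * (1 + K) ^ n := by
  -- Adding the next term multiplies `1 + ∑ x j` by at most `1 + K`.
  have hS : ∀ n, 1 + ∑ j ∈ Finset.range n, x j ≤ (1 + K) ^ n := by
    intro n
    induction n with
    | zero => simp
    | succ n ih =>
      rw [Finset.sum_range_succ, pow_succ]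
      nlinarith [h n]
  exact (h n).trans (by gcongr; exact hS n)

/-! ### Fuchsian operators of order four -/

/-- `∑ₖ (z - z₀)^k bₖ(z) f⁽ᵏ⁾(z)`. -/
def fuchsOp (z₀ : ℂ) (b : ℕ → ℂ → ℂ) (f : ℂ → ℂ) (z : ℂ) : ℂ :=
  ∑ k ∈ Finset.range 5, (z - z₀) ^ k * b k z * iteratedDeriv k f z

/-- The value at `x` of the polynomial with coefficients `β` in the basis of falling factorials. -/
def fallingSum (β : ℕ → ℂ) (x : ℂ) : ℂ :=
  ∑ k ∈ Finset.range 5, β k * (descPochhammer ℂ k).eval x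

theorem descPochhammer_eval_small (x : ℂ) :
    (descPochhammer ℂ 0).eval x = 1 ∧ (descPochhammer ℂ 1).eval x = x ∧
    (descPochhammer ℂ 2).eval x = x * (x - 1) ∧
    (descPochhammer ℂ 3).eval x = x * (x - 1) * (x - 2) ∧
    (descPochhammer ℂ 4).eval x = x * (x - 1) * (x - 2) * (x - 3) := by
  simp [descPochhammer_succ_right]

theorem fallingSum_eq (β : ℕ → ℂ) (x : ℂ) :
    fallingSum β x = β 0 + β 1 * x + β 2 * (x * (x - 1)) + β 3 * (x * (x - 1) * (x - 2))
      + β 4 * (x * (x - 1) * (x - 2) * (x - 3)) := by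
  obtain ⟨h0, h1, h2, h3, h4⟩ := descPochhammer_eval_small x
  simp [fallingSum, Finset.sum_range_succ, h2, h3, h4]

theorem norm_descPochhammer_le (j : ℕ) {k : ℕ} (hk : k ∈ Finset.range 5) :
    ‖(descPochhammer ℂ k).eval (j : ℂ)‖ ≤ ((j : ℝ) + 1) ^ 4 := by
  rw [descPochhammer_eval_eq_descFactorial]
  rw [Complex.norm_natCast]
  have h1 : j.descFactorial k ≤ (j + 1) ^ 4 :=
    (Nat.descFactorial_le_pow j k).trans ((Nat.pow_le_pow_left (Nat.le_succ j) k).trans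
      (Nat.pow_le_pow_right (Nat.succ_pos j) (by simpa using Nat.lt_succ_iff.1 (Finset.mem_range.1 hk))))
  exact_mod_cast h1

/-- The quotient by `(n + 1)^4` tends to `β 4 ≠ 0` and never vanishes, so its inverse is a
convergent, hence bounded, sequence. -/
theorem exists_le_norm_fallingSum {β : ℕ → ℂ} (h4 : β 4 ≠ 0)
    (hI : ∀ n : ℕ, fallingSum β n ≠ 0) :
    ∃ K : ℝ, 0 ≤ K ∧ ∀ n : ℕ, ((n : ℝ) + 1) ^ 4 ≤ K * ‖fallingSum β n‖ := by
  have hu : Tendsto (fun n : ℕ => (1 : ℂ) / ((n : ℂ) + 1)) atTop (𝓝 0) :=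
    tendsto_one_div_add_atTop_nhds_zero_nat
  have hne : ∀ n : ℕ, (n : ℂ) + 1 ≠ 0 := fun n => by exact_mod_cast Nat.succ_ne_zero n
  have hlim : Tendsto (fun n : ℕ => fallingSum β n / ((n : ℂ) + 1) ^ 4) atTop (𝓝 (β 4)) := by
    -- With `u = 1/(n+1)` one has `n - j = (1 - (j+1) u) / u`, so the quotient is a polynomial in
    -- `u`.
    have he : ∀ n : ℕ, fallingSum β n / ((n : ℂ) + 1) ^ 4 = (fun u : ℂ =>
        β 0 * u ^ 4 + β 1 * (1 - u) * u ^ 3 + β 2 * ((1 - u) * (1 - 2 * u)) * u ^ 2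
        + β 3 * ((1 - u) * (1 - 2 * u) * (1 - 3 * u)) * u
        + β 4 * ((1 - u) * (1 - 2 * u) * (1 - 3 * u) * (1 - 4 * u))) (1 / ((n : ℂ) + 1)) := by
      intro n
      have := hne n
      rw [fallingSum_eq]
      field_simp
      ring
    simp_rw [he]
    have hc : Continuous (fun u : ℂ =>
        β 0 * u ^ 4 + β 1 * (1 - u) * u ^ 3 + β 2 * ((1 - u) * (1 - 2 * u)) * u ^ 2
        + β 3 * ((1 - u) * (1 - 2 * u) * (1 - 3 * u)) * u
        + β 4 * ((1 - u) * (1 - 2 * u) * (1 - 3 * u) * (1 - 4 * u))) := by fun_prop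
    have := (hc.tendsto 0).comp hu
    simpa [Function.comp_def] using this
  have hinv := (hlim.inv₀ h4).norm
  obtain ⟨K, hK⟩ := (hinv.bddAbove_range)
  refine ⟨K, (norm_nonneg _).trans (hK ⟨0, rfl⟩), fun n => ?_⟩
  have h1 : ‖(fallingSum β n / ((n : ℂ) + 1) ^ 4)⁻¹‖ ≤ K := hK ⟨n, rfl⟩
  have h2 : ‖((n : ℂ) + 1) ^ 4‖ = ((n : ℝ) + 1) ^ 4 := by
    rw [norm_pow]; congr 1; exact_mod_cast Complex.norm_natCast (n + 1)
  rw [inv_div, norm_div, h2, div_le_iff₀ (norm_pos_iff.2 (hI n))] at h1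
  exact h1

theorem exists_strongRec (F : ∀ n : ℕ, (Fin n → ℂ) → ℂ) :
    ∃ c : ℕ → ℂ, ∀ n, c n = F n fun j => c j := by
  refine ⟨wellFounded_lt.fix fun n ih => F n fun j => ih j j.2, fun n => ?_⟩
  rw [WellFounded.fix_eq]

/-- The formal recursion of the Frobenius method, with its majorant. -/
theorem exists_frobenius_coeff {β : ℕ → ℕ → ℂ} {ρ : ℕ → ℂ} {C R : ℝ} (hR : 0 < R)
    (hβ : ∀ k ∈ Finset.range 5, ∀ n, ‖β k n‖ ≤ C * R ^ n) (hρ : ∀ n, ‖ρ n‖ ≤ C * R ^ n)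
    (h4 : β 4 0 ≠ 0) (hI : ∀ n : ℕ, fallingSum (fun k => β k 0) n ≠ 0) :
    ∃ c : ℕ → ℂ, (∃ K R' : ℝ, 0 < R' ∧ ∀ n, ‖c n‖ ≤ K * R' ^ n) ∧
      ∀ n, ∑ k ∈ Finset.range 5, ∑ p ∈ Finset.HasAntidiagonal.antidiagonal n,
        β k p.1 * ((descPochhammer ℂ k).eval (p.2 : ℂ) * c p.2) = ρ n := by
  -- `E i j` is the factor with which the coefficient `c j` enters the coefficient of order `i + j`
  -- of the image; `E 0 n` is the indicial value at `n`.
  set E : ℕ → ℕ → ℂ := fun i j => ∑ k ∈ Finset.range 5, β k i * (descPochhammer ℂ k).eval (j : ℂ)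
    with hE
  obtain ⟨c, hc⟩ := exists_strongRec fun n ih =>
    (ρ n - ∑ j : Fin n, E (n - j) j * ih j) / fallingSum (fun k => β k 0) n
  have hc' : ∀ n : ℕ, fallingSum (fun k => β k 0) n * c n
      = ρ n - ∑ j ∈ Finset.range n, E (n - j) j * c j := by
    intro n
    rw [hc n, mul_div_cancel₀ _ (hI n), Finset.sum_range fun j => E (n - j) j * c j]
  have hC : 0 ≤ C := by simpa using (norm_nonneg _).trans (hρ 0)
  refine ⟨c, ?_, fun n => ?_⟩
  · obtain ⟨K, hK, hKI⟩ := exists_le_norm_fallingSum h4 hI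
    have hEb : ∀ n, ∀ j ∈ Finset.range n, ‖E (n - j) j‖ ≤ 5 * C * R ^ (n - j) * ((n : ℝ) + 1) ^ 4 := by
      intro n j hj
      have hjn : (j : ℝ) ≤ n := by exact_mod_cast (Finset.mem_range.1 hj).le
      calc ‖E (n - j) j‖ ≤ ∑ k ∈ Finset.range 5, C * R ^ (n - j) * ((n : ℝ) + 1) ^ 4 := by
            refine norm_sum_le_of_le _ fun k hk => ?_
            rw [norm_mul]
            gcongr
            · exact hβ k hk _
            · exact (norm_descPochhammer_le j hk).trans (by gcongr)
        _ = _ := by simp; ring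
    -- The factor `(n + 1)^4` in the bound for `E` cancels against the lower bound for the indicial
    -- value. After weighting by `R ^ n` what is left is the hypothesis of `exists_geometric_bound`.
    have hx : ∀ n, ‖c n‖ / R ^ n ≤ 5 * C * K * (1 + ∑ j ∈ Finset.range n, ‖c j‖ / R ^ j) := by
      intro n
      have hn4 : (0 : ℝ) < ((n : ℝ) + 1) ^ 4 := by positivity
      have hn1 : (1 : ℝ) ≤ ((n : ℝ) + 1) ^ 4 := one_le_pow₀ (by linarith [n.cast_nonneg (α := ℝ)])
      have h1 : ‖fallingSum (fun k => β k 0) n‖ * ‖c n‖ ≤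
          5 * C * R ^ n * ((n : ℝ) + 1) ^ 4 * (1 + ∑ j ∈ Finset.range n, ‖c j‖ / R ^ j) := by
        rw [← norm_mul, hc']
        refine (norm_sub_le _ _).trans ?_
        rw [mul_add, mul_one, Finset.mul_sum]
        refine add_le_add ((hρ n).trans ?_) (norm_sum_le_of_le _ fun j hj => ?_)
        · have : 0 ≤ C * R ^ n := by positivity
          nlinarith
        · rw [norm_mul]
          calc ‖E (n - j) j‖ * ‖c j‖ ≤ 5 * C * R ^ (n - j) * ((n : ℝ) + 1) ^ 4 * ‖c j‖ := by
                gcongr; exact hEb n j hj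
            _ = _ := by
                have : R ^ n = R ^ (n - j) * R ^ j := by
                  rw [← pow_add, Nat.sub_add_cancel (Finset.mem_range.1 hj).le]
                rw [this]; field_simp
      rw [div_le_iff₀ (by positivity)]
      have h2 := mul_le_mul_of_nonneg_right (hKI n) (norm_nonneg (c n))
      have h3 := mul_le_mul_of_nonneg_left h1 hK
      refine le_of_mul_le_mul_left ?_ hn4
      nlinarith
    have hb := exists_geometric_bound (by positivity) hx
    refine ⟨5 * C * K, (1 + 5 * C * K) * R, by positivity, fun n => ?_⟩
    have := (div_le_iff₀ (by positivity)).1 (hb n)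
    rw [mul_pow]; linarith
  · have h1 : ∑ k ∈ Finset.range 5, ∑ p ∈ Finset.HasAntidiagonal.antidiagonal n,
        β k p.1 * ((descPochhammer ℂ k).eval (p.2 : ℂ) * c p.2)
        = ∑ p ∈ Finset.HasAntidiagonal.antidiagonal n, E p.1 p.2 * c p.2 := by
      rw [Finset.sum_comm]
      refine Finset.sum_congr rfl fun p _ => ?_
      rw [hE, Finset.sum_mul]
      exact Finset.sum_congr rfl fun k _ => by ring
    rw [h1, ← Finset.Nat.sum_antidiagonal_swap,
      Finset.Nat.sum_antidiagonal_eq_sum_range_succ_mk]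
    simp only [Prod.fst_swap, Prod.snd_swap]
    rw [Finset.sum_range_succ, Nat.sub_self]
    have := hc' n
    have hE0 : E 0 n = fallingSum (fun k => β k 0) n := rfl
    rw [hE0, this]; ring

theorem IsTaylor.exists_bound {z₀ : ℂ} {r r' : ℝ} {c : ℕ → ℂ} {f : ℂ → ℂ}
    (h : IsTaylor z₀ r c f) (h0 : 0 < r') (hr : r' < r) :
    ∃ C, ∀ n, ‖c n‖ ≤ C * (r'⁻¹) ^ n := by
  have hs := h.summable_norm h0.le hr
  refine ⟨∑' n, ‖c n‖ * r' ^ n, fun n => ?_⟩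
  have := hs.le_tsum n fun j _ => by positivity
  rw [inv_pow, ← div_eq_mul_inv, le_div_iff₀ (by positivity)]
  exact this

/-- The inhomogeneous Fuchsian equation is solvable in holomorphic functions as soon as no
natural number is an exponent. -/
theorem exists_analytic_fuchsOp_eq {z₀ : ℂ} {b : ℕ → ℂ → ℂ} {r : ℂ → ℂ}
    (hb : ∀ k, AnalyticAt ℂ (b k) z₀) (hr : AnalyticAt ℂ r z₀) (h4 : b 4 z₀ ≠ 0)
    (hI : ∀ n : ℕ, fallingSum (fun k => b k z₀) n ≠ 0) :
    ∃ y : ℂ → ℂ, AnalyticAt ℂ y z₀ ∧ ∀ᶠ z in 𝓝 z₀, fuchsOp z₀ b y z = r z := by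
  choose β s hs hβ using fun k => (hb k).exists_isTaylor
  obtain ⟨ρ, t, ht, hρ⟩ := hr.exists_isTaylor
  obtain ⟨x, hx0, hxs, hxt⟩ : ∃ x > 0, (∀ k ∈ Finset.range 5, x < s k) ∧ x < t := by
    have h1 : ∀ᶠ x in 𝓝[>] (0 : ℝ), (∀ k ∈ Finset.range 5, x < s k) ∧ x < t := by
      refine .and ?_ (nhdsWithin_le_nhds (eventually_lt_nhds ht))
      rw [Finset.eventually_all]
      exact fun k _ => nhdsWithin_le_nhds (eventually_lt_nhds (hs k))
    obtain ⟨x, hx, hx0⟩ := (h1.and self_mem_nhdsWithin).exists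
    exact ⟨x, hx0, hx.1, hx.2⟩
  have hbound : ∃ C, (∀ k ∈ Finset.range 5, ∀ n, ‖β k n‖ ≤ C * (x⁻¹) ^ n) ∧
      ∀ n, ‖ρ n‖ ≤ C * (x⁻¹) ^ n := by
    obtain ⟨C₀, hC₀⟩ := hρ.exists_bound hx0 hxt
    have : ∀ k, ∃ C, k ∈ Finset.range 5 → ∀ n, ‖β k n‖ ≤ C * (x⁻¹) ^ n := by
      intro k
      by_cases hk : k ∈ Finset.range 5
      · obtain ⟨C, hC⟩ := (hβ k).exists_bound hx0 (hxs k hk)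
        exact ⟨C, fun _ => hC⟩
      · exact ⟨0, fun h => absurd h hk⟩
    choose C hC using this
    have hpos : ∀ k ∈ Finset.range 5, 0 ≤ C k := fun k hk => by
      simpa using (norm_nonneg _).trans (hC k hk 0)
    have hpos0 : 0 ≤ C₀ := by simpa using (norm_nonneg _).trans (hC₀ 0)
    refine ⟨C₀ + ∑ k ∈ Finset.range 5, C k, fun k hk n => (hC k hk n).trans ?_,
      fun n => (hC₀ n).trans ?_⟩
    · gcongr
      have := Finset.single_le_sum hpos hk
      linarith
    · gcongr
      have := Finset.sum_nonneg hpos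
      linarith
  obtain ⟨C, hC1, hC2⟩ := hbound
  have hβ0 : ∀ k, β k 0 = b k z₀ := fun k => ((hβ k).apply_center (hs k)).symm
  obtain ⟨c, ⟨K, R', hR', hcb⟩, hc⟩ := exists_frobenius_coeff (inv_pos.2 hx0) hC1 hC2
    (by rwa [hβ0]) (by simpa only [hβ0] using hI)
  obtain ⟨y, hy⟩ := exists_isTaylor_of_norm_le hR' hcb z₀
  have hm : 0 < min x R'⁻¹ := lt_min hx0 (inv_pos.2 hR')
  refine ⟨y, hy.analyticOnNhd z₀ (Metric.mem_ball_self (inv_pos.2 hR')), ?_⟩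
  have hL := IsTaylor.sum (Finset.range 5) fun k hk =>
    ((hβ k).mono ((min_le_left x R'⁻¹).trans (hxs k hk).le)).mul
      ((hy.mono (min_le_right x R'⁻¹)).iteratedDeriv k)
  simp only [hc] at hL
  filter_upwards [Metric.ball_mem_nhds z₀ hm] with z hz
  have h1 := hL z hz
  have h2 := (hρ.mono ((min_le_left x R'⁻¹).trans hxt.le)) z hz
  rw [← h1.unique h2, fuchsOp]
  exact Finset.sum_congr rfl fun k _ => by ring

/-! ### Conjugation of Fuchsian operators by powers and logarithms -/

theorem AnalyticAt.contDiffAt_nat {f : ℂ → ℂ} {z : ℂ} (hf : AnalyticAt ℂ f z) (n : ℕ) :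
    ContDiffAt ℂ n f z := hf.contDiffAt

theorem AnalyticAt.iteratedDeriv_analyticAt {f : ℂ → ℂ} {z : ℂ} (hf : AnalyticAt ℂ f z) (n : ℕ) :
    AnalyticAt ℂ (iteratedDeriv n f) z := by
  rw [iteratedDeriv_eq_iterate]; exact hf.iterated_deriv n

theorem fuchsOp_congr {z₀ z : ℂ} {b : ℕ → ℂ → ℂ} {f g : ℂ → ℂ} (h : f =ᶠ[𝓝 z] g) :
    fuchsOp z₀ b f z = fuchsOp z₀ b g z :=
  Finset.sum_congr rfl fun k _ => by rw [(h.iteratedDeriv k).eq_of_nhds]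

theorem fuchsOp_add {z₀ z : ℂ} {b : ℕ → ℂ → ℂ} {f g : ℂ → ℂ} (hf : AnalyticAt ℂ f z)
    (hg : AnalyticAt ℂ g z) :
    fuchsOp z₀ b (fun x => f x + g x) z = fuchsOp z₀ b f z + fuchsOp z₀ b g z := by
  rw [fuchsOp, fuchsOp, fuchsOp, ← Finset.sum_add_distrib]
  refine Finset.sum_congr rfl fun k _ => ?_
  rw [iteratedDeriv_fun_add (hf.contDiffAt_nat k) (hg.contDiffAt_nat k), mul_add]

theorem fuchsOp_const_mul {z₀ z : ℂ} {b : ℕ → ℂ → ℂ} {f : ℂ → ℂ} (c : ℂ) :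
    fuchsOp z₀ b (fun x => c * f x) z = c * fuchsOp z₀ b f z := by
  rw [fuchsOp, fuchsOp, Finset.mul_sum]
  refine Finset.sum_congr rfl fun k _ => ?_
  rw [iteratedDeriv_const_mul_field]; ring

theorem fuchsOp_one {z₀ z : ℂ} {b : ℕ → ℂ → ℂ} : fuchsOp z₀ b (fun _ => 1) z = b 0 z := by
  simp [fuchsOp, iteratedDeriv_const]

theorem fuchsOp_center {z₀ : ℂ} {b : ℕ → ℂ → ℂ} {f : ℂ → ℂ} :
    fuchsOp z₀ b f z₀ = b 0 z₀ * f z₀ := by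
  simp [fuchsOp, Finset.sum_range_succ]

theorem analyticAt_fuchsOp {z₀ z : ℂ} {b : ℕ → ℂ → ℂ} {f : ℂ → ℂ}
    (hb : ∀ k, AnalyticAt ℂ (b k) z) (hf : AnalyticAt ℂ f z) :
    AnalyticAt ℂ (fuchsOp z₀ b f) z := by
  unfold fuchsOp
  refine Finset.analyticAt_fun_sum _ fun k _ => ?_
  have := hf.iteratedDeriv_analyticAt k
  have := hb k
  fun_prop

/-- The coefficients of `h ↦ L(φ h)` when `(z - z₀)^k φ⁽ᵏ⁾ = μ k`. -/
def leibnizCoeff (μ : ℕ → ℂ) (b : ℕ → ℂ → ℂ) (j : ℕ) (z : ℂ) : ℂ :=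
  ∑ k ∈ Finset.range 5, k.choose j * μ (k - j) * b k z

theorem analyticAt_leibnizCoeff {μ : ℕ → ℂ} {b : ℕ → ℂ → ℂ} {z : ℂ}
    (hb : ∀ k, AnalyticAt ℂ (b k) z) (j : ℕ) : AnalyticAt ℂ (leibnizCoeff μ b j) z := by
  unfold leibnizCoeff
  refine Finset.analyticAt_fun_sum _ fun k _ => ?_
  have := hb k
  fun_prop

/-- By Leibniz' rule. Since all derivatives of `φ` are multiples of one value `a`, conjugation by
`φ` stays within Fuchsian operators with the same centre. -/
theorem fuchsOp_mul {z₀ z : ℂ} {b : ℕ → ℂ → ℂ} {φ h : ℂ → ℂ} {μ : ℕ → ℂ} {a : ℂ}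
    (hφ : AnalyticAt ℂ φ z) (hh : AnalyticAt ℂ h z)
    (hμ : ∀ k, (z - z₀) ^ k * iteratedDeriv k φ z = μ k * a) :
    fuchsOp z₀ b (fun x => φ x * h x) z = a * fuchsOp z₀ (leibnizCoeff μ b) h z := by
  have hk := fun k => iteratedDeriv_fun_mul (hφ.contDiffAt_nat k) (hh.contDiffAt_nat k)
  have h0 := hμ 0
  have h1 := hμ 1
  have h2 := hμ 2
  have h3 := hμ 3
  have h4 := hμ 4
  simp only [fuchsOp, leibnizCoeff, hk, Finset.sum_range_succ, Finset.sum_range_zero]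
  simp [Nat.choose] at h0 h1 ⊢
  generalize z - z₀ = s at *
  generalize iteratedDeriv 2 φ z = φ2 at *
  generalize iteratedDeriv 3 φ z = φ3 at *
  generalize iteratedDeriv 4 φ z = φ4 at *
  generalize deriv φ z = φ1 at *
  generalize φ z = φ0 at *
  -- The factor of each hypothesis collects the Leibniz terms in which `φ` is differentiated that
  -- many times; the integers are binomial coefficients.
  linear_combination
    (b 0 z * h z + b 1 z * s * deriv h z + b 2 z * s ^ 2 * iteratedDeriv 2 h z
      + b 3 z * s ^ 3 * iteratedDeriv 3 h z + b 4 z * s ^ 4 * iteratedDeriv 4 h z) * h0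
    + (b 1 z * h z + 2 * b 2 z * s * deriv h z + 3 * b 3 z * s ^ 2 * iteratedDeriv 2 h z
      + 4 * b 4 z * s ^ 3 * iteratedDeriv 3 h z) * h1
    + (b 2 z * h z + 3 * b 3 z * s * deriv h z + 6 * b 4 z * s ^ 2 * iteratedDeriv 2 h z) * h2
    + (b 3 z * h z + 4 * b 4 z * s * deriv h z) * h3
    + b 4 z * h z * h4

/-- `φ` is near `z` a branch of a constant multiple of `(x - z₀)^ρ`. -/
def IsPowerGerm (z₀ ρ : ℂ) (φ : ℂ → ℂ) (z : ℂ) : Prop :=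
  AnalyticAt ℂ φ z ∧ deriv φ =ᶠ[𝓝 z] fun x => ρ / (x - z₀) * φ x

/-- The first-order equation `φ' = ρ φ / (x - z₀)` is all that is used, so the formula holds for
every branch at once. -/
theorem IsPowerGerm.iteratedDeriv {z₀ ρ z : ℂ} {φ : ℂ → ℂ} (h : IsPowerGerm z₀ ρ φ z)
    (hz : z ≠ z₀) (k : ℕ) :
    (z - z₀) ^ k * _root_.iteratedDeriv k φ z = (descPochhammer ℂ k).eval ρ * φ z := by
  obtain ⟨ha, hd⟩ := h
  have key : _root_.iteratedDeriv k φ =ᶠ[𝓝 z]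
      fun x => (descPochhammer ℂ k).eval ρ * φ x / (x - z₀) ^ k := by
    induction k with
    | zero => simp
    | succ k ih =>
      filter_upwards [ih.eventuallyEq_nhds, hd, ha.eventually_analyticAt,
        isOpen_ne.eventually_mem hz] with x hx hdx hax hxz
      have hx0 : x - z₀ ≠ 0 := sub_ne_zero.2 hxz
      rw [iteratedDeriv_succ, hx.deriv_eq]
      have h1 : HasDerivAt (fun x => (descPochhammer ℂ k).eval ρ * φ x / (x - z₀) ^ k)
          _ x := ((hax.differentiableAt.hasDerivAt).const_mul _).div
            (((hasDerivAt_id x).sub_const z₀).pow k) (pow_ne_zero _ hx0)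
      rw [h1.deriv, hdx, descPochhammer_succ_right, eval_mul, eval_sub, eval_X, eval_natCast]
      cases k with
      | zero => simp; field_simp
      | succ k => simp; field_simp; ring
  have hz0 : z - z₀ ≠ 0 := sub_ne_zero.2 hz
  rw [key.eq_of_nhds]
  field_simp

theorem IsPowerGerm.fuchsOp_mul {z₀ ρ z : ℂ} {b : ℕ → ℂ → ℂ} {φ h : ℂ → ℂ}
    (hφ : IsPowerGerm z₀ ρ φ z) (hz : z ≠ z₀) (hh : AnalyticAt ℂ h z) :
    fuchsOp z₀ b (fun x => φ x * h x) z =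
      φ z * fuchsOp z₀ (leibnizCoeff (fun k => (descPochhammer ℂ k).eval ρ) b) h z :=
  _root_.fuchsOp_mul hφ.1 hh fun k => hφ.iteratedDeriv hz k

theorem IsPowerGerm.fuchsOp_self {z₀ ρ z : ℂ} {b : ℕ → ℂ → ℂ} {φ : ℂ → ℂ}
    (hφ : IsPowerGerm z₀ ρ φ z) (hz : z ≠ z₀) :
    fuchsOp z₀ b φ z = φ z * fallingSum (fun k => b k z) ρ := by
  rw [fuchsOp, fallingSum, Finset.mul_sum]
  refine Finset.sum_congr rfl fun k _ => ?_
  linear_combination b k z * hφ.iteratedDeriv hz k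

/-- Vandermonde's identity for falling factorials: conjugation by `(x - z₀)^ρ` replaces the Euler
operator `θ` by `θ + ρ`, and so translates the exponents. -/
theorem fallingSum_leibnizCoeff (b : ℕ → ℂ → ℂ) (z ρ x : ℂ) :
    fallingSum (fun j => leibnizCoeff (fun k => (descPochhammer ℂ k).eval ρ) b j z) x =
      fallingSum (fun k => b k z) (ρ + x) := by
  obtain ⟨h0, h1, h2, h3, h4⟩ := descPochhammer_eval_small ρ
  rw [fallingSum_eq, fallingSum_eq]
  simp [leibnizCoeff, Finset.sum_range_succ, Nat.choose, h2, h3, h4]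
  ring

theorem leibnizCoeff_zero (b : ℕ → ℂ → ℂ) (z ρ : ℂ) :
    leibnizCoeff (fun k => (descPochhammer ℂ k).eval ρ) b 0 z = fallingSum (fun k => b k z) ρ := by
  simp [leibnizCoeff, fallingSum, mul_comm]

theorem leibnizCoeff_four (μ : ℕ → ℂ) (b : ℕ → ℂ → ℂ) (z : ℂ) :
    leibnizCoeff μ b 4 z = μ 0 * b 4 z := by
  simp [leibnizCoeff, Finset.sum_range_succ, Nat.choose]

theorem IsPowerGerm.pow {z₀ z : ℂ} (hz : z ≠ z₀) (m : ℕ) :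
    IsPowerGerm z₀ m (fun x => (x - z₀) ^ m) z := by
  refine ⟨by fun_prop, ?_⟩
  filter_upwards [isOpen_ne.eventually_mem hz] with x hx
  have hx0 : x - z₀ ≠ 0 := sub_ne_zero.2 hx
  have h : HasDerivAt (fun x => (x - z₀) ^ m) _ x := ((hasDerivAt_id x).sub_const z₀).pow m
  rw [h.deriv]
  cases m with
  | zero => simp
  | succ m => simp [pow_succ]; field_simp

theorem IsPowerGerm.mul {z₀ ρ σ z : ℂ} {φ ψ : ℂ → ℂ} (hφ : IsPowerGerm z₀ ρ φ z)
    (hψ : IsPowerGerm z₀ σ ψ z) : IsPowerGerm z₀ (ρ + σ) (fun x => φ x * ψ x) z := by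
  refine ⟨hφ.1.mul hψ.1, ?_⟩
  filter_upwards [hφ.2, hψ.2, hφ.1.eventually_analyticAt, hψ.1.eventually_analyticAt]
    with x h1 h2 h3 h4
  have h := (h3.differentiableAt.hasDerivAt.mul h4.differentiableAt.hasDerivAt).deriv
  rw [h1, h2] at h
  refine h.trans ?_
  ring

theorem IsPowerGerm.cpow {z₀ z : ℂ} (ρ : ℂ) (hz : z - z₀ ∈ Complex.slitPlane) :
    IsPowerGerm z₀ ρ (fun x => (x - z₀) ^ ρ) z := by
  have ho : IsOpen {x : ℂ | x - z₀ ∈ Complex.slitPlane} :=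
    Complex.isOpen_slitPlane.preimage (by fun_prop)
  have hd : ∀ x, x - z₀ ∈ Complex.slitPlane →
      HasDerivAt (fun x => (x - z₀) ^ ρ) (ρ / (x - z₀) * (x - z₀) ^ ρ) x := by
    intro x hx
    have h := (((hasDerivAt_id x).sub_const z₀)).cpow_const (c := ρ) hx
    refine h.congr_deriv ?_
    have hx0 : x - z₀ ≠ 0 := Complex.slitPlane_ne_zero hx
    simp only [id]
    rw [Complex.cpow_sub _ _ hx0, Complex.cpow_one]
    ring
  refine ⟨?_, ?_⟩
  · exact (DifferentiableOn.analyticOnNhd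
      (fun x hx => (hd x hx).differentiableAt.differentiableWithinAt) ho) z hz
  · filter_upwards [ho.eventually_mem hz] with x hx using (hd x hx).deriv

/-- This branch is cut along the ray opposite to that of `IsPowerGerm.cpow`. Together the two cover
a punctured disc, and comparing them gives the local monodromy. -/
theorem IsPowerGerm.cpow_neg {z₀ z : ℂ} (ρ : ℂ) (hz : z₀ - z ∈ Complex.slitPlane) :
    IsPowerGerm z₀ ρ (fun x => (z₀ - x) ^ ρ) z := by
  have ho : IsOpen {x : ℂ | z₀ - x ∈ Complex.slitPlane} :=
    Complex.isOpen_slitPlane.preimage (by fun_prop)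
  have hd : ∀ x, z₀ - x ∈ Complex.slitPlane →
      HasDerivAt (fun x => (z₀ - x) ^ ρ) (ρ / (x - z₀) * (z₀ - x) ^ ρ) x := by
    intro x hx
    have h := (((hasDerivAt_id x).const_sub z₀)).cpow_const (c := ρ) hx
    refine h.congr_deriv ?_
    have hx0 : z₀ - x ≠ 0 := Complex.slitPlane_ne_zero hx
    have hx1 : x - z₀ ≠ 0 := by rw [← neg_sub]; exact neg_ne_zero.2 hx0
    simp only [id]
    rw [Complex.cpow_sub _ _ hx0, Complex.cpow_one, ← neg_sub z₀ x]
    field_simp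
  refine ⟨?_, ?_⟩
  · exact (DifferentiableOn.analyticOnNhd
      (fun x hx => (hd x hx).differentiableAt.differentiableWithinAt) ho) z hz
  · filter_upwards [ho.eventually_mem hz] with x hx using (hd x hx).deriv

theorem IsPowerGerm.const_mul {z₀ ρ z : ℂ} {φ : ℂ → ℂ} (h : IsPowerGerm z₀ ρ φ z) (c : ℂ) :
    IsPowerGerm z₀ ρ (fun x => c * φ x) z := by
  refine ⟨analyticAt_const.mul h.1, ?_⟩
  filter_upwards [h.2] with x hx
  rw [deriv_const_mul_field, hx]; ring

/-- `ℓ` is near `z` a branch of `log (x - z₀)`, up to a constant. -/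
def IsLogGerm (z₀ : ℂ) (ℓ : ℂ → ℂ) (z : ℂ) : Prop :=
  AnalyticAt ℂ ℓ z ∧ deriv ℓ =ᶠ[𝓝 z] fun x => 1 / (x - z₀)

/-- The coefficients of `w ↦ L(ℓ w) - ℓ L w`, where `ℓ` is a logarithm. -/
def logCoeff (b : ℕ → ℂ → ℂ) : ℕ → ℂ → ℂ :=
  leibnizCoeff (fun k => if k = 0 then 0 else (descPochhammer ℂ (k - 1)).eval (-1)) b

/-- The derivative `ℓ'` is a power germ of exponent `-1`, so the derivatives of `ℓ` of positive
order are known multiples of powers. Only the value `ℓ z` is not, and it factors out by linearity.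
-/
theorem IsLogGerm.fuchsOp_mul {z₀ z : ℂ} {b : ℕ → ℂ → ℂ} {ℓ w : ℂ → ℂ} (hℓ : IsLogGerm z₀ ℓ z)
    (hz : z ≠ z₀) (hw : AnalyticAt ℂ w z) :
    fuchsOp z₀ b (fun x => ℓ x * w x) z =
      ℓ z * fuchsOp z₀ b w z + fuchsOp z₀ (logCoeff b) w z := by
  have hz0 : z - z₀ ≠ 0 := sub_ne_zero.2 hz
  have hpow : IsPowerGerm z₀ (-1) (deriv ℓ) z := by
    refine ⟨hℓ.1.deriv, ?_⟩
    filter_upwards [hℓ.2.eventuallyEq_nhds, isOpen_ne.eventually_mem hz] with x hx hxz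
    have hx0 : x - z₀ ≠ 0 := sub_ne_zero.2 hxz
    rw [hx.deriv_eq, hx.eq_of_nhds]
    have h : HasDerivAt (fun x => 1 / (x - z₀)) _ x :=
      (hasDerivAt_const x (1 : ℂ)).div ((hasDerivAt_id x).sub_const z₀) hx0
    rw [h.deriv]
    simp; field_simp
  -- subtract the value at `z`, so that the logarithm vanishes there
  have h1 : fuchsOp z₀ b (fun x => ℓ x * w x) z
      = fuchsOp z₀ b (fun x => (ℓ x - ℓ z) * w x) z + ℓ z * fuchsOp z₀ b w z := by
    rw [← fuchsOp_const_mul, ← fuchsOp_add (f := fun x => (ℓ x - ℓ z) * w x) (g := fun x => ℓ z * w x)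
      ((hℓ.1.sub analyticAt_const).mul hw) (analyticAt_const.mul hw)]
    exact fuchsOp_congr (Eventually.of_forall fun x => by ring)
  have h2 := _root_.fuchsOp_mul (b := b) (z₀ := z₀) (φ := fun x => ℓ x - ℓ z) (h := w) (a := 1)
    (μ := fun k => if k = 0 then 0 else (descPochhammer ℂ (k - 1)).eval (-1))
    (hℓ.1.sub analyticAt_const) hw (by
      intro k
      cases k with
      | zero => simp
      | succ k =>
        have hd : deriv (fun x => ℓ x - ℓ z) = deriv ℓ := by ext x; simp
        rw [iteratedDeriv_succ', hd, pow_succ, mul_right_comm, hpow.iteratedDeriv hz k,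
          hℓ.2.eq_of_nhds]
        simp; field_simp)
  rw [h1, h2, one_mul, add_comm]; rfl

/-- The right-hand side is the derivative in `x` of the indicial polynomial, as it must be: the
logarithm is the derivative of `(x - z₀)^ρ` with respect to `ρ` at `ρ = 0`. -/
theorem fallingSum_logCoeff (b : ℕ → ℂ → ℂ) (z x : ℂ) :
    fallingSum (fun k => logCoeff b k z) x =
      b 1 z + b 2 z * (2 * x - 1) + b 3 z * (3 * x ^ 2 - 6 * x + 2)
        + b 4 z * (4 * x ^ 3 - 18 * x ^ 2 + 22 * x - 6) := by
  obtain ⟨h0, h1, h2, h3, h4⟩ := descPochhammer_eval_small (-1)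
  rw [fallingSum_eq]
  simp [logCoeff, leibnizCoeff, Finset.sum_range_succ, Nat.choose, h2, h3]
  ring

/-! ### Local solutions at a Fuchsian point -/

theorem AnalyticAt.exists_eq_sub_mul {f : ℂ → ℂ} {z₀ : ℂ} (hf : AnalyticAt ℂ f z₀)
    (h0 : f z₀ = 0) :
    ∃ g : ℂ → ℂ, AnalyticAt ℂ g z₀ ∧ ∀ z, f z = (z - z₀) * g z := by
  obtain ⟨p, hp⟩ := hf
  refine ⟨dslope f z₀, hp.has_fpower_series_dslope_fslope.analyticAt, fun z => ?_⟩
  have := sub_smul_dslope f z₀ z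
  rw [h0, sub_zero, smul_eq_mul] at this
  exact this.symm

/-- Dividing by `φ` shifts the exponents by `-ρ`, which reduces the claim to
`exists_analytic_fuchsOp_eq`. The conjugated operator depends on `ρ` only, so one `y` serves all
branches `φ`. -/
theorem exists_conj_solution {z₀ ρ : ℂ} {b : ℕ → ℂ → ℂ} {r : ℂ → ℂ}
    (hb : ∀ k, AnalyticAt ℂ (b k) z₀) (hr : AnalyticAt ℂ r z₀) (h4 : b 4 z₀ ≠ 0)
    (hI : ∀ n : ℕ, fallingSum (fun k => b k z₀) (ρ + n) ≠ 0) :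
    ∃ y : ℂ → ℂ, AnalyticAt ℂ y z₀ ∧ ∀ᶠ z in 𝓝 z₀, z ≠ z₀ → ∀ φ, IsPowerGerm z₀ ρ φ z →
      fuchsOp z₀ b (fun x => φ x * y x) z = φ z * r z := by
  obtain ⟨y, hy, h⟩ := exists_analytic_fuchsOp_eq (z₀ := z₀) (r := r)
    (b := leibnizCoeff (fun k => (descPochhammer ℂ k).eval ρ) b)
    (fun k => analyticAt_leibnizCoeff hb k) hr (by simpa [leibnizCoeff_four] using h4)
    (fun n => by rw [fallingSum_leibnizCoeff]; exact hI n)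
  refine ⟨y, hy, ?_⟩
  filter_upwards [h, hy.eventually_analyticAt] with z hz hyz hne φ hφ
  rw [hφ.fuchsOp_mul hne hyz, hz]

/-- The Frobenius solution for an exponent `ρ` such that no `ρ + n`, `n ≥ 1`, is an exponent. -/
theorem exists_power_solution {z₀ ρ : ℂ} {b : ℕ → ℂ → ℂ}
    (hb : ∀ k, AnalyticAt ℂ (b k) z₀) (h4 : b 4 z₀ ≠ 0)
    (h0 : fallingSum (fun k => b k z₀) ρ = 0)
    (hI : ∀ n : ℕ, fallingSum (fun k => b k z₀) (ρ + 1 + n) ≠ 0) :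
    ∃ h : ℂ → ℂ, AnalyticAt ℂ h z₀ ∧ h z₀ = 1 ∧ ∀ᶠ z in 𝓝 z₀, z ≠ z₀ → ∀ φ,
      IsPowerGerm z₀ ρ φ z → fuchsOp z₀ b (fun x => φ x * h x) z = 0 := by
  have hF : AnalyticAt ℂ (fun z => fallingSum (fun k => b k z) ρ) z₀ := by
    unfold fallingSum
    refine Finset.analyticAt_fun_sum _ fun k _ => ?_
    have := hb k
    fun_prop
  obtain ⟨κ, hκ, hκ'⟩ := hF.exists_eq_sub_mul h0
  -- The bare power has image `φ (z - z₀) κ`; a correction `φ (x - z₀) y`, of exponent `ρ + 1`,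
  -- cancels it.
  obtain ⟨y, hy, h⟩ := exists_conj_solution (ρ := ρ + 1) (r := fun z => -κ z) hb hκ.neg h4 hI
  refine ⟨fun z => 1 + (z - z₀) * y z, by fun_prop, by simp, ?_⟩
  filter_upwards [h, hy.eventually_analyticAt] with z hz hyz hne φ hφ
  have h1 : IsPowerGerm z₀ (ρ + 1) (fun x => φ x * (x - z₀)) z := by
    simpa using hφ.mul (IsPowerGerm.pow hne 1)
  have h2 : fuchsOp z₀ b (fun x => φ x * (1 + (x - z₀) * y x)) z =
      fuchsOp z₀ b (fun x => φ x + φ x * (x - z₀) * y x) z :=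
    fuchsOp_congr (Eventually.of_forall fun x => by ring)
  rw [h2, fuchsOp_add (g := fun x => φ x * (x - z₀) * y x) hφ.1 (h1.1.mul hyz),
    hz hne _ h1, hφ.fuchsOp_self hne, hκ']
  ring

/-- Local solutions at a point with exponents `0, 1, 2, 3` at which the equation has three
holomorphic solutions vanishing at the point. -/
theorem exists_log_solution {z₀ : ℂ} {b : ℕ → ℂ → ℂ} {β : ℂ} {κ₀ : ℂ → ℂ}
    (hb : ∀ k, AnalyticAt ℂ (b k) z₀) (h4 : b 4 z₀ = 1)
    (hb0 : ∀ k < 4, b k z₀ = 0) (hκ₀ : AnalyticAt ℂ κ₀ z₀)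
    (hbκ : ∀ᶠ z in 𝓝 z₀, b 0 z = (z - z₀) * κ₀ z) (hβ : κ₀ z₀ = -2 * β)
    (hcomp : ∀ m : ℕ, 1 ≤ m → m ≤ 3 → ∃ κ : ℂ → ℂ, AnalyticAt ℂ κ z₀ ∧
      ∀ᶠ z in 𝓝 z₀, fallingSum (fun k => b k z) m = (z - z₀) ^ (4 - m) * κ z) :
    ∃ (u : ℕ → ℂ → ℂ) (v : ℂ → ℂ) (R : ℕ → ℂ), (∀ m, AnalyticAt ℂ (u m) z₀ ∧ u m z₀ = 1) ∧
      AnalyticAt ℂ v z₀ ∧ v z₀ = 1 ∧ R 1 = β ∧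
      (∀ m, 1 ≤ m → m ≤ 3 → ∀ᶠ z in 𝓝 z₀, z ≠ z₀ →
        fuchsOp z₀ b (fun x => (x - z₀) ^ m * u m x) z = 0) ∧
      ∀ᶠ z in 𝓝 z₀, z ≠ z₀ → ∀ ℓ, IsLogGerm z₀ ℓ z →
        fuchsOp z₀ b (fun x => v x + ℓ x * (R 1 * ((x - z₀) ^ 1 * u 1 x)
          + R 2 * ((x - z₀) ^ 2 * u 2 x) + R 3 * ((x - z₀) ^ 3 * u 3 x))) z = 0 := by
  -- At `z₀` the indicial polynomial is `x (x-1) (x-2) (x-3)`, which has no root at `4` or beyond.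
  -- Any defect of order `4` can therefore be solved away.
  have hI4 : ∀ n : ℕ, fallingSum (fun k => b k z₀) (((4 : ℕ) : ℂ) + n) ≠ 0 := by
    intro n
    rw [fallingSum_eq]
    simp only [hb0 0 (by norm_num), hb0 1 (by norm_num), hb0 2 (by norm_num), hb0 3 (by norm_num), h4]
    have h1 : ((n : ℂ) + 4) ≠ 0 := by exact_mod_cast (Nat.succ_ne_zero (n + 3))
    have h2 : ((n : ℂ) + 3) ≠ 0 := by exact_mod_cast (Nat.succ_ne_zero (n + 2))
    have h3 : ((n : ℂ) + 2) ≠ 0 := by exact_mod_cast (Nat.succ_ne_zero (n + 1))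
    have h5 : ((n : ℂ) + 1) ≠ 0 := by exact_mod_cast (Nat.succ_ne_zero n)
    have := mul_ne_zero (mul_ne_zero (mul_ne_zero h1 h2) h3) h5
    intro h
    apply this
    push_cast at h
    linear_combination h
  have h4' : b 4 z₀ ≠ 0 := by rw [h4]; exact one_ne_zero
  -- the holomorphic solutions
  have hu : ∀ m : ℕ, ∃ u : ℂ → ℂ, AnalyticAt ℂ u z₀ ∧ u z₀ = 1 ∧ (1 ≤ m → m ≤ 3 →
      ∀ᶠ z in 𝓝 z₀, z ≠ z₀ → fuchsOp z₀ b (fun x => (x - z₀) ^ m * u x) z = 0) := by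
    intro m
    by_cases hm : 1 ≤ m ∧ m ≤ 3
    swap
    · exact ⟨fun _ => 1, analyticAt_const, rfl, fun h1 h2 => absurd ⟨h1, h2⟩ hm⟩
    obtain ⟨κ, hκ, hκ'⟩ := hcomp m hm.1 hm.2
    -- The image of `(x - z₀)^m` is `(z - z₀)^4 κ`, already of order `4`, so that no resonance with
    -- the exponents between `m` and `3` can occur.
    obtain ⟨y, hy, h⟩ := exists_conj_solution (r := fun z => -κ z) hb hκ.neg h4' hI4
    refine ⟨fun z => 1 + (z - z₀) ^ (4 - m) * y z, by fun_prop, ?_, fun _ _ => ?_⟩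
    · have : 4 - m ≠ 0 := by omega
      simp [this]
    filter_upwards [h, hy.eventually_analyticAt, hκ'] with z hz hyz hκz hne
    have h2 : fuchsOp z₀ b (fun x => (x - z₀) ^ m * (1 + (x - z₀) ^ (4 - m) * y x)) z =
        fuchsOp z₀ b (fun x => (x - z₀) ^ m + (x - z₀) ^ 4 * y x) z :=
      fuchsOp_congr (Eventually.of_forall fun x => by
        have : (x - z₀) ^ 4 = (x - z₀) ^ m * (x - z₀) ^ (4 - m) := by
          rw [← pow_add]; congr 1; omega
        simp only [this]; ring)
    have h3 : (z - z₀) ^ 4 = (z - z₀) ^ m * (z - z₀) ^ (4 - m) := by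
      rw [← pow_add]; congr 1; omega
    rw [h2, fuchsOp_add (f := fun x => (x - z₀) ^ m) (g := fun x => (x - z₀) ^ 4 * y x)
      (by fun_prop) (by fun_prop), hz hne _ (IsPowerGerm.pow hne 4),
      (IsPowerGerm.pow hne m).fuchsOp_self hne, hκz, h3]
    ring
  choose u hua hu1 hu using hu
  -- the operator produced by the logarithm, applied to the holomorphic solutions
  have hlb : ∀ k, AnalyticAt ℂ (logCoeff b k) z₀ := fun k => analyticAt_leibnizCoeff hb k
  set T : ℕ → ℂ → ℂ := fun m => fuchsOp z₀
    (leibnizCoeff (fun k => (descPochhammer ℂ k).eval (m : ℂ)) (logCoeff b)) (u m) with hT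
  have hTa : ∀ m, AnalyticAt ℂ (T m) z₀ := fun m =>
    analyticAt_fuchsOp (fun k => analyticAt_leibnizCoeff hlb k) (hua m)
  -- `T m z₀` is the derivative of `x (x-1) (x-2) (x-3)` at `m`. It is non-zero because the
  -- exponents are simple.
  have hT0 : ∀ m : ℕ, T m z₀ = 4 * m ^ 3 - 18 * m ^ 2 + 22 * m - 6 := by
    intro m
    rw [hT]
    simp only [fuchsOp_center, leibnizCoeff_zero, fallingSum_logCoeff, hu1,
      hb0 1 (by norm_num), hb0 2 (by norm_num), hb0 3 (by norm_num), h4]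
    ring
  have hT1 : T 1 z₀ = 2 := by rw [hT0]; norm_num
  have hT2 : T 2 z₀ = -2 := by rw [hT0]; norm_num
  have hT3 : T 3 z₀ = 6 := by rw [hT0]; norm_num
  -- With `s = z - z₀`, the image of `1` is `s κ₀`, and a multiple `R m` of `ℓ s^m u m` contributes
  -- `R m s^m T m`. The three factors are chosen in turn to remove the orders `1`, `2`, `3`,
  -- dividing by `T 1 z₀ = 2`, `T 2 z₀ = -2`, `T 3 z₀ = 6`; the rest `s^4 κ₃` is absorbed by `(z -
  -- z₀)^4 y`.
  obtain ⟨κ₁, hκ₁, hκ₁'⟩ := AnalyticAt.exists_eq_sub_mul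
    (f := fun z => κ₀ z + β * T 1 z) (hκ₀.add (analyticAt_const.mul (hTa 1)))
    (by simp only [hβ, hT1]; ring)
  obtain ⟨κ₂, hκ₂, hκ₂'⟩ := AnalyticAt.exists_eq_sub_mul
    (f := fun z => κ₁ z + κ₁ z₀ / 2 * T 2 z) (hκ₁.add (analyticAt_const.mul (hTa 2)))
    (by simp only [hT2]; ring)
  obtain ⟨κ₃, hκ₃, hκ₃'⟩ := AnalyticAt.exists_eq_sub_mul
    (f := fun z => κ₂ z + -κ₂ z₀ / 6 * T 3 z) (hκ₂.add (analyticAt_const.mul (hTa 3)))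
    (by simp only [hT3]; ring)
  obtain ⟨y, hy, hyeq⟩ := exists_conj_solution (r := fun z => -κ₃ z) hb hκ₃.neg h4' hI4
  let R : ℕ → ℂ := fun m => if m = 1 then β else if m = 2 then κ₁ z₀ / 2 else -κ₂ z₀ / 6
  refine ⟨u, fun z => 1 + (z - z₀) ^ 4 * y z, R, fun m => ⟨hua m, hu1 m⟩, by fun_prop, by simp,
    rfl, hu, ?_⟩
  filter_upwards [hbκ, hyeq, hy.eventually_analyticAt, hu 1 le_rfl (by norm_num),
    hu 2 (by norm_num) (by norm_num), hu 3 (by norm_num) (by norm_num),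
    (hua 1).eventually_analyticAt, (hua 2).eventually_analyticAt, (hua 3).eventually_analyticAt]
    with z hbz hyz hya e1 e2 e3 a1 a2 a3 hne ℓ hℓ
  have hv : fuchsOp z₀ b (fun x => 1 + (x - z₀) ^ 4 * y x) z
      = b 0 z - (z - z₀) ^ 4 * κ₃ z := by
    rw [fuchsOp_add (f := fun _ => 1) (g := fun x => (x - z₀) ^ 4 * y x) analyticAt_const
      (by fun_prop), hyz hne _ (IsPowerGerm.pow hne 4), fuchsOp_one]
    ring
  have hw : ∀ c : ℕ → ℂ → ℂ, fuchsOp z₀ c (fun x => R 1 * ((x - z₀) ^ 1 * u 1 x)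
      + R 2 * ((x - z₀) ^ 2 * u 2 x) + R 3 * ((x - z₀) ^ 3 * u 3 x)) z =
      R 1 * fuchsOp z₀ c (fun x => (x - z₀) ^ 1 * u 1 x) z
      + R 2 * fuchsOp z₀ c (fun x => (x - z₀) ^ 2 * u 2 x) z
      + R 3 * fuchsOp z₀ c (fun x => (x - z₀) ^ 3 * u 3 x) z := by
    intro c
    rw [fuchsOp_add (f := fun x => R 1 * ((x - z₀) ^ 1 * u 1 x) + R 2 * ((x - z₀) ^ 2 * u 2 x))
        (g := fun x => R 3 * ((x - z₀) ^ 3 * u 3 x)) (by fun_prop) (by fun_prop),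
      fuchsOp_add (f := fun x => R 1 * ((x - z₀) ^ 1 * u 1 x))
        (g := fun x => R 2 * ((x - z₀) ^ 2 * u 2 x)) (by fun_prop) (by fun_prop),
      fuchsOp_const_mul, fuchsOp_const_mul, fuchsOp_const_mul]
  have hG : ∀ m : ℕ, AnalyticAt ℂ (u m) z →
      fuchsOp z₀ (logCoeff b) (fun x => (x - z₀) ^ m * u m x) z = (z - z₀) ^ m * T m z :=
    fun m hm => (IsPowerGerm.pow hne m).fuchsOp_mul hne hm
  have hwa : AnalyticAt ℂ (fun x => R 1 * ((x - z₀) ^ 1 * u 1 x)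
      + R 2 * ((x - z₀) ^ 2 * u 2 x) + R 3 * ((x - z₀) ^ 3 * u 3 x)) z := by fun_prop
  rw [fuchsOp_add (f := fun x => 1 + (x - z₀) ^ 4 * y x) (g := fun x => ℓ x *
    (R 1 * ((x - z₀) ^ 1 * u 1 x) + R 2 * ((x - z₀) ^ 2 * u 2 x) + R 3 * ((x - z₀) ^ 3 * u 3 x)))
    (by fun_prop) (hℓ.1.mul hwa), hℓ.fuchsOp_mul hne hwa, hw, hw, e1 hne, e2 hne, e3 hne,
    hG 1 a1, hG 2 a2, hG 3 a3, hv, hbz]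
  have hR1 : R 1 = β := rfl
  have hR2 : R 2 = κ₁ z₀ / 2 := rfl
  have hR3 : R 3 = -κ₂ z₀ / 6 := rfl
  rw [hR1, hR2, hR3]
  linear_combination (z - z₀) * hκ₁' z + (z - z₀) ^ 2 * hκ₂' z + (z - z₀) ^ 3 * hκ₃' z

/-! ### Linear systems on star-shaped domains -/

section Picard

variable {E : Type*} [NormedAddCommGroup E] [NormedSpace ℂ E]

/-- The primitive of `f` along the segments issuing from `c`. -/
def radialPrimitive (c : ℂ) (f : ℂ → E) (z : ℂ) : E :=
  (z - c) • ∫ t in (0 : ℝ)..1, f (c + t * (z - c))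

/-- The segment from the centre to `z` is compact in `U`, and thickenings of a segment are convex.
`C` serves for Cauchy's theorem, the compact `K` for uniform bounds on the coefficients. -/
theorem exists_convex_nhd {U : Set ℂ} {c z : ℂ} (hU : IsOpen U) (hs : StarConvex ℝ c U)
    (hz : z ∈ U) :
    ∃ C K : Set ℂ, IsOpen C ∧ Convex ℝ C ∧ c ∈ C ∧ z ∈ C ∧ C ⊆ K ∧ IsCompact K ∧ K ⊆ U := by
  have hcomp : IsCompact (segment ℝ c z) := by
    rw [segment_eq_image]
    exact isCompact_Icc.image (by fun_prop)
  obtain ⟨δ, hδ, hsub⟩ := hcomp.exists_cthickening_subset_open hU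
    (hs.segment_subset hz)
  exact ⟨Metric.thickening δ (segment ℝ c z), Metric.cthickening δ (segment ℝ c z),
    Metric.isOpen_thickening, (convex_segment c z).thickening δ,
    Metric.self_subset_thickening hδ _ (left_mem_segment ℝ c z),
    Metric.self_subset_thickening hδ _ (right_mem_segment ℝ c z),
    Metric.thickening_subset_cthickening _ _, hcomp.cthickening, hsub⟩

/-- On the convex neighbourhood `C` of the segment a primitive `g` exists, and integrating its
derivative along segments from `c` gives `g - g c`. -/
theorem hasDerivAt_radialPrimitive [CompleteSpace E] {U : Set ℂ} {c z : ℂ} {f : ℂ → E} (hU : IsOpen U)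
    (hs : StarConvex ℝ c U) (hf : DifferentiableOn ℂ f U) (hz : z ∈ U) :
    HasDerivAt (radialPrimitive c f) (f z) z := by
  obtain ⟨C, K, hCo, hCc, hcC, hzC, hCK, -, hKU⟩ := exists_convex_nhd hU hs hz
  have hCU : C ⊆ U := hCK.trans hKU
  obtain ⟨g, hg⟩ := hCc.exists_forall_hasDerivWithinAt (hf.mono hCU)
  have hg' : ∀ w ∈ C, HasDerivAt g (f w) w := fun w hw =>
    (hg w hw).hasDerivAt (hCo.mem_nhds hw)
  have heq : ∀ w ∈ C, radialPrimitive c f w = g w - g c := by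
    intro w hw
    have hmem : ∀ t ∈ Set.uIcc (0 : ℝ) 1, c + t * (w - c) ∈ C := by
      intro t ht
      rw [Set.uIcc_of_le zero_le_one] at ht
      have := hCc.add_smul_sub_mem hcC hw ht
      simpa using this
    have hderiv : ∀ t ∈ Set.uIcc (0 : ℝ) 1,
        HasDerivAt (fun t : ℝ => g (c + t * (w - c))) ((w - c) • f (c + t * (w - c))) t := by
      intro t ht
      have h1 : HasDerivAt (fun t : ℝ => c + (t : ℂ) * (w - c)) (w - c) t := by
        simpa using ((Complex.ofRealCLM.hasDerivAt (x := t)).mul_const (w - c)).const_add c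
      exact (hg' _ (hmem t ht)).scomp t h1
    have hcont : ContinuousOn (fun t : ℝ => (w - c) • f (c + t * (w - c))) (Set.uIcc 0 1) := by
      refine ContinuousOn.const_smul ?_ _
      exact (hf.continuousOn.mono hCU).comp (by fun_prop) hmem
    have := intervalIntegral.integral_eq_sub_of_hasDerivAt hderiv hcont.intervalIntegrable
    rw [intervalIntegral.integral_smul] at this
    rw [radialPrimitive, this]
    simp
  have he : radialPrimitive c f =ᶠ[𝓝 z] fun w => g w - g c :=
    (hCo.eventually_mem hzC).mono heq
  exact ((hg' z hzC).sub_const _).congr_of_eventuallyEq he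

/-- Keeping the power `t ^ n` under the integral yields the divisor `n + 1`, hence the factorials in
the Picard bound. -/
theorem norm_radialPrimitive_le {c z : ℂ} {f : ℂ → E} {B : ℝ} {n : ℕ}
    (hf : ∀ t ∈ Set.Icc (0 : ℝ) 1, ‖f (c + t * (z - c))‖ ≤ B * t ^ n) :
    ‖radialPrimitive c f z‖ ≤ ‖z - c‖ * (B / (n + 1)) := by
  rw [radialPrimitive, norm_smul]
  gcongr
  have h := intervalIntegral.norm_integral_le_of_norm_le (f := fun t : ℝ => f (c + t * (z - c)))
    (g := fun t => B * t ^ n) (μ := MeasureTheory.volume) zero_le_one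
    (Eventually.of_forall fun t ht => hf t ⟨ht.1.le, ht.2⟩)
    (Continuous.intervalIntegrable (by fun_prop) _ _)
  refine h.trans (le_of_eq ?_)
  rw [intervalIntegral.integral_const_mul, integral_pow]
  simp; ring

theorem radialPrimitive_center (c : ℂ) (f : ℂ → E) : radialPrimitive c f c = 0 := by
  simp [radialPrimitive]

/-- The Picard iterates for `Y' = A Y`, `Y c = v`. -/
def picardTerm (A : ℂ → E →L[ℂ] E) (c : ℂ) (v : E) : ℕ → ℂ → E
  | 0 => fun _ => v
  | n + 1 => radialPrimitive c fun z => A z (picardTerm A c v n z)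

/-- A linear system with holomorphic coefficients on a star-shaped domain has a solution on the
whole domain for every initial value at the centre. -/
theorem exists_linear_system_solution [CompleteSpace E] {U : Set ℂ} {c : ℂ} {A : ℂ → E →L[ℂ] E} (hU : IsOpen U)
    (hs : StarConvex ℝ c U) (hA : DifferentiableOn ℂ A U) (v : E) :
    ∃ Y : ℂ → E, Y c = v ∧ ∀ z ∈ U, HasDerivAt Y (A z (Y z)) z := by
  set y := picardTerm A c v with hy
  have hyd : ∀ n, DifferentiableOn ℂ (y n) U ∧
      ∀ z ∈ U, HasDerivAt (y (n + 1)) (A z (y n z)) z := by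
    have step : ∀ n, DifferentiableOn ℂ (y n) U →
        ∀ z ∈ U, HasDerivAt (y (n + 1)) (A z (y n z)) z := fun n hn z hz =>
      hasDerivAt_radialPrimitive hU hs (hA.clm_apply hn) hz
    intro n
    induction n with
    | zero =>
      have : DifferentiableOn ℂ (y 0) U := differentiableOn_const v
      exact ⟨this, step 0 this⟩
    | succ n ih =>
      have : DifferentiableOn ℂ (y (n + 1)) U :=
        fun z hz => (ih.2 z hz).differentiableAt.differentiableWithinAt
      exact ⟨this, step _ this⟩
  have hyc : ∀ n, y (n + 1) c = 0 := fun n => radialPrimitive_center _ _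
  refine ⟨fun z => ∑' n, y n z, ?_, fun z hz => ?_⟩
  · change ∑' n, y n c = v
    rw [tsum_eq_single 0]
    · rfl
    · intro n hn
      obtain ⟨m, rfl⟩ := Nat.exists_eq_succ_of_ne_zero hn
      exact hyc m
  · obtain ⟨C, K, hCo, hCc, hcC, hzC, hCK, hK, hKU⟩ := exists_convex_nhd hU hs hz
    obtain ⟨a, ha⟩ := hK.exists_bound_of_continuousOn (hA.continuousOn.mono hKU)
    obtain ⟨D, hD⟩ := hK.exists_bound_of_continuousOn (f := fun w => w - c) (by fun_prop)
    have ha0 : 0 ≤ a := (norm_nonneg _).trans (ha c (hCK hcC))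
    have hD0 : 0 ≤ D := (norm_nonneg _).trans (hD c (hCK hcC))
    have hbd : ∀ n, ∀ w ∈ C, ‖y n w‖ ≤ ‖v‖ * (a * ‖w - c‖) ^ n / n.factorial := by
      intro n
      induction n with
      | zero => intro w _; simp [hy, picardTerm]
      | succ n ih =>
        intro w hw
        have h := norm_radialPrimitive_le (c := c) (z := w) (n := n)
          (f := fun z => A z (y n z)) (B := a * (‖v‖ * (a * ‖w - c‖) ^ n / n.factorial)) (by
            intro t ht
            have hm : c + t * (w - c) ∈ C := by
              simpa using hCc.add_smul_sub_mem hcC hw ht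
            calc ‖A (c + t * (w - c)) (y n (c + t * (w - c)))‖
                ≤ a * (‖v‖ * (a * ‖c + t * (w - c) - c‖) ^ n / n.factorial) :=
                  (ContinuousLinearMap.le_opNorm _ _).trans
                    (mul_le_mul (ha _ (hCK hm)) (ih _ hm) (norm_nonneg _) ha0)
              _ = _ := by
                  rw [add_sub_cancel_left, norm_mul, Complex.norm_real, Real.norm_of_nonneg ht.1]
                  ring)
        refine h.trans (le_of_eq ?_)
        rw [Nat.factorial_succ]
        push_cast
        field_simp
        ring
    have hle : ∀ n w, w ∈ C → ‖y n w‖ ≤ ‖v‖ * ((a * D) ^ n / n.factorial) := by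
      intro n w hw
      refine (hbd n w hw).trans ?_
      rw [mul_div_assoc]
      gcongr
      exact hD w (hCK hw)
    have hu : Summable fun n : ℕ => ‖v‖ * ((a * D) ^ n / n.factorial) :=
      (Real.summable_pow_div_factorial _).mul_left _
    have hCU : C ⊆ U := hCK.trans hKU
    have hdiff := Complex.differentiableOn_tsum_of_summable_norm hu
      (fun n => (hyd n).1.mono hCU) hCo hle
    have hsum := Complex.hasSum_deriv_of_summable_norm hu
      (fun n => (hyd n).1.mono hCU) hCo hle hzC
    have hder := (hdiff.differentiableAt (hCo.mem_nhds hzC)).hasDerivAt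
    refine hder.congr_deriv ?_
    -- The `(n+1)`-st iterate differentiates to `A` applied to the `n`-th: differentiating the
    -- series shifts it by one, and the dropped term is constant.
    have hs1 : HasSum (fun n => deriv (y (n + 1)) z) (A z (∑' n, y n z)) := by
      have h1 : Summable fun n => y n z :=
        Summable.of_norm_bounded hu fun n => hle n z hzC
      have h2 := h1.hasSum.mapL (A z)
      convert! h2 using 2 with n
      exact ((hyd n).2 z hz).deriv
    have hs2 := (hasSum_nat_add_iff' 1).2 hsum
    have h0 : deriv (y 0) z = 0 := by
      have : y 0 = fun _ => v := rfl
      rw [this]; simp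
    simp only [Finset.sum_range_one, h0, sub_zero] at hs2
    exact hs2.unique hs1

end Picard

/-! ### The Cauchy problem for equations of order four -/

namespace ODE4

variable {a : ODE4}

theorem SolvesAt.const_mul {f : ℂ → ℂ} {z : ℂ} (h : a.SolvesAt f z) (c : ℂ) :
    a.SolvesAt (fun x => c * f x) z := by
  refine ⟨analyticAt_const.mul h.1, ?_⟩
  have := congrArg (c * ·) h.2
  simp only [mul_add, Finset.mul_sum, mul_zero] at this
  rw [iteratedDeriv_const_mul_field, ← this]
  congr 1
  refine Finset.sum_congr rfl fun k _ => ?_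
  rw [iteratedDeriv_const_mul_field]; ring

theorem SolvesAt.add {f g : ℂ → ℂ} {z : ℂ} (hf : a.SolvesAt f z) (hg : a.SolvesAt g z) :
    a.SolvesAt (fun x => f x + g x) z := by
  refine ⟨hf.1.add hg.1, ?_⟩
  have h := fun k => iteratedDeriv_fun_add (hf.1.contDiffAt_nat k) (hg.1.contDiffAt_nat k)
  simp only [h, mul_add, Finset.sum_add_distrib]
  linear_combination hf.2 + hg.2

theorem solvesAt_zero (z : ℂ) : a.SolvesAt (fun _ => 0) z :=
  ⟨analyticAt_const, by simp⟩

theorem SolvesAt.sum {ι : Type*} {s : Finset ι} {u : ι → ℂ → ℂ} {z : ℂ} (c : ι → ℂ)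
    (h : ∀ i ∈ s, a.SolvesAt (u i) z) : a.SolvesAt (fun x => ∑ i ∈ s, c i * u i x) z := by
  classical
  induction s using Finset.induction_on with
  | empty => simpa using solvesAt_zero z
  | insert i s hi ih =>
    simp only [Finset.sum_insert hi]
    exact ((h i (Finset.mem_insert_self i s)).const_mul (c i)).add
      (ih fun j hj => h j (Finset.mem_insert_of_mem hj))

theorem SolvesAt.sub {f g : ℂ → ℂ} {z : ℂ} (hf : a.SolvesAt f z) (hg : a.SolvesAt g z) :
    a.SolvesAt (fun x => f x - g x) z := by
  simpa [sub_eq_add_neg] using hf.add (hg.const_mul (-1))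

/-- Away from `z₀`, solving the equation is solving the associated Fuchsian one. -/
theorem solvesAt_iff_fuchsOp {z₀ z : ℂ} {b : ℕ → ℂ → ℂ} {f : ℂ → ℂ} (hz : z ≠ z₀)
    (hb : ∀ k : Fin 4, b k z = (z - z₀) ^ (4 - (k : ℕ)) * a k z) (h4 : b 4 z = 1) :
    a.SolvesAt f z ↔ AnalyticAt ℂ f z ∧ fuchsOp z₀ b f z = 0 := by
  have h0 := hb 0
  have h1 := hb 1
  have h2 := hb 2
  have h3 := hb 3
  have key : fuchsOp z₀ b f z = (z - z₀) ^ 4 *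
      (iteratedDeriv 4 f z + ∑ k : Fin 4, a k z * iteratedDeriv k f z) := by
    simp [fuchsOp, Finset.sum_range_succ, Fin.sum_univ_four] at h0 h1 h2 h3 ⊢
    rw [h0, h1, h2, h3, h4]; ring
  have hz0 : (z - z₀) ^ 4 ≠ 0 := pow_ne_zero _ (sub_ne_zero.2 hz)
  rw [SolvesAt, key, mul_eq_zero, or_iff_right hz0]

/-- A solution at an ordinary point is determined by its first four derivatives. -/
theorem eventuallyEq_zero_of_jet {f : ℂ → ℂ} {z₀ : ℂ} (ha : ∀ k, AnalyticAt ℂ (a k) z₀)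
    (hf : ∀ᶠ z in 𝓝 z₀, a.SolvesAt f z) (hj : ∀ k : Fin 4, iteratedDeriv k f z₀ = 0) :
    f =ᶠ[𝓝 z₀] 0 := by
  have hfa : AnalyticAt ℂ f z₀ := hf.self_of_nhds.1
  by_contra hne
  obtain ⟨n, hn⟩ : ∃ n : ℕ, analyticOrderAt f z₀ = n := by
    refine ⟨(analyticOrderAt f z₀).toNat, (ENat.natCast_toNat fun h => hne ?_).symm⟩
    exact analyticOrderAt_eq_top.1 h
  have hn4 : 4 ≤ n := by
    by_contra hlt
    have := ((analyticOrderAt_eq_nat_iff_iteratedDeriv_eq_zero hfa).1 hn).2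
    exact this (hj ⟨n, by omega⟩)
  -- If `f` were not zero, write `f = (z - z₀)^n g` with `n ≥ 4`. Conjugation by the `n`-th power
  -- and evaluation at `z₀` give `n (n-1) (n-2) (n-3) g z₀ = 0`, since at an ordinary point the
  -- lower coefficients `(z - z₀)^(4-k) a k` vanish there.
  obtain ⟨g, hg, hg0, hfg⟩ := (hfa.analyticOrderAt_eq_natCast).1 hn
  let b : ℕ → ℂ → ℂ := fun k z => if h : k < 4 then (z - z₀) ^ (4 - k) * a ⟨k, h⟩ z else 1
  have hb : ∀ k, AnalyticAt ℂ (b k) z₀ := by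
    intro k
    by_cases h : k < 4
    · simp only [b, h, dite_true]
      have := ha ⟨k, h⟩
      fun_prop
    · simp only [b, h, dite_false]
      exact analyticAt_const
  set b' := leibnizCoeff (fun k => (descPochhammer ℂ k).eval (n : ℂ)) b with hb'
  have hL : ∀ᶠ z in 𝓝[≠] z₀, fuchsOp z₀ b' g z = 0 := by
    have hfg' : f =ᶠ[𝓝 z₀] fun z => (z - z₀) ^ n * g z := hfg
    filter_upwards [nhdsWithin_le_nhds hf, nhdsWithin_le_nhds hfg'.eventuallyEq_nhds,
      nhdsWithin_le_nhds hg.eventually_analyticAt, self_mem_nhdsWithin] with z h1 h2 h3 hz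
    have hz' : z ≠ z₀ := hz
    have h4 := ((solvesAt_iff_fuchsOp (b := b) hz' (by intro k; simp [b]) (by simp [b])).1 h1).2
    rw [fuchsOp_congr h2, (IsPowerGerm.pow hz' n).fuchsOp_mul hz' h3] at h4
    exact (mul_eq_zero.1 h4).resolve_left (pow_ne_zero _ (sub_ne_zero.2 hz'))
  have hcont : ContinuousAt (fuchsOp z₀ b' g) z₀ :=
    (analyticAt_fuchsOp (fun k => analyticAt_leibnizCoeff hb k) hg).continuousAt
  have h0 : fuchsOp z₀ b' g z₀ = 0 := by
    have h1 : Tendsto (fuchsOp z₀ b' g) (𝓝[≠] z₀) (𝓝 (fuchsOp z₀ b' g z₀)) :=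
      hcont.tendsto.mono_left nhdsWithin_le_nhds
    have h2 : Tendsto (fuchsOp z₀ b' g) (𝓝[≠] z₀) (𝓝 0) :=
      (tendsto_congr' hL).2 tendsto_const_nhds
    exact tendsto_nhds_unique h1 h2
  rw [fuchsOp_center, hb', leibnizCoeff_zero, fallingSum_eq] at h0
  simp [b] at h0
  rcases h0 with ((((h | h) | h) | h) | h)
  · omega
  · exact absurd (show n = 1 by exact_mod_cast sub_eq_zero.1 h) (by omega)
  · exact absurd (show n = 2 by exact_mod_cast sub_eq_zero.1 h) (by omega)
  · exact absurd (show n = 3 by exact_mod_cast sub_eq_zero.1 h) (by omega)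
  · exact hg0 h

/-- The companion system. -/
def companion (a : ODE4) (z : ℂ) : (Fin 4 → ℂ) →L[ℂ] (Fin 4 → ℂ) :=
  let P : Fin 4 → (Fin 4 → ℂ) →L[ℂ] ℂ := fun k => ContinuousLinearMap.proj k
  (P 1).smulRight (Pi.single 0 1) + (P 2).smulRight (Pi.single 1 1)
    + (P 3).smulRight (Pi.single 2 1) - ∑ k, a k z • (P k).smulRight (Pi.single 3 1)

theorem companion_apply (a : ODE4) (z : ℂ) (v : Fin 4 → ℂ) :
    a.companion z v = ![v 1, v 2, v 3, -∑ k, a k z * v k] := by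
  ext i
  fin_cases i <;> simp [companion, Fin.sum_univ_four]

/-- The Cauchy problem on a star-shaped domain, with initial data at the centre. -/
theorem exists_solution_of_starConvex {U : Set ℂ} {c : ℂ} (hU : IsOpen U) (hs : StarConvex ℝ c U)
    (hc : c ∈ U) (ha : ∀ z ∈ U, ∀ k, AnalyticAt ℂ (a k) z) (v : Fin 4 → ℂ) :
    ∃ f : ℂ → ℂ, (∀ z ∈ U, a.SolvesAt f z) ∧ ∀ k : Fin 4, iteratedDeriv k f c = v k := by
  have hA : DifferentiableOn ℂ a.companion U := by
    intro z hz
    have h := fun k => (ha z hz k).differentiableAt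
    unfold companion
    refine DifferentiableAt.differentiableWithinAt ?_
    fun_prop
  obtain ⟨Y, hYc, hY⟩ := exists_linear_system_solution hU hs hA v
  have hcomp : ∀ z ∈ U, ∀ i, HasDerivAt (fun x => Y x i) (a.companion z (Y z) i) z :=
    fun z hz => hasDerivAt_pi.1 (hY z hz)
  simp only [companion_apply] at hcomp
  have e1 : ∀ z ∈ U, iteratedDeriv 1 (fun x => Y x 0) z = Y z 1 := fun z hz => by
    rw [iteratedDeriv_one]; exact (hcomp z hz 0).deriv
  have e2 : ∀ z ∈ U, iteratedDeriv 2 (fun x => Y x 0) z = Y z 2 := fun z hz => by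
    have : iteratedDeriv 1 (fun x => Y x 0) =ᶠ[𝓝 z] fun x => Y x 1 :=
      (hU.eventually_mem hz).mono e1
    rw [iteratedDeriv_succ, this.deriv_eq]; exact (hcomp z hz 1).deriv
  have e3 : ∀ z ∈ U, iteratedDeriv 3 (fun x => Y x 0) z = Y z 3 := fun z hz => by
    have : iteratedDeriv 2 (fun x => Y x 0) =ᶠ[𝓝 z] fun x => Y x 2 :=
      (hU.eventually_mem hz).mono e2
    rw [iteratedDeriv_succ, this.deriv_eq]; exact (hcomp z hz 2).deriv
  have e4 : ∀ z ∈ U, iteratedDeriv 4 (fun x => Y x 0) z = -∑ k, a k z * Y z k := fun z hz => by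
    have : iteratedDeriv 3 (fun x => Y x 0) =ᶠ[𝓝 z] fun x => Y x 3 :=
      (hU.eventually_mem hz).mono e3
    rw [iteratedDeriv_succ, this.deriv_eq]; exact (hcomp z hz 3).deriv
  have hjet : ∀ z ∈ U, ∀ k : Fin 4, iteratedDeriv k (fun x => Y x 0) z = Y z k := by
    intro z hz k
    fin_cases k
    · simp
    · exact e1 z hz
    · exact e2 z hz
    · exact e3 z hz
  refine ⟨fun x => Y x 0, fun z hz => ⟨?_, ?_⟩, fun k => by rw [hjet c hc, hYc]⟩
  · exact DifferentiableOn.analyticOnNhd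
      (fun x hx => (hcomp x hx 0).differentiableAt.differentiableWithinAt) hU z hz
  · rw [e4 z hz]
    simp only [hjet z hz]
    ring

end ODE4

/-! ### Bases of solutions on domains -/

namespace ODE4

variable {a : ODE4}

theorem iteratedDeriv_linComb {e : Fin 4 → ℂ → ℂ} {z : ℂ} (c : Fin 4 → ℂ)
    (he : ∀ i, AnalyticAt ℂ (e i) z) (k : ℕ) :
    iteratedDeriv k (fun x => ∑ i, c i * e i x) z = ∑ i, c i * iteratedDeriv k (e i) z := by
  rw [iteratedDeriv_fun_sum (f := fun i x => c i * e i x)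
    (fun i _ => ((analyticAt_const.mul (he i)).contDiffAt_nat k))]
  simp only [iteratedDeriv_const_mul_field]

/-- Four linearly independent solutions form a basis. -/
theorem isLocalBasis_of_linearIndependent {e : Fin 4 → ℂ → ℂ} {z : ℂ}
    (ha : ∀ k, AnalyticAt ℂ (a k) z) (he : ∀ i, ∀ᶠ x in 𝓝 z, a.SolvesAt (e i) x)
    (hi : ∀ c : Fin 4 → ℂ, (fun x => ∑ i, c i * e i x) =ᶠ[𝓝 z] 0 → c = 0) :
    a.IsLocalBasis z e := by
  have hea : ∀ i, AnalyticAt ℂ (e i) z := fun i => (he i).self_of_nhds.1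
  have hsol : ∀ c : Fin 4 → ℂ, ∀ᶠ x in 𝓝 z, a.SolvesAt (fun x => ∑ i, c i * e i x) x := by
    intro c
    filter_upwards [eventually_all.2 he] with x hx using SolvesAt.sum c fun i _ => hx i
  -- `T` sends coefficients to the jet of the combination at `z`. It is injective because a solution
  -- is determined by its jet, hence bijective by dimension, so every jet is reached.
  let T : (Fin 4 → ℂ) →ₗ[ℂ] (Fin 4 → ℂ) :=
    { toFun := fun c k => ∑ i, c i * iteratedDeriv k (e i) z
      map_add' := fun c d => by ext k; simp [add_mul, Finset.sum_add_distrib]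
      map_smul' := fun r c => by ext k; simp [Finset.mul_sum, mul_assoc] }
  have hT : ∀ c k, T c k = iteratedDeriv k (fun x => ∑ i, c i * e i x) z := fun c k =>
    (iteratedDeriv_linComb c hea k).symm
  have hinj : Function.Injective T := by
    rw [← LinearMap.ker_eq_bot, LinearMap.ker_eq_bot']
    intro c hc
    refine hi c (eventuallyEq_zero_of_jet ha (hsol c) fun k => ?_)
    rw [← hT, hc]; rfl
  have hsurj := LinearMap.injective_iff_surjective.1 hinj
  refine ⟨he, fun f hf => ?_⟩
  obtain ⟨c, hc⟩ := hsurj fun k => iteratedDeriv k f z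
  refine ⟨c, ?_, fun d hd => ?_⟩
  · have h0 : (fun x => f x - ∑ i, c i * e i x) =ᶠ[𝓝 z] 0 := by
      refine eventuallyEq_zero_of_jet ha ?_ fun k => ?_
      · filter_upwards [hf, hsol c] with x h1 h2 using h1.sub h2
      · rw [iteratedDeriv_fun_sub (hf.self_of_nhds.1.contDiffAt_nat _)
          ((hsol c).self_of_nhds.1.contDiffAt_nat _), ← hT, hc, sub_self]
    filter_upwards [h0] with x hx using sub_eq_zero.1 hx
  · apply hinj
    rw [hc]
    ext k
    rw [hT, (hd.iteratedDeriv k).eq_of_nhds]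

theorem IsLocalBasis.eq_zero {e : Fin 4 → ℂ → ℂ} {z : ℂ} (h : a.IsLocalBasis z e)
    {c : Fin 4 → ℂ} (hc : (fun x => ∑ i, c i * e i x) =ᶠ[𝓝 z] 0) : c = 0 := by
  obtain ⟨d, -, hd⟩ := h.2 (fun _ => 0) (Eventually.of_forall solvesAt_zero)
  have h1 := hd c (by filter_upwards [hc] with x hx; simpa using hx.symm)
  have h2 := hd 0 (Eventually.of_forall fun x => by simp)
  rw [h1, h2]

theorem IsLocalBasis.coeff_unique {e : Fin 4 → ℂ → ℂ} {z : ℂ} (h : a.IsLocalBasis z e)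
    {c d : Fin 4 → ℂ}
    (hc : (fun x => ∑ i, c i * e i x) =ᶠ[𝓝 z] fun x => ∑ i, d i * e i x) : c = d := by
  refine sub_eq_zero.1 (h.eq_zero ?_)
  filter_upwards [hc] with x hx
  simp only [Pi.sub_apply, sub_mul, Finset.sum_sub_distrib, hx, sub_self, Pi.zero_apply]

theorem analyticOnNhd_of_solves {D : Set ℂ} {f : ℂ → ℂ} (h : ∀ z ∈ D, a.SolvesAt f z) :
    AnalyticOnNhd ℂ f D := fun z hz => (h z hz).1

theorem analyticOnNhd_linComb {D : Set ℂ} {e : Fin 4 → ℂ → ℂ} (c : Fin 4 → ℂ)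
    (h : ∀ i, ∀ z ∈ D, a.SolvesAt (e i) z) :
    AnalyticOnNhd ℂ (fun x => ∑ i, c i * e i x) D :=
  analyticOnNhd_of_solves fun z hz => SolvesAt.sum c fun i _ => h i z hz

/-- A basis at one point of a domain is a basis at every other one. -/
theorem IsLocalBasis.transport {D : Set ℂ} {e : Fin 4 → ℂ → ℂ} {z z' : ℂ} (hD : IsOpen D)
    (hc : IsPreconnected D) (ha : ∀ z ∈ D, ∀ k, AnalyticAt ℂ (a k) z)
    (he : ∀ i, ∀ z ∈ D, a.SolvesAt (e i) z) (h : a.IsLocalBasis z e) (hz : z ∈ D) (hz' : z' ∈ D) :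
    a.IsLocalBasis z' e := by
  refine isLocalBasis_of_linearIndependent (ha z' hz')
    (fun i => (hD.eventually_mem hz').mono (he i)) fun c hc0 => h.eq_zero ?_
  have := (analyticOnNhd_linComb c he).eqOn_of_preconnected_of_eventuallyEq
    (g := 0) analyticOnNhd_const hc hz' hc0
  exact this.eventuallyEq_of_mem (hD.mem_nhds hz)

/-- The solutions whose jets at the centre are the unit vectors form a basis there; connectedness
carries it to `z`. -/
theorem exists_basis_of_starConvex {U : Set ℂ} {c z : ℂ} (hU : IsOpen U) (hs : StarConvex ℝ c U)
    (hc : c ∈ U) (ha : ∀ z ∈ U, ∀ k, AnalyticAt ℂ (a k) z) (hz : z ∈ U) :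
    ∃ e : Fin 4 → ℂ → ℂ, (∀ i, ∀ z ∈ U, a.SolvesAt (e i) z) ∧ a.IsLocalBasis z e := by
  choose e he hj using fun i : Fin 4 =>
    exists_solution_of_starConvex hU hs hc ha (Pi.single i (1 : ℂ))
  refine ⟨e, he, ?_⟩
  have hb : a.IsLocalBasis c e := by
    refine isLocalBasis_of_linearIndependent (ha c hc)
      (fun i => (hU.eventually_mem hc).mono (he i)) fun d hd => ?_
    ext k
    have h := (hd.iteratedDeriv k).eq_of_nhds
    rw [iteratedDeriv_linComb d (fun i => (he i c hc).1)] at h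
    simp only [hj] at h
    have h0 : iteratedDeriv k (0 : ℂ → ℂ) c = 0 := by
      rw [show (0 : ℂ → ℂ) = fun _ => 0 from rfl, iteratedDeriv_const]; simp
    rw [h0] at h
    simpa [Pi.single_apply] using h
  exact hb.transport hU (hs.isPathConnected hc).isConnected.isPreconnected ha he hc hz

/-- A germ of solution extends to any star-shaped domain. -/
theorem exists_extension {U : Set ℂ} {c z : ℂ} (hU : IsOpen U) (hs : StarConvex ℝ c U)
    (hc : c ∈ U) (ha : ∀ z ∈ U, ∀ k, AnalyticAt ℂ (a k) z) (hz : z ∈ U) {f : ℂ → ℂ}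
    (hf : ∀ᶠ x in 𝓝 z, a.SolvesAt f x) :
    ∃ F : ℂ → ℂ, (∀ z ∈ U, a.SolvesAt F z) ∧ F =ᶠ[𝓝 z] f := by
  obtain ⟨e, he, hb⟩ := exists_basis_of_starConvex hU hs hc ha hz
  obtain ⟨d, hd, -⟩ := hb.2 f hf
  exact ⟨_, fun z hz => SolvesAt.sum d fun i _ => he i z hz, hd.symm⟩

/-! ### Analytic continuation -/

theorem IsContinuation.glue {γ : ℝ → ℂ} {D₁ D₂ : Set ℂ} {f₁ f₂ : ℂ → ℂ} (hγ : Continuous γ)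
    (hD₁ : IsOpen D₁) (hD₂ : IsOpen D₂) (h₁ : ∀ z ∈ D₁, a.SolvesAt f₁ z)
    (h₂ : ∀ z ∈ D₂, a.SolvesAt f₂ z) (hγ₁ : ∀ t ∈ Set.Icc (0 : ℝ) (1 / 2), γ t ∈ D₁)
    (hγ₂ : ∀ t ∈ Set.Icc (1 / 2 : ℝ) 1, γ t ∈ D₂) (h : f₁ =ᶠ[𝓝 (γ (1 / 2))] f₂) :
    a.IsContinuation γ fun t => if t ≤ 1 / 2 then f₁ else f₂ := by
  intro t ht
  rcases lt_trichotomy t (1 / 2) with hlt | rfl | hgt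
  · refine ⟨?_, nhdsWithin_le_nhds ?_⟩
    · simp only [if_pos hlt.le]
      exact (hD₁.eventually_mem (hγ₁ t ⟨ht.1, hlt.le⟩)).mono h₁
    · filter_upwards [eventually_lt_nhds hlt] with s hs
      rw [if_pos hlt.le, if_pos hs.le]
  · refine ⟨?_, nhdsWithin_le_nhds ?_⟩
    · simp only [if_pos le_rfl]
      exact (hD₁.eventually_mem (hγ₁ _ ⟨ht.1, le_rfl⟩)).mono h₁
    · filter_upwards [hγ.continuousAt.eventually h.eventuallyEq_nhds] with s hs
      rw [if_pos le_rfl]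
      split_ifs
      · rfl
      · exact hs.symm
  · refine ⟨?_, nhdsWithin_le_nhds ?_⟩
    · simp only [if_neg hgt.not_ge]
      exact (hD₂.eventually_mem (hγ₂ t ⟨hgt.le, ht.2⟩)).mono h₂
    · filter_upwards [eventually_gt_nhds hgt] with s hs
      rw [if_neg hgt.not_ge, if_neg hs.not_ge]

/-- By the identity theorem on a small ball, coincidence of germs neither starts nor stops near `z`.
This makes the set of times in `IsContinuation.unique` both open and closed. -/
theorem eventually_eventuallyEq_iff {f g : ℂ → ℂ} {z : ℂ} (hf : AnalyticAt ℂ f z)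
    (hg : AnalyticAt ℂ g z) : ∀ᶠ w in 𝓝 z, (f =ᶠ[𝓝 w] g ↔ f =ᶠ[𝓝 z] g) := by
  obtain ⟨r, hr, hb⟩ := Metric.eventually_nhds_iff_ball.1
    (hf.eventually_analyticAt.and hg.eventually_analyticAt)
  have hpre : IsPreconnected (Metric.ball z r) := (convex_ball z r).isPreconnected
  have key : ∀ w ∈ Metric.ball z r, ∀ w' ∈ Metric.ball z r, f =ᶠ[𝓝 w] g → f =ᶠ[𝓝 w'] g := by
    intro w hw w' hw' h
    have := AnalyticOnNhd.eqOn_of_preconnected_of_eventuallyEq (𝕜 := ℂ)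
      (fun x hx => (hb x hx).1) (fun x hx => (hb x hx).2) hpre hw h
    exact this.eventuallyEq_of_mem (Metric.isOpen_ball.mem_nhds hw')
  filter_upwards [Metric.ball_mem_nhds z hr] with w hw
  exact ⟨key w hw z (Metric.mem_ball_self hr), key z (Metric.mem_ball_self hr) w hw⟩

/-- The times at which the two germs agree form a clopen set in the connected interval, and it
contains `0`. -/
theorem IsContinuation.unique {γ : ℝ → ℂ} {F F' : ℝ → ℂ → ℂ} (hγ : Continuous γ)
    (hF : a.IsContinuation γ F) (hF' : a.IsContinuation γ F') (h0 : F 0 =ᶠ[𝓝 (γ 0)] F' 0) :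
    F 1 =ᶠ[𝓝 (γ 1)] F' 1 := by
  let S : Set (Set.Icc (0 : ℝ) 1) := {t | F t =ᶠ[𝓝 (γ t)] F' t}
  have hloc : ∀ t : Set.Icc (0 : ℝ) 1, ∀ᶠ s in 𝓝 t, (s ∈ S ↔ t ∈ S) := by
    intro t
    obtain ⟨h1, h2⟩ := hF t t.2
    obtain ⟨h1', h2'⟩ := hF' t t.2
    have h3 := eventually_eventuallyEq_iff h1.self_of_nhds.1 h1'.self_of_nhds.1
    have h4 : ∀ᶠ s in 𝓝[Set.Icc 0 1] (t : ℝ), F s =ᶠ[𝓝 (γ s)] F t ∧ F' s =ᶠ[𝓝 (γ s)] F' t ∧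
        (F t =ᶠ[𝓝 (γ s)] F' t ↔ F t =ᶠ[𝓝 (γ t)] F' t) := by
      filter_upwards [h2, h2', nhdsWithin_le_nhds (hγ.continuousAt.eventually h3)] with s a b c
      exact ⟨a, b, c⟩
    rw [nhdsWithin_eq_map_subtype_coe t.2, eventually_map] at h4
    filter_upwards [h4] with s hs
    obtain ⟨e1, e2, e3⟩ := hs
    exact ⟨fun h => e3.1 (e1.symm.trans (h.trans e2)), fun h => e1.trans ((e3.2 h).trans e2.symm)⟩
  have hopen : IsOpen S := isOpen_iff_mem_nhds.2 fun t ht =>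
    (hloc t).mono fun s hs => hs.2 ht
  have hclosed : IsClosed S := by
    rw [← isOpen_compl_iff]
    exact isOpen_iff_mem_nhds.2 fun t ht => (hloc t).mono fun s hs h => ht (hs.1 h)
  have huniv : S = Set.univ := by
    have : PreconnectedSpace (Set.Icc (0 : ℝ) 1) :=
      isPreconnected_iff_preconnectedSpace.1 isPreconnected_Icc
    exact IsClopen.eq_univ ⟨hclosed, hopen⟩ ⟨⟨0, by simp⟩, h0⟩
  have : (⟨1, by simp⟩ : Set.Icc (0 : ℝ) 1) ∈ S := huniv ▸ Set.mem_univ _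
  exact this

theorem IsMonodromyMatrix.unique {γ : ℝ → ℂ} {u : Fin 4 → ℂ → ℂ} {M N : Matrix (Fin 4) (Fin 4) ℂ}
    (hγ : Continuous γ) (hu : a.IsLocalBasis (γ 1) u) (hM : a.IsMonodromyMatrix γ u M)
    (hN : a.IsMonodromyMatrix γ u N) : N = M := by
  ext i j
  obtain ⟨F, hF, hF0, hF1⟩ := hM j
  obtain ⟨F', hF', hF0', hF1'⟩ := hN j
  have h := hF.unique hγ hF' (hF0.trans hF0'.symm)
  have := hu.coeff_unique (c := fun i => N i j) (d := fun i => M i j)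
    (hF1'.symm.trans (h.symm.trans hF1))
  exact congrFun this i

/-! ### Monodromy as a jump between two slit domains -/

/-- Two bases on overlapping domains that agree above the real axis, and the matrix that relates
them below it. -/
structure Crossing (a : ODE4) (D' D : Set ℂ) (f' f : Fin 4 → ℂ → ℂ)
    (M : Matrix (Fin 4) (Fin 4) ℂ) : Prop where
  isOpen' : IsOpen D'
  isOpen : IsOpen D
  solves' : ∀ i, ∀ z ∈ D', a.SolvesAt (f' i) z
  solves : ∀ i, ∀ z ∈ D, a.SolvesAt (f i) z
  basis' : ∀ z ∈ D', a.IsLocalBasis z f'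
  basis : ∀ z ∈ D, a.IsLocalBasis z f
  upper : ∀ i, ∀ z : ℂ, 0 < z.im → f' i z = f i z
  lower : ∀ j, ∀ z : ℂ, z.im < 0 → f' j z = ∑ i, M i j * f i z

theorem isOpen_im_pos : IsOpen {z : ℂ | 0 < z.im} := isOpen_lt continuous_const Complex.continuous_im
theorem isOpen_im_neg : IsOpen {z : ℂ | z.im < 0} := isOpen_lt Complex.continuous_im continuous_const

/-- The continuation uses `f'` on the first half of the loop and the corresponding combination of
`f` on the second; the two agree where the loop changes domains, below the real axis. -/
theorem Crossing.isMonodromyMatrix {D' D : Set ℂ} {f' f u : Fin 4 → ℂ → ℂ}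
    {M : Matrix (Fin 4) (Fin 4) ℂ} (h : a.Crossing D' D f' f M) {γ : ℝ → ℂ} (hγ : Continuous γ)
    (hγ₁ : ∀ t ∈ Set.Icc (0 : ℝ) (1 / 2), γ t ∈ D') (hγ₂ : ∀ t ∈ Set.Icc (1 / 2 : ℝ) 1, γ t ∈ D)
    (him : (γ (1 / 2)).im < 0) (h0 : ∀ i, f' i =ᶠ[𝓝 (γ 0)] u i)
    (h1 : ∀ i, f i =ᶠ[𝓝 (γ 1)] u i) : a.IsMonodromyMatrix γ u M := by
  intro j
  refine ⟨_, IsContinuation.glue hγ h.isOpen' h.isOpen (h.solves' j)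
    (fun z hz => SolvesAt.sum (s := Finset.univ) (fun i => M i j) fun i _ => h.solves i z hz) hγ₁ hγ₂ ?_, ?_, ?_⟩
  · exact (isOpen_im_neg.eventually_mem him).mono fun z hz => h.lower j z hz
  · simpa using h0 j
  · have : ¬ (1 : ℝ) ≤ 1 / 2 := by norm_num
    simp only [this, if_false]
    filter_upwards [eventually_all.2 h1] with z hz
    simp only [hz]

/-- The action of a crossing on a solution given by local formulas. -/
theorem Crossing.exists_coeff {D' D S' S : Set ℂ} {f' f : Fin 4 → ℂ → ℂ}
    {M : Matrix (Fin 4) (Fin 4) ℂ} (h : a.Crossing D' D f' f M) (hS' : IsOpen S') (hS : IsOpen S)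
    (hSc' : IsPreconnected S') (hSc : IsPreconnected S) (hSD' : S' ⊆ D') (hSD : S ⊆ D)
    {z₁ z₂ : ℂ} (h1' : z₁ ∈ S') (h1 : z₁ ∈ S) (h2' : z₂ ∈ S') (hi1 : 0 < z₁.im)
    (hi2 : z₂.im < 0) {e' e : ℂ → ℂ} (he' : ∀ z ∈ S', a.SolvesAt e' z)
    (he : ∀ z ∈ S, a.SolvesAt e z) (hee : e' =ᶠ[𝓝 z₁] e) :
    ∃ s : Fin 4 → ℂ, (∀ z ∈ S, e z = ∑ i, s i * f i z) ∧
      e' =ᶠ[𝓝 z₂] fun z => ∑ i, (M.mulVec s) i * f i z := by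
  obtain ⟨s, hs, -⟩ := (h.basis z₁ (hSD h1)).2 e ((hS.eventually_mem h1).mono he)
  have hS1 : ∀ z ∈ S, e z = ∑ i, s i * f i z :=
    (analyticOnNhd_of_solves he).eqOn_of_preconnected_of_eventuallyEq
      (analyticOnNhd_linComb s fun i z hz => h.solves i z (hSD hz)) hSc h1 hs
  have hs' : e' =ᶠ[𝓝 z₁] fun z => ∑ i, s i * f' i z := by
    filter_upwards [hee, hs, isOpen_im_pos.eventually_mem hi1] with z a1 a2 a3
    rw [a1, a2]
    exact Finset.sum_congr rfl fun i _ => by rw [h.upper i z a3]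
  have hS2 : ∀ z ∈ S', e' z = ∑ i, s i * f' i z :=
    (analyticOnNhd_of_solves he').eqOn_of_preconnected_of_eventuallyEq
      (analyticOnNhd_linComb s fun i z hz => h.solves' i z (hSD' hz)) hSc' h1' hs'
  refine ⟨s, hS1, ?_⟩
  filter_upwards [hS'.eventually_mem h2', isOpen_im_neg.eventually_mem hi2] with z a1 a2
  rw [hS2 z a1]
  simp only [h.lower _ z a2, Matrix.mulVec, dotProduct, Finset.mul_sum, Finset.sum_mul]
  rw [Finset.sum_comm]
  exact Finset.sum_congr rfl fun i _ => Finset.sum_congr rfl fun j _ => by ring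

end ODE4

/-! ### The three slit planes -/

/-- `ℂ ∖ [0, ∞)` -/
def domNeg : Set ℂ := {z | -z ∈ Complex.slitPlane}
/-- `ℂ ∖ ((-∞, 0] ∪ [1, ∞))` -/
def domMid : Set ℂ := {z | z ∈ Complex.slitPlane ∧ 1 - z ∈ Complex.slitPlane}
/-- `ℂ ∖ (-∞, 1]` -/
def domPos : Set ℂ := {z | z - 1 ∈ Complex.slitPlane}

theorem mem_domNeg {z : ℂ} : z ∈ domNeg ↔ z.re < 0 ∨ z.im ≠ 0 := by
  simp [domNeg, Complex.mem_slitPlane_iff]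
theorem mem_domMid {z : ℂ} : z ∈ domMid ↔ (0 < z.re ∧ z.re < 1) ∨ z.im ≠ 0 := by
  simp [domMid, Complex.mem_slitPlane_iff]; tauto
theorem mem_domPos {z : ℂ} : z ∈ domPos ↔ 1 < z.re ∨ z.im ≠ 0 := by
  simp [domPos, Complex.mem_slitPlane_iff]

theorem isOpen_domNeg : IsOpen domNeg := Complex.isOpen_slitPlane.preimage (by fun_prop)
theorem isOpen_domMid : IsOpen domMid :=
  Complex.isOpen_slitPlane.inter (Complex.isOpen_slitPlane.preimage (by fun_prop))
theorem isOpen_domPos : IsOpen domPos := Complex.isOpen_slitPlane.preimage (by fun_prop)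

theorem starConvex_domNeg : StarConvex ℝ (-1) domNeg := by
  intro z hz s t hs ht hst
  rw [mem_domNeg] at hz ⊢
  simp
  rcases hz with h | h
  · by_cases h0 : t = 0
    · left; subst h0; simp; linarith
    · left; nlinarith [mul_neg_of_pos_of_neg (ht.lt_of_ne' h0) h]
  · by_cases h0 : t = 0
    · left; subst h0; simp; linarith
    · right; exact ⟨h0, h⟩

theorem starConvex_domMid : StarConvex ℝ (1 / 2) domMid := by
  intro z hz s t hs ht hst
  rw [mem_domMid] at hz ⊢
  simp
  rcases hz with h | h
  · left; constructor <;> nlinarith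
  · by_cases h0 : t = 0
    · left; subst h0; constructor <;> norm_num <;> linarith
    · right; exact ⟨h0, h⟩

theorem starConvex_domPos : StarConvex ℝ 2 domPos := by
  intro z hz s t hs ht hst
  rw [mem_domPos] at hz ⊢
  simp
  rcases hz with h | h
  · left; nlinarith [mul_nonneg ht (sub_pos.2 h).le]
  · by_cases h0 : t = 0
    · left; subst h0; simp; linarith
    · right; exact ⟨h0, h⟩

theorem ne_of_mem_domNeg {z : ℂ} (h : z ∈ domNeg) : z ≠ 0 ∧ z ≠ 1 := by
  rw [mem_domNeg] at h
  constructor <;> rintro rfl <;> norm_num at h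
theorem ne_of_mem_domMid {z : ℂ} (h : z ∈ domMid) : z ≠ 0 ∧ z ≠ 1 := by
  rw [mem_domMid] at h
  constructor <;> rintro rfl <;> norm_num at h
theorem ne_of_mem_domPos {z : ℂ} (h : z ∈ domPos) : z ≠ 0 ∧ z ≠ 1 := by
  rw [mem_domPos] at h
  constructor <;> rintro rfl <;> norm_num at h

/-! ### The loops -/

theorem basePoint_re : basePoint.re = 1 / 2 := by simp [basePoint]
theorem basePoint_im : basePoint.im = 3 / 4 := by simp [basePoint]

theorem exp_loop (t : ℝ) : Complex.exp (2 * Real.pi * Complex.I * t) =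
    (Real.cos (2 * Real.pi * t) : ℂ) + (Real.sin (2 * Real.pi * t) : ℂ) * Complex.I := by
  rw [show 2 * (Real.pi : ℂ) * Complex.I * t = ((2 * Real.pi * t : ℝ) : ℂ) * Complex.I by
    push_cast; ring, Complex.exp_mul_I]
  simp

theorem exp_neg_loop (t : ℝ) : Complex.exp (-(2 * Real.pi * Complex.I * t)) =
    (Real.cos (2 * Real.pi * t) : ℂ) - (Real.sin (2 * Real.pi * t) : ℂ) * Complex.I := by
  rw [show -(2 * (Real.pi : ℂ) * Complex.I * t) = ((-(2 * Real.pi * t) : ℝ) : ℂ) * Complex.I by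
    push_cast; ring, Complex.exp_mul_I, ← Complex.ofReal_cos, ← Complex.ofReal_sin,
    Real.cos_neg, Real.sin_neg]
  push_cast; ring

theorem sin_loop_nonneg {t : ℝ} (ht : t ∈ Set.Icc (0 : ℝ) (1 / 2)) :
    0 ≤ Real.sin (2 * Real.pi * t) :=
  Real.sin_nonneg_of_nonneg_of_le_pi (by have := Real.pi_pos; have := ht.1; positivity)
    (by nlinarith [ht.2, Real.pi_pos])

theorem sin_loop_nonpos {t : ℝ} (ht : t ∈ Set.Icc (1 / 2 : ℝ) 1) :
    Real.sin (2 * Real.pi * t) ≤ 0 := by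
  have h := Real.sin_nonneg_of_nonneg_of_le_pi (x := 2 * Real.pi * t - Real.pi)
    (by nlinarith [ht.1, Real.pi_pos]) (by nlinarith [ht.2, Real.pi_pos])
  rw [Real.sin_sub_pi] at h
  linarith

theorem continuous_loops (j : Fin 3) : Continuous (loops j) := by
  fin_cases j <;> simp [loops] <;> fun_prop

theorem loops_zero (j : Fin 3) : loops j 0 = basePoint := by
  fin_cases j <;> simp [loops]

theorem loops_one (j : Fin 3) : loops j 1 = basePoint := by
  have h : Complex.exp (2 * Real.pi * Complex.I) = 1 := Complex.exp_two_pi_mul_I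
  fin_cases j <;> simp [loops, Complex.exp_neg, h]

theorem loops_re_im (t : ℝ) :
    ((loops 0 t).re = 1 / 2 * Real.cos (2 * Real.pi * t) - 3 / 4 * Real.sin (2 * Real.pi * t) ∧
     (loops 0 t).im = 1 / 2 * Real.sin (2 * Real.pi * t) + 3 / 4 * Real.cos (2 * Real.pi * t)) ∧
    ((loops 1 t).re =
      1 - 1 / 2 * Real.cos (2 * Real.pi * t) - 3 / 4 * Real.sin (2 * Real.pi * t) ∧
     (loops 1 t).im = 3 / 4 * Real.cos (2 * Real.pi * t) - 1 / 2 * Real.sin (2 * Real.pi * t)) ∧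
    ((loops 2 t).re = 1 / 2 + 3 / 4 * Real.sin (2 * Real.pi * t) ∧
     (loops 2 t).im = 3 / 4 * Real.cos (2 * Real.pi * t)) := by
  simp only [loops, Matrix.cons_val_zero, Matrix.cons_val_one, Matrix.cons_val, exp_loop,
    exp_neg_loop]
  generalize Real.cos (2 * Real.pi * t) = c
  generalize Real.sin (2 * Real.pi * t) = s
  refine ⟨⟨?_, ?_⟩, ⟨?_, ?_⟩, ⟨?_, ?_⟩⟩ <;> simp [basePoint_re, basePoint_im] <;> ring

theorem loops_half_im (j : Fin 3) : (loops j (1 / 2)).im < 0 := by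
  have hc : Real.cos (2 * Real.pi * (1 / 2)) = -1 := by
    rw [show 2 * Real.pi * (1 / 2) = Real.pi by ring, Real.cos_pi]
  have hs : Real.sin (2 * Real.pi * (1 / 2)) = 0 := by
    rw [show 2 * Real.pi * (1 / 2) = Real.pi by ring, Real.sin_pi]
  obtain ⟨⟨-, h0⟩, ⟨-, h1⟩, ⟨-, h2⟩⟩ := loops_re_im (1 / 2)
  rw [hc, hs] at h0 h1
  rw [hc] at h2
  fin_cases j
  · change (loops 0 (1 / 2)).im < 0; rw [h0]; norm_num
  · change (loops 1 (1 / 2)).im < 0; rw [h1]; norm_num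
  · change (loops 2 (1 / 2)).im < 0; rw [h2]; norm_num

/-- Off the real axis there is nothing to check. Where the circle meets the axis, the vanishing
imaginary part ties cosine to sine, and the sign of the sine on this half of the loop places the
real part. -/
theorem loops_mem_first {t : ℝ} (ht : t ∈ Set.Icc (0 : ℝ) (1 / 2)) :
    loops 0 t ∈ domNeg ∧ loops 1 t ∈ domMid ∧ loops 2 t ∈ domPos := by
  obtain ⟨⟨r0, i0⟩, ⟨r1, i1⟩, ⟨r2, i2⟩⟩ := loops_re_im t
  have hs := sin_loop_nonneg ht
  have hcs := Real.sin_sq_add_cos_sq (2 * Real.pi * t)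
  rw [mem_domNeg, mem_domMid, mem_domPos, r0, r1, r2, i0, i1, i2]
  generalize Real.cos (2 * Real.pi * t) = c at *
  generalize Real.sin (2 * Real.pi * t) = s at *
  refine ⟨?_, ?_, ?_⟩ <;> rw [or_iff_not_imp_right, not_not] <;> intro h
  · have hc : c = -2 / 3 * s := by linarith
    subst hc
    have : 0 < s := by nlinarith
    linarith
  · have hc : c = 2 / 3 * s := by linarith
    subst hc
    have : 0 < s := by nlinarith
    constructor <;> nlinarith
  · have hc : c = 0 := by linarith
    subst hc
    nlinarith

theorem loops_mem_second {t : ℝ} (ht : t ∈ Set.Icc (1 / 2 : ℝ) 1) :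
    loops 0 t ∈ domMid ∧ loops 1 t ∈ domPos ∧ loops 2 t ∈ domNeg := by
  obtain ⟨⟨r0, i0⟩, ⟨r1, i1⟩, ⟨r2, i2⟩⟩ := loops_re_im t
  have hs := sin_loop_nonpos ht
  have hcs := Real.sin_sq_add_cos_sq (2 * Real.pi * t)
  rw [mem_domNeg, mem_domMid, mem_domPos, r0, r1, r2, i0, i1, i2]
  generalize Real.cos (2 * Real.pi * t) = c at *
  generalize Real.sin (2 * Real.pi * t) = s at *
  refine ⟨?_, ?_, ?_⟩ <;> rw [or_iff_not_imp_right, not_not] <;> intro h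
  · have hc : c = -2 / 3 * s := by linarith
    subst hc
    have : s < 0 := by nlinarith
    constructor <;> nlinarith
  · have hc : c = 2 / 3 * s := by linarith
    subst hc
    have : s < 0 := by nlinarith
    linarith
  · have hc : c = 0 := by linarith
    subst hc
    nlinarith

/-! ### The monodromy triple -/

namespace ODE4

variable {a : ODE4}

/-- Both families are bases near `-i`, which gives a matrix there; the identity theorem extends the
relation over the connected lower half-plane. -/
theorem exists_crossing_matrix {D' D : Set ℂ} {f' f : Fin 4 → ℂ → ℂ} (hD' : IsOpen D')
    (hD : IsOpen D) (hlow' : ∀ z : ℂ, z.im < 0 → z ∈ D') (hlow : ∀ z : ℂ, z.im < 0 → z ∈ D)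
    (hs' : ∀ i, ∀ z ∈ D', a.SolvesAt (f' i) z) (hs : ∀ i, ∀ z ∈ D, a.SolvesAt (f i) z)
    (hb' : ∀ z ∈ D', a.IsLocalBasis z f') (hb : ∀ z ∈ D, a.IsLocalBasis z f)
    (hup : ∀ i, ∀ z : ℂ, 0 < z.im → f' i z = f i z) :
    ∃ M, a.Crossing D' D f' f M := by
  have hlowpre : IsPreconnected {z : ℂ | z.im < 0} :=
    (convex_halfSpace_im_lt 0).isPreconnected
  have hz : ((-Complex.I : ℂ)).im < 0 := by simp
  choose c hcc _ using fun j => (hb _ (hlow _ hz)).2 (f' j)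
    ((hD'.eventually_mem (hlow' _ hz)).mono (hs' j))
  refine ⟨fun i j => c j i, hD', hD, hs', hs, hb', hb, hup, fun j z hzl => ?_⟩
  have := (AnalyticOnNhd.eqOn_of_preconnected_of_eventuallyEq
    (analyticOnNhd_of_solves fun z hz => hs' j z (hlow' z hz))
    (analyticOnNhd_linComb (c j) fun i z hz => hs i z (hlow z hz)) hlowpre hz (hcc j))
  exact this hzl

/-- The germs of `u` are extended to each of the three slit planes. The extensions agree on the
upper half-plane, which contains the base point, so only the lower half-plane remembers how the
loops wind. -/
theorem exists_crossings (ha : ∀ z, z ≠ 0 → z ≠ 1 → ∀ k, AnalyticAt ℂ (a k) z)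
    {u : Fin 4 → ℂ → ℂ} (hu : a.IsLocalBasis basePoint u) :
    ∃ (M : Fin 3 → Matrix (Fin 4) (Fin 4) ℂ) (n m p : Fin 4 → ℂ → ℂ),
      a.Crossing domNeg domMid n m (M 0) ∧ a.Crossing domMid domPos m p (M 1) ∧
      a.Crossing domPos domNeg p n (M 2) ∧ (∀ i, n i =ᶠ[𝓝 basePoint] u i) ∧
      (∀ i, m i =ᶠ[𝓝 basePoint] u i) ∧ ∀ i, p i =ᶠ[𝓝 basePoint] u i := by
  have hup : (0 : ℝ) < basePoint.im := by rw [basePoint_im]; norm_num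
  have haN : ∀ z ∈ domNeg, ∀ k, AnalyticAt ℂ (a k) z := fun z hz =>
    ha z (ne_of_mem_domNeg hz).1 (ne_of_mem_domNeg hz).2
  have haM : ∀ z ∈ domMid, ∀ k, AnalyticAt ℂ (a k) z := fun z hz =>
    ha z (ne_of_mem_domMid hz).1 (ne_of_mem_domMid hz).2
  have haP : ∀ z ∈ domPos, ∀ k, AnalyticAt ℂ (a k) z := fun z hz =>
    ha z (ne_of_mem_domPos hz).1 (ne_of_mem_domPos hz).2
  have cN : (-1 : ℂ) ∈ domNeg := by rw [mem_domNeg]; simp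
  have cM : (1 / 2 : ℂ) ∈ domMid := by rw [mem_domMid]; norm_num
  have cP : (2 : ℂ) ∈ domPos := by rw [mem_domPos]; norm_num
  have preN := (starConvex_domNeg.isPathConnected cN).isConnected.isPreconnected
  have preM := (starConvex_domMid.isPathConnected cM).isConnected.isPreconnected
  have preP := (starConvex_domPos.isPathConnected cP).isConnected.isPreconnected
  have iN : ∀ z : ℂ, z.im ≠ 0 → z ∈ domNeg := fun z hz => mem_domNeg.2 (.inr hz)
  have iM : ∀ z : ℂ, z.im ≠ 0 → z ∈ domMid := fun z hz => mem_domMid.2 (.inr hz)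
  have iP : ∀ z : ℂ, z.im ≠ 0 → z ∈ domPos := fun z hz => mem_domPos.2 (.inr hz)
  choose n hn hnu using fun i => exists_extension isOpen_domNeg starConvex_domNeg cN haN
    (iN _ hup.ne') (hu.1 i)
  choose m hm hmu using fun i => exists_extension isOpen_domMid starConvex_domMid cM haM
    (iM _ hup.ne') (hu.1 i)
  choose p hp hpu using fun i => exists_extension isOpen_domPos starConvex_domPos cP haP
    (iP _ hup.ne') (hu.1 i)
  have hloc : ∀ {D : Set ℂ} {e : Fin 4 → ℂ → ℂ}, IsOpen D → IsPreconnected D →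
      (∀ z ∈ D, ∀ k, AnalyticAt ℂ (a k) z) → (∀ i, ∀ z ∈ D, a.SolvesAt (e i) z) →
      basePoint ∈ D → (∀ i, e i =ᶠ[𝓝 basePoint] u i) → ∀ z ∈ D, a.IsLocalBasis z e := by
    intro D e hD hc haD he hbD heu z hz
    refine IsLocalBasis.transport hD hc haD he (z := basePoint) ?_ hbD hz
    refine isLocalBasis_of_linearIndependent (haD _ hbD)
      (fun i => (hD.eventually_mem hbD).mono (he i)) fun c h0 => hu.eq_zero ?_
    filter_upwards [h0, eventually_all.2 heu] with x h1 h2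
    rw [← h1]
    exact Finset.sum_congr rfl fun i _ => by rw [h2]
  have hbN := hloc isOpen_domNeg preN haN hn (iN _ hup.ne') hnu
  have hbM := hloc isOpen_domMid preM haM hm (iM _ hup.ne') hmu
  have hbP := hloc isOpen_domPos preP haP hp (iP _ hup.ne') hpu
  have hpre : IsPreconnected {z : ℂ | 0 < z.im} := (convex_halfSpace_im_gt 0).isPreconnected
  have hagree : ∀ {D D' : Set ℂ} {f f' : ℂ → ℂ}, (∀ z : ℂ, z.im ≠ 0 → z ∈ D) →
      (∀ z : ℂ, z.im ≠ 0 → z ∈ D') → (∀ z ∈ D, a.SolvesAt f z) → (∀ z ∈ D', a.SolvesAt f' z) →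
      f =ᶠ[𝓝 basePoint] f' → ∀ z : ℂ, 0 < z.im → f z = f' z := by
    intro D D' f f' h1 h2 h3 h4 h5 z hz
    exact AnalyticOnNhd.eqOn_of_preconnected_of_eventuallyEq (𝕜 := ℂ)
      (fun x hx => (h3 x (h1 x (ne_of_gt hx))).1) (fun x hx => (h4 x (h2 x (ne_of_gt hx))).1)
      hpre hup h5 hz
  obtain ⟨M₀, h₀⟩ := exists_crossing_matrix isOpen_domNeg isOpen_domMid
    (fun z hz => iN z hz.ne) (fun z hz => iM z hz.ne) hn hm hbN hbM
    fun i => hagree iN iM (hn i) (hm i) ((hnu i).trans (hmu i).symm)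
  obtain ⟨M₁, h₁⟩ := exists_crossing_matrix isOpen_domMid isOpen_domPos
    (fun z hz => iM z hz.ne) (fun z hz => iP z hz.ne) hm hp hbM hbP
    fun i => hagree iM iP (hm i) (hp i) ((hmu i).trans (hpu i).symm)
  obtain ⟨M₂, h₂⟩ := exists_crossing_matrix isOpen_domPos isOpen_domNeg
    (fun z hz => iP z hz.ne) (fun z hz => iN z hz.ne) hp hn hbP hbN
    fun i => hagree iP iN (hp i) (hn i) ((hpu i).trans (hnu i).symm)
  exact ⟨![M₀, M₁, M₂], n, m, p, h₀, h₁, h₂, hnu, hmu, hpu⟩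

theorem Crossing.lower_mulVec {D' D : Set ℂ} {f' f : Fin 4 → ℂ → ℂ}
    {M : Matrix (Fin 4) (Fin 4) ℂ} (h : a.Crossing D' D f' f M) (s : Fin 4 → ℂ) {z : ℂ}
    (hz : z.im < 0) : ∑ i, s i * f' i z = ∑ i, (M.mulVec s) i * f i z := by
  simp only [h.lower _ z hz, Matrix.mulVec, dotProduct, Finset.mul_sum, Finset.sum_mul]
  rw [Finset.sum_comm]
  exact Finset.sum_congr rfl fun i _ => Finset.sum_congr rfl fun j _ => by ring

/-- Below the axis, as rows, `n = m M 0`, `m = p M 1` and `p = n M 2`; hence `n = n (M 2 * M 1 * M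
0)`, and `n` is a basis. -/
theorem monodromy_mul_eq_one {n m p : Fin 4 → ℂ → ℂ} {M : Fin 3 → Matrix (Fin 4) (Fin 4) ℂ}
    (h₀ : a.Crossing domNeg domMid n m (M 0)) (h₁ : a.Crossing domMid domPos m p (M 1))
    (h₂ : a.Crossing domPos domNeg p n (M 2)) : M 2 * M 1 * M 0 = 1 := by
  have hz : ((-Complex.I : ℂ)).im < 0 := by simp
  have hb := h₀.basis' (-Complex.I) (mem_domNeg.2 (.inr hz.ne))
  refine Matrix.ext_of_mulVec_single fun j => ?_
  rw [Matrix.one_mulVec]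
  refine hb.coeff_unique ?_
  filter_upwards [isOpen_im_neg.eventually_mem hz] with z hz'
  have h := h₀.lower_mulVec (Pi.single j 1) hz'
  rw [h₁.lower_mulVec _ hz', h₂.lower_mulVec _ hz', Matrix.mulVec_mulVec,
    Matrix.mulVec_mulVec] at h
  exact h.symm

theorem isMonodromyTriple_of_crossings {u n m p : Fin 4 → ℂ → ℂ}
    {M : Fin 3 → Matrix (Fin 4) (Fin 4) ℂ}
    (h₀ : a.Crossing domNeg domMid n m (M 0)) (h₁ : a.Crossing domMid domPos m p (M 1))
    (h₂ : a.Crossing domPos domNeg p n (M 2)) (hn : ∀ i, n i =ᶠ[𝓝 basePoint] u i)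
    (hm : ∀ i, m i =ᶠ[𝓝 basePoint] u i) (hp : ∀ i, p i =ᶠ[𝓝 basePoint] u i) :
    a.IsMonodromyTriple u M := by
  intro j
  fin_cases j
  · exact h₀.isMonodromyMatrix (continuous_loops 0) (fun t ht => (loops_mem_first ht).1)
      (fun t ht => (loops_mem_second ht).1) (loops_half_im 0) (by rwa [loops_zero])
      (by rwa [loops_one])
  · exact h₁.isMonodromyMatrix (continuous_loops 1) (fun t ht => (loops_mem_first ht).2.1)
      (fun t ht => (loops_mem_second ht).2.1) (loops_half_im 1) (by rwa [loops_zero])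
      (by rwa [loops_one])
  · exact h₂.isMonodromyMatrix (continuous_loops 2) (fun t ht => (loops_mem_first ht).2.2)
      (fun t ht => (loops_mem_second ht).2.2) (loops_half_im 2) (by rwa [loops_zero])
      (by rwa [loops_one])

theorem IsMonodromyTriple.unique {u : Fin 4 → ℂ → ℂ} {M N : Fin 3 → Matrix (Fin 4) (Fin 4) ℂ}
    (hu : a.IsLocalBasis basePoint u) (hM : a.IsMonodromyTriple u M)
    (hN : a.IsMonodromyTriple u N) : N = M :=
  funext fun j => (hM j).unique (continuous_loops j) (by rwa [loops_one]) (hN j)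

end ODE4

/-! ### Local monodromy -/

theorem log_neg_of_im_pos {z : ℂ} (hz : 0 < z.im) :
    Complex.log (-z) = Complex.log z - Real.pi * Complex.I := by
  rw [Complex.log, Complex.log, norm_neg, Complex.arg_neg_eq_arg_sub_pi_of_im_pos hz]
  push_cast; ring

theorem log_neg_of_im_neg {z : ℂ} (hz : z.im < 0) :
    Complex.log (-z) = Complex.log z + Real.pi * Complex.I := by
  rw [Complex.log, Complex.log, norm_neg, Complex.arg_neg_eq_arg_add_pi_of_im_neg hz]
  push_cast; ring

theorem cpow_neg_of_im_pos {z : ℂ} (hz : 0 < z.im) (ρ : ℂ) :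
    (-z) ^ ρ = Complex.exp (-(Real.pi * Complex.I * ρ)) * z ^ ρ := by
  have h0 : z ≠ 0 := by rintro rfl; simp at hz
  rw [Complex.cpow_def_of_ne_zero (neg_ne_zero.2 h0), Complex.cpow_def_of_ne_zero h0,
    log_neg_of_im_pos hz, ← Complex.exp_add]
  congr 1; ring

theorem cpow_neg_of_im_neg {z : ℂ} (hz : z.im < 0) (ρ : ℂ) :
    (-z) ^ ρ = Complex.exp (Real.pi * Complex.I * ρ) * z ^ ρ := by
  have h0 : z ≠ 0 := by rintro rfl; simp at hz
  rw [Complex.cpow_def_of_ne_zero (neg_ne_zero.2 h0), Complex.cpow_def_of_ne_zero h0,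
    log_neg_of_im_neg hz, ← Complex.exp_add]
  congr 1; ring

/-- A disc about `0`, slit along the negative real axis. -/
def slitDisc (r : ℝ) : Set ℂ := Complex.slitPlane ∩ Metric.ball 0 r

theorem isOpen_slitDisc (r : ℝ) : IsOpen (slitDisc r) :=
  Complex.isOpen_slitPlane.inter Metric.isOpen_ball

theorem isPreconnected_slitDisc {r : ℝ} (hr : 0 < r) : IsPreconnected (slitDisc r) := by
  have hm : ((r / 2 : ℝ) : ℂ) ∈ Metric.ball (0 : ℂ) r := by
    simp [abs_of_pos hr]; linarith
  have h1 := (Complex.starConvex_ofReal_slitPlane (half_pos hr)).inter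
    ((convex_ball (0 : ℂ) r).starConvex hm)
  exact (h1.isPathConnected ⟨Complex.ofReal_mem_slitPlane.2 (half_pos hr), hm⟩).isConnected.isPreconnected

theorem mem_slitDisc {r : ℝ} {z : ℂ} : z ∈ slitDisc r ↔ z ∈ Complex.slitPlane ∧ ‖z‖ < r := by
  simp [slitDisc]

theorem mul_I_mem_slitDisc {r x : ℝ} (hx : x ≠ 0) (hxr : |x| < r) :
    (x : ℂ) * Complex.I ∈ slitDisc r := by
  simp [mem_slitDisc, Complex.mem_slitPlane_iff, hx, hxr]

theorem isPreconnected_preimage_slitDisc {r : ℝ} (hr : 0 < r) {f g : ℂ → ℂ}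
    (hg : ContinuousOn g Complex.slitPlane) (hfg : Function.LeftInverse f g)
    (hgf : Function.RightInverse f g) : IsPreconnected (f ⁻¹' slitDisc r) := by
  rw [← Set.image_eq_preimage_of_inverse hfg hgf]
  exact (isPreconnected_slitDisc hr).image _ (hg.mono Set.inter_subset_left)

namespace ODE4

variable {a : ODE4}

/-- As `e' = e` and `f' = f` above the axis, `e'` has the same coordinates `s` in `f'` as `e` in
`f`. Below the axis the coordinates of `e'` in `f` are `M s` by the crossing and `q s` by
assumption. -/
theorem Crossing.eigenvector {D' D S' S : Set ℂ} {f' f : Fin 4 → ℂ → ℂ}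
    {M : Matrix (Fin 4) (Fin 4) ℂ} (h : a.Crossing D' D f' f M) (hS' : IsOpen S') (hS : IsOpen S)
    (hSc' : IsPreconnected S') (hSc : IsPreconnected S) (hSD' : S' ⊆ D') (hSD : S ⊆ D)
    {z₁ z₂ : ℂ} (h1' : z₁ ∈ S') (h1 : z₁ ∈ S) (h2' : z₂ ∈ S') (h2 : z₂ ∈ S) (hi1 : 0 < z₁.im)
    (hi2 : z₂.im < 0) {e' e : ℂ → ℂ} (he' : ∀ z ∈ S', a.SolvesAt e' z)
    (he : ∀ z ∈ S, a.SolvesAt e z) (hup : ∀ z, 0 < z.im → e' z = e z) {q : ℂ}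
    (hlow : ∀ z, z.im < 0 → e' z = q * e z) (h0 : e z₁ ≠ 0) :
    ∃ s : Fin 4 → ℂ, s ≠ 0 ∧ M.mulVec s = q • s := by
  obtain ⟨s, hs1, hs2⟩ := h.exists_coeff hS' hS hSc' hSc hSD' hSD h1' h1 h2' hi1 hi2 he' he
    ((isOpen_im_pos.eventually_mem hi1).mono hup)
  refine ⟨s, ?_, (h.basis z₂ (hSD h2)).coeff_unique ?_⟩
  · rintro rfl
    exact h0 (by rw [hs1 z₁ h1]; simp)
  · filter_upwards [hs2, hS.eventually_mem h2, isOpen_im_neg.eventually_mem hi2] with z b1 b2 b3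
    rw [← b1, hlow z b3, hs1 z b2, Finset.mul_sum]
    exact Finset.sum_congr rfl fun i _ => by simp [mul_assoc]

/-- The branch `(-z)^ρ`, normalised by `e^{πiρ}`, equals the principal branch of `z^ρ` in the upper
half-plane and `e^{2πiρ}` times it in the lower one. -/
theorem Crossing.eigenvector_zero {f' f : Fin 4 → ℂ → ℂ} {M : Matrix (Fin 4) (Fin 4) ℂ}
    (h : a.Crossing domNeg domMid f' f M) {ρ : ℂ} {g : ℂ → ℂ} (hg : AnalyticAt ℂ g 0)
    (hg0 : g 0 = 1)
    (hsol : ∀ᶠ z in 𝓝 0, z ≠ 0 → ∀ φ, IsPowerGerm 0 ρ φ z → a.SolvesAt (fun x => φ x * g x) z) :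
    ∃ s : Fin 4 → ℂ, s ≠ 0 ∧ M.mulVec s = Complex.exp (2 * Real.pi * Complex.I * ρ) • s := by
  have hne : ∀ᶠ z in 𝓝 (0 : ℂ), g z ≠ 0 :=
    hg.continuousAt.eventually_ne (by rw [hg0]; exact one_ne_zero)
  obtain ⟨r', hr', hb⟩ := Metric.eventually_nhds_iff_ball.1 (hsol.and hne)
  -- The radius is at most `1` so that the slit disc stays clear of the cut `[1, ∞)` of `domMid`.
  obtain ⟨r, hr, hrr, hr1⟩ : ∃ r, 0 < r ∧ r ≤ r' ∧ r ≤ 1 :=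
    ⟨min r' 1, lt_min hr' one_pos, min_le_left _ _, min_le_right _ _⟩
  have hb' : ∀ z, ‖z‖ < r → (z ≠ 0 → ∀ φ, IsPowerGerm 0 ρ φ z →
      a.SolvesAt (fun x => φ x * g x) z) ∧ g z ≠ 0 := fun z hz =>
    hb z (by simpa using hz.trans_le hrr)
  have hx1 : ((r / 2 : ℝ) : ℂ) * Complex.I ∈ slitDisc r :=
    mul_I_mem_slitDisc (half_pos hr).ne' (by rw [abs_of_pos (half_pos hr)]; linarith)
  have hx2 : ((-(r / 2) : ℝ) : ℂ) * Complex.I ∈ slitDisc r :=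
    mul_I_mem_slitDisc (neg_ne_zero.2 (half_pos hr).ne')
      (by rw [abs_neg, abs_of_pos (half_pos hr)]; linarith)
  have hneg : -(((r / 2 : ℝ) : ℂ) * Complex.I) = ((-(r / 2) : ℝ) : ℂ) * Complex.I := by
    push_cast; ring
  have hneg' : -(((-(r / 2) : ℝ) : ℂ) * Complex.I) = ((r / 2 : ℝ) : ℂ) * Complex.I := by
    push_cast; ring
  refine h.eigenvector (S' := (fun z => -z) ⁻¹' slitDisc r) (S := slitDisc r)
    (z₁ := ((r / 2 : ℝ) : ℂ) * Complex.I) (z₂ := ((-(r / 2) : ℝ) : ℂ) * Complex.I)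
    (e' := fun z => Complex.exp (Real.pi * Complex.I * ρ) * (-z) ^ ρ * g z)
    (e := fun z => z ^ ρ * g z)
    ((isOpen_slitDisc r).preimage (by fun_prop)) (isOpen_slitDisc r)
    (isPreconnected_preimage_slitDisc hr (g := fun z => -z) (by fun_prop) neg_neg neg_neg)
    (isPreconnected_slitDisc hr) (fun z hz => hz.1) ?_ ?_ hx1 ?_ hx2 ?_ ?_ ?_ ?_ ?_ ?_ ?_
  · intro z hz
    obtain ⟨hz1, hz2⟩ := mem_slitDisc.1 hz
    refine ⟨hz1, ?_⟩
    rw [Complex.mem_slitPlane_iff]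
    left
    have := (Complex.abs_re_le_norm z).trans_lt hz2
    have := (abs_lt.1 this).2
    simp; linarith
  · change -(_ : ℂ) ∈ slitDisc r
    rw [hneg]; exact hx2
  · change -(_ : ℂ) ∈ slitDisc r
    rw [hneg']; exact hx1
  · simpa using hr
  · simpa using hr
  · intro z hz
    obtain ⟨hz1, hz2⟩ := mem_slitDisc.1 hz
    have hz0 : z ≠ 0 := neg_ne_zero.1 (Complex.slitPlane_ne_zero hz1)
    have := IsPowerGerm.cpow_neg (z₀ := 0) (z := z) ρ (by simpa using hz1)
    simp only [zero_sub] at this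
    exact (hb' z (by simpa using hz2)).1 hz0 _ (this.const_mul _)
  · intro z hz
    obtain ⟨hz1, hz2⟩ := mem_slitDisc.1 hz
    have := IsPowerGerm.cpow (z₀ := 0) (z := z) ρ (by simpa using hz1)
    simp only [sub_zero] at this
    exact (hb' z hz2).1 (Complex.slitPlane_ne_zero hz1) _ this
  · intro z hz
    rw [cpow_neg_of_im_pos hz, ← mul_assoc, ← Complex.exp_add]
    simp
  · intro z hz
    rw [cpow_neg_of_im_neg hz, ← mul_assoc, ← Complex.exp_add, mul_assoc]
    congr 2; ring
  · refine mul_ne_zero ?_ (hb' _ (mem_slitDisc.1 hx1).2).2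
    rw [Complex.cpow_def_of_ne_zero (Complex.slitPlane_ne_zero hx1.1)]
    exact Complex.exp_ne_zero _

/-- A solution in the coordinate `t = 1/z` is a solution in the coordinate `z`. -/
theorem SolvesAt.comp_inv {φ : ℂ → ℂ} {z : ℂ} (hz : z ≠ 0)
    (h : a.atInfinity.SolvesAt φ z⁻¹) : a.SolvesAt (fun x => φ x⁻¹) z := by
  obtain ⟨hφ, heq⟩ := h
  have hinv : ∀ x : ℂ, x ≠ 0 → HasDerivAt (fun y : ℂ => y⁻¹) (-(x⁻¹) ^ 2) x := by
    intro x hx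
    refine (hasDerivAt_inv hx).congr_deriv ?_
    rw [inv_pow]
  have hcont : ContinuousAt (fun y : ℂ => y⁻¹) z := continuousAt_inv₀ hz
  have hev : ∀ᶠ x in 𝓝 z, AnalyticAt ℂ φ x⁻¹ ∧ x ≠ 0 :=
    (hcont.eventually hφ.eventually_analyticAt).and (isOpen_ne.eventually_mem hz)
  have hD : ∀ x, AnalyticAt ℂ φ x⁻¹ → x ≠ 0 → ∀ k, HasDerivAt (fun s => iteratedDeriv k φ s⁻¹)
      (iteratedDeriv (k + 1) φ x⁻¹ * -(x⁻¹) ^ 2) x := fun x hx hx0 k =>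
    hasDerivAt_iteratedDeriv_comp hx (hinv x hx0) k
  have e1 : iteratedDeriv 1 (fun x => φ x⁻¹) =ᶠ[𝓝 z] fun x => -((x⁻¹) ^ 2 * iteratedDeriv 1 φ x⁻¹) := by
    filter_upwards [hev] with x hx
    rw [iteratedDeriv_one]
    have := hD x hx.1 hx.2 0
    simp only [iteratedDeriv_zero] at this
    rw [this.deriv]; ring
  have e2 : iteratedDeriv 2 (fun x => φ x⁻¹) =ᶠ[𝓝 z] fun x =>
      (x⁻¹) ^ 4 * iteratedDeriv 2 φ x⁻¹ + 2 * (x⁻¹) ^ 3 * iteratedDeriv 1 φ x⁻¹ := by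
    filter_upwards [e1.eventuallyEq_nhds, hev] with x hx hx'
    rw [iteratedDeriv_succ, hx.deriv_eq]
    refine ((((hinv x hx'.2).pow 2).mul (hD x hx'.1 hx'.2 1)).neg).deriv.trans ?_
    simp only [Pi.pow_apply]; push_cast; ring
  have e3 : iteratedDeriv 3 (fun x => φ x⁻¹) =ᶠ[𝓝 z] fun x =>
      -((x⁻¹) ^ 6 * iteratedDeriv 3 φ x⁻¹ + 6 * (x⁻¹) ^ 5 * iteratedDeriv 2 φ x⁻¹
        + 6 * (x⁻¹) ^ 4 * iteratedDeriv 1 φ x⁻¹) := by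
    filter_upwards [e2.eventuallyEq_nhds, hev] with x hx hx'
    rw [iteratedDeriv_succ, hx.deriv_eq]
    refine ((((hinv x hx'.2).pow 4).mul (hD x hx'.1 hx'.2 2)).add
      ((((hinv x hx'.2).pow 3).const_mul 2).mul (hD x hx'.1 hx'.2 1))).deriv.trans ?_
    simp only [Pi.pow_apply]; push_cast; ring
  have e4 : iteratedDeriv 4 (fun x => φ x⁻¹) z =
      (z⁻¹) ^ 8 * iteratedDeriv 4 φ z⁻¹ + 12 * (z⁻¹) ^ 7 * iteratedDeriv 3 φ z⁻¹
        + 36 * (z⁻¹) ^ 6 * iteratedDeriv 2 φ z⁻¹ + 24 * (z⁻¹) ^ 5 * iteratedDeriv 1 φ z⁻¹ := by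
    have hx' := hev.self_of_nhds
    rw [iteratedDeriv_succ, e3.deriv_eq]
    refine (((((hinv z hx'.2).pow 6).mul (hD z hx'.1 hx'.2 3)).add
      ((((hinv z hx'.2).pow 5).const_mul 6).mul (hD z hx'.1 hx'.2 2))).add
      ((((hinv z hx'.2).pow 4).const_mul 6).mul (hD z hx'.1 hx'.2 1))).neg.deriv.trans ?_
    simp only [Pi.pow_apply]; push_cast; ring
  refine ⟨?_, ?_⟩
  · refine DifferentiableOn.analyticAt (s := {x | AnalyticAt ℂ φ x⁻¹ ∧ x ≠ 0})
      (fun x hx => ?_) hev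
    have := hD x hx.1 hx.2 0
    simp only [iteratedDeriv_zero] at this
    exact this.differentiableAt.differentiableWithinAt
  · have e1' := e1.eq_of_nhds
    have e2' := e2.eq_of_nhds
    have e3' := e3.eq_of_nhds
    rw [iteratedDeriv_one] at e2' e3'
    have ht : z⁻¹ ≠ 0 := inv_ne_zero hz
    rw [e4, iteratedDeriv_one, Fin.sum_univ_four]
    simp only [Fin.sum_univ_four] at heq
    simp [atInfinity] at heq e1' ⊢
    rw [e1', e2', e3']
    -- The leading term of the transformed function is `t^8 φ⁗` with `t = z⁻¹`, so the equation at
    -- infinity has to be multiplied by `t^8`.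
    have := congrArg (z⁻¹ ^ 8 * ·) heq
    simp only [mul_zero] at this
    rw [← this]
    field_simp
    ring

/-- The argument of `eigenvector_zero` in the coordinate `t = 1/z`. Inversion exchanges the
half-planes, so the normalisation is now by `e^{-πiσ}` and falls on the branch of `domNeg`; this
keeps the eigenvalue `e^{2πiσ}`. -/
theorem Crossing.eigenvector_infinity {f' f : Fin 4 → ℂ → ℂ} {M : Matrix (Fin 4) (Fin 4) ℂ}
    (h : a.Crossing domPos domNeg f' f M) {σ : ℂ} {g : ℂ → ℂ} (hg : AnalyticAt ℂ g 0)
    (hg0 : g 0 = 1)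
    (hsol : ∀ᶠ z in 𝓝 0, z ≠ 0 → ∀ φ, IsPowerGerm 0 σ φ z →
      a.atInfinity.SolvesAt (fun x => φ x * g x) z) :
    ∃ s : Fin 4 → ℂ, s ≠ 0 ∧ M.mulVec s = Complex.exp (2 * Real.pi * Complex.I * σ) • s := by
  have hne : ∀ᶠ z in 𝓝 (0 : ℂ), g z ≠ 0 :=
    hg.continuousAt.eventually_ne (by rw [hg0]; exact one_ne_zero)
  obtain ⟨r', hr', hb⟩ := Metric.eventually_nhds_iff_ball.1 (hsol.and hne)
  obtain ⟨r, hr, hrr, hr1⟩ : ∃ r, 0 < r ∧ r ≤ r' ∧ r ≤ 1 :=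
    ⟨min r' 1, lt_min hr' one_pos, min_le_left _ _, min_le_right _ _⟩
  have hb' : ∀ z, ‖z‖ < r → (z ≠ 0 → ∀ φ, IsPowerGerm 0 σ φ z →
      a.atInfinity.SolvesAt (fun x => φ x * g x) z) ∧ g z ≠ 0 := fun z hz =>
    hb z (by simpa using hz.trans_le hrr)
  have hx1 : ((r / 2 : ℝ) : ℂ) * Complex.I ∈ slitDisc r :=
    mul_I_mem_slitDisc (half_pos hr).ne' (by rw [abs_of_pos (half_pos hr)]; linarith)
  have hx2 : ((-(r / 2) : ℝ) : ℂ) * Complex.I ∈ slitDisc r :=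
    mul_I_mem_slitDisc (neg_ne_zero.2 (half_pos hr).ne')
      (by rw [abs_neg, abs_of_pos (half_pos hr)]; linarith)
  have hneg : -(((r / 2 : ℝ) : ℂ) * Complex.I) = ((-(r / 2) : ℝ) : ℂ) * Complex.I := by
    push_cast; ring
  have hneg' : -(((-(r / 2) : ℝ) : ℂ) * Complex.I) = ((r / 2 : ℝ) : ℂ) * Complex.I := by
    push_cast; ring
  have hslit : ∀ w : ℂ, w⁻¹ ∈ Complex.slitPlane ↔ w ∈ Complex.slitPlane := by
    intro w
    rw [Complex.mem_slitPlane_iff_arg, Complex.mem_slitPlane_iff_arg, Complex.arg_inv]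
    by_cases hw : w.arg = Real.pi
    · simp [hw]
    · have : -w.arg ≠ Real.pi := fun h => by
        have := Complex.neg_pi_lt_arg w; linarith
      simp [hw, this]
  have him : ∀ z : ℂ, (0 < z.im → z⁻¹.im < 0) ∧ (z.im < 0 → 0 < z⁻¹.im) := by
    intro z
    have hpos : z.im ≠ 0 → 0 < Complex.normSq z := fun hz =>
      Complex.normSq_pos.2 (by rintro rfl; simp at hz)
    rw [Complex.inv_im]
    exact ⟨fun hz => div_neg_of_neg_of_pos (neg_lt_zero.2 hz) (hpos hz.ne'),
      fun hz => div_pos (neg_pos.2 hz) (hpos hz.ne)⟩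
  have hinvS' : ∀ z, z ∈ (fun z : ℂ => z⁻¹) ⁻¹' slitDisc r → z ∈ Complex.slitPlane ∧ ‖z⁻¹‖ < r ∧ z ≠ 0 := by
    intro z hz
    obtain ⟨hz1, hz2⟩ := mem_slitDisc.1 hz
    exact ⟨(hslit z).1 hz1, hz2, fun h => Complex.slitPlane_ne_zero hz1 (by simp [h])⟩
  have hinvS : ∀ z, z ∈ (fun z : ℂ => -z⁻¹) ⁻¹' slitDisc r →
      -z ∈ Complex.slitPlane ∧ ‖z⁻¹‖ < r ∧ z ≠ 0 := by
    intro z hz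
    obtain ⟨hz1, hz2⟩ := mem_slitDisc.1 hz
    have hz1' : -z⁻¹ ∈ Complex.slitPlane := hz1
    rw [← inv_neg] at hz1'
    exact ⟨(hslit (-z)).1 hz1', by simpa using hz2,
      fun h => Complex.slitPlane_ne_zero hz1' (by simp [h])⟩
  have hinvcont : ContinuousOn (fun z : ℂ => z⁻¹) Complex.slitPlane :=
    continuousOn_inv₀.mono fun z hz => Complex.slitPlane_ne_zero hz
  have hopenS' : IsOpen ((fun z : ℂ => z⁻¹) ⁻¹' slitDisc r) := by
    have h1 : ContinuousOn (fun z : ℂ => z⁻¹) {0}ᶜ := continuousOn_inv₀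
    have h2 := h1.isOpen_inter_preimage isOpen_compl_singleton (isOpen_slitDisc r)
    rwa [Set.inter_eq_right.2 (show (fun z : ℂ => z⁻¹) ⁻¹' slitDisc r ⊆ {0}ᶜ from
      fun z hz => (hinvS' z hz).2.2)] at h2
  have hopenS : IsOpen ((fun z : ℂ => -z⁻¹) ⁻¹' slitDisc r) := by
    have h1 : ContinuousOn (fun z : ℂ => -z⁻¹) {0}ᶜ := continuousOn_inv₀.neg
    have h2 := h1.isOpen_inter_preimage isOpen_compl_singleton (isOpen_slitDisc r)
    rwa [Set.inter_eq_right.2 (show (fun z : ℂ => -z⁻¹) ⁻¹' slitDisc r ⊆ {0}ᶜ from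
      fun z hz => (hinvS z hz).2.2)] at h2
  refine h.eigenvector (S' := (fun z : ℂ => z⁻¹) ⁻¹' slitDisc r)
    (S := (fun z : ℂ => -z⁻¹) ⁻¹' slitDisc r)
    (z₁ := (((-(r / 2) : ℝ) : ℂ) * Complex.I)⁻¹) (z₂ := (((r / 2 : ℝ) : ℂ) * Complex.I)⁻¹)
    (e' := fun z => (z⁻¹) ^ σ * g z⁻¹)
    (e := fun z => Complex.exp (-(Real.pi * Complex.I * σ)) * (-z⁻¹) ^ σ * g z⁻¹)
    hopenS' hopenS
    (isPreconnected_preimage_slitDisc hr (g := fun z => z⁻¹) hinvcont inv_inv inv_inv)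
    (isPreconnected_preimage_slitDisc hr (g := fun z => -z⁻¹) hinvcont.neg
      (fun z => by simp [inv_neg]) (fun z => by simp [inv_neg])) ?_ ?_ ?_ ?_ ?_ ?_ ?_ ?_ ?_ ?_ ?_ ?_ ?_
  · intro z hz
    obtain ⟨hz1, hz2, hz0⟩ := hinvS' z hz
    rw [mem_domPos]
    by_cases hi : z.im = 0
    · left
      have hre : 0 < z.re := (Complex.mem_slitPlane_iff.1 hz1).resolve_right (not_not.2 hi)
      have hz' : z = (z.re : ℂ) := Complex.ext rfl (by simpa using hi)
      rw [hz', ← Complex.ofReal_inv, Complex.norm_real, Real.norm_of_nonneg (inv_nonneg.2 hre.le)]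
        at hz2
      exact (inv_lt_one₀ hre).1 (hz2.trans_le hr1)
    · exact .inr hi
  · intro z hz
    exact (hinvS z hz).1
  · change (_ : ℂ)⁻¹⁻¹ ∈ slitDisc r
    rw [inv_inv]; exact hx2
  · change -(_ : ℂ)⁻¹⁻¹ ∈ slitDisc r
    rw [inv_inv, hneg']; exact hx1
  · change (_ : ℂ)⁻¹⁻¹ ∈ slitDisc r
    rw [inv_inv]; exact hx1
  · change -(_ : ℂ)⁻¹⁻¹ ∈ slitDisc r
    rw [inv_inv, hneg]; exact hx2
  · exact (him _).2 (by simpa using hr)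
  · exact (him _).1 (by simpa using hr)
  · intro z hz
    obtain ⟨hz1, hz2, hz0⟩ := hinvS' z hz
    have := IsPowerGerm.cpow (z₀ := 0) (z := z⁻¹) σ (by simpa using hz.1)
    simp only [sub_zero] at this
    exact SolvesAt.comp_inv (φ := fun x => x ^ σ * g x) hz0
      ((hb' z⁻¹ hz2).1 (inv_ne_zero hz0) _ this)
  · intro z hz
    obtain ⟨hz1, hz2, hz0⟩ := hinvS z hz
    have := IsPowerGerm.cpow_neg (z₀ := 0) (z := z⁻¹) σ (by simpa using hz.1)
    simp only [zero_sub] at this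
    exact SolvesAt.comp_inv (φ := fun x => Complex.exp (-(Real.pi * Complex.I * σ)) * (-x) ^ σ * g x)
      hz0 ((hb' z⁻¹ hz2).1 (inv_ne_zero hz0) _ (this.const_mul _))
  · intro z hz
    rw [cpow_neg_of_im_neg ((him z).1 hz), ← mul_assoc, ← Complex.exp_add]
    simp
  · intro z hz
    rw [cpow_neg_of_im_pos ((him z).2 hz)]
    have h1 : Complex.exp (2 * Real.pi * Complex.I * σ) *
        (Complex.exp (-(Real.pi * Complex.I * σ)) * Complex.exp (-(Real.pi * Complex.I * σ))) = 1 := by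
      rw [← Complex.exp_add, ← Complex.exp_add, Complex.exp_eq_one_iff]
      exact ⟨0, by push_cast; ring⟩
    linear_combination (-(z⁻¹ ^ σ * g z⁻¹)) * h1
  · refine mul_ne_zero (mul_ne_zero (Complex.exp_ne_zero _) ?_) ?_
    · rw [inv_inv, hneg', Complex.cpow_def_of_ne_zero (Complex.slitPlane_ne_zero hx1.1)]
      exact Complex.exp_ne_zero _
    · rw [inv_inv]
      exact (hb' _ (mem_slitDisc.1 hx2).2).2

end ODE4

/-! ### Branches of the logarithm and limits at the centre of a slit disc -/

theorem isLogGerm_log_sub {z₀ z : ℂ} (hz : z - z₀ ∈ Complex.slitPlane) :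
    IsLogGerm z₀ (fun x => Complex.log (x - z₀)) z := by
  refine ⟨AnalyticAt.clog (by fun_prop) hz, ?_⟩
  have hopen : IsOpen {x : ℂ | x - z₀ ∈ Complex.slitPlane} :=
    Complex.isOpen_slitPlane.preimage (by fun_prop)
  filter_upwards [hopen.eventually_mem hz] with x hx
  have := ((hasDerivAt_id x).sub_const z₀).clog hx
  exact this.deriv

theorem isLogGerm_log_sub_left {z₀ z : ℂ} (c : ℂ) (hz : z₀ - z ∈ Complex.slitPlane) :
    IsLogGerm z₀ (fun x => Complex.log (z₀ - x) + c) z := by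
  refine ⟨(AnalyticAt.clog (by fun_prop) hz).add analyticAt_const, ?_⟩
  have hopen : IsOpen {x : ℂ | z₀ - x ∈ Complex.slitPlane} :=
    Complex.isOpen_slitPlane.preimage (by fun_prop)
  filter_upwards [hopen.eventually_mem hz] with x hx
  have := (((hasDerivAt_id x).const_sub z₀).clog hx).add_const c
  refine this.deriv.trans ?_
  rw [id, neg_div, ← div_neg, neg_sub]

theorem slitDisc_tendsto {z₀ : ℂ} {r : ℝ} (hr : 0 < r) :
    ∀ᶠ x : ℝ in 𝓝[>] 0, z₀ + x - z₀ ∈ slitDisc r := by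
  filter_upwards [self_mem_nhdsWithin, nhdsWithin_le_nhds (eventually_lt_nhds hr)] with x hx hxr
  rw [add_sub_cancel_left, mem_slitDisc, Complex.norm_real, Real.norm_of_nonneg (le_of_lt hx)]
  exact ⟨Complex.ofReal_mem_slitPlane.2 hx, hxr⟩

theorem tendsto_add_ofReal (z₀ : ℂ) :
    Tendsto (fun x : ℝ => z₀ + (x : ℂ)) (𝓝[>] 0) (𝓝 z₀) := by
  have : ContinuousAt (fun x : ℝ => z₀ + (x : ℂ)) 0 := by fun_prop
  have h := this.tendsto
  simp only [Complex.ofReal_zero, add_zero] at h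
  exact h.mono_left nhdsWithin_le_nhds

theorem eq_zero_of_eqOn_slitDisc {z₀ : ℂ} {r : ℝ} (hr : 0 < r) {k : ℂ → ℂ}
    (hk : ContinuousAt k z₀) (h : ∀ z, z - z₀ ∈ slitDisc r → k z = 0) : k z₀ = 0 := by
  refine tendsto_nhds_unique (hk.tendsto.comp (tendsto_add_ofReal z₀))
    (tendsto_const_nhds.congr' ?_)
  filter_upwards [slitDisc_tendsto (z₀ := z₀) hr] with x hx
  exact (h _ hx).symm

/-- Along the positive direction `x log x → 0`, so a logarithm multiplied by a function vanishing at
`z₀` does not contribute to the limit. -/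
theorem eq_zero_of_add_log_eqOn_slitDisc {z₀ : ℂ} {r : ℝ} (hr : 0 < r) {k w : ℂ → ℂ}
    (hk : ContinuousAt k z₀) (hw : ContinuousAt w z₀)
    (h : ∀ z, z - z₀ ∈ slitDisc r → k z + Complex.log (z - z₀) * ((z - z₀) * w z) = 0) :
    k z₀ = 0 := by
  have hlog : Tendsto (fun x : ℝ => Complex.log (x : ℂ) * (x : ℂ)) (𝓝[>] 0) (𝓝 0) := by
    have h1 := tendsto_log_mul_rpow_nhdsGT_zero one_pos
    have h2 := (Complex.continuous_ofReal.tendsto 0).comp h1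
    rw [Complex.ofReal_zero] at h2
    refine h2.congr' ?_
    filter_upwards [self_mem_nhdsWithin] with x hx
    simp [Complex.ofReal_log (le_of_lt hx)]
  have h1 := (hk.tendsto.comp (tendsto_add_ofReal z₀)).add
    (hlog.mul (hw.tendsto.comp (tendsto_add_ofReal z₀)))
  rw [zero_mul, add_zero] at h1
  refine tendsto_nhds_unique h1 (tendsto_const_nhds.congr' ?_)
  filter_upwards [slitDisc_tendsto (z₀ := z₀) hr] with x hx
  rw [← h _ hx]
  simp [mul_assoc]

/-! ### The Jordan block at a logarithmic point -/

namespace ODE4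

variable {a : ODE4}

theorem isConj_jordan112_of_mulVec {M : Matrix (Fin 4) (Fin 4) ℂ} {c : Fin 4 → Fin 4 → ℂ}
    (hc : LinearIndependent ℂ c) (h0 : M.mulVec (c 0) = c 0) (h1 : M.mulVec (c 1) = c 1)
    (h2 : M.mulVec (c 2) = c 2) (h3 : M.mulVec (c 3) = c 2 + c 3) : IsConj M jordan112 := by
  set P : Matrix (Fin 4) (Fin 4) ℂ := (Matrix.of c).transpose with hP
  have hu : IsUnit P := by
    rw [← Matrix.linearIndependent_cols_iff_isUnit]
    exact hc
  obtain ⟨U, hU⟩ := hu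
  refine IsConj.symm ⟨U, ?_⟩
  rw [hU]
  change P * jordan112 = M * P
  ext i j
  have hMP : ∀ j, (M * P) i j = (M.mulVec (c j)) i := fun j => rfl
  rw [hMP, Matrix.mul_apply, Fin.sum_univ_four]
  fin_cases j <;> simp [jordan112, h0, h1, h2, h3, hP]

/-- Single-valued solutions are fixed vectors, and going around `1` adds `2πi w` to the logarithmic
one. The Jordan chain is thus `q, s₄`, with `q` the coordinates of `2πi w`. Since `R 1 ≠ 0`, `w`
vanishes to first order exactly and `q` can replace the fixed vector `s 1`. -/
theorem Crossing.isConj_jordan {f' f : Fin 4 → ℂ → ℂ} {M : Matrix (Fin 4) (Fin 4) ℂ}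
    (h : a.Crossing domMid domPos f' f M) {u : ℕ → ℂ → ℂ} {v : ℂ → ℂ} {R : ℕ → ℂ}
    (hu : ∀ m, AnalyticAt ℂ (u m) 1 ∧ u m 1 = 1) (hv : AnalyticAt ℂ v 1) (hv1 : v 1 = 1)
    (hR : R 1 ≠ 0)
    (hsol : ∀ m, 1 ≤ m → m ≤ 3 → ∀ᶠ z in 𝓝 1, z ≠ 1 →
      a.SolvesAt (fun x => (x - 1) ^ m * u m x) z)
    (hlog : ∀ᶠ z in 𝓝 1, z ≠ 1 → ∀ ℓ, IsLogGerm 1 ℓ z →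
      a.SolvesAt (fun x => v x + ℓ x * (R 1 * ((x - 1) ^ 1 * u 1 x)
          + R 2 * ((x - 1) ^ 2 * u 2 x) + R 3 * ((x - 1) ^ 3 * u 3 x))) z) :
    IsConj M jordan112 := by
  obtain ⟨r', hr', hb⟩ := Metric.eventually_nhds_iff_ball.1
    ((hsol 1 le_rfl (by norm_num)).and ((hsol 2 (by norm_num) (by norm_num)).and
      ((hsol 3 (by norm_num) le_rfl).and hlog)))
  obtain ⟨r, hr, hrr, hr1⟩ : ∃ r, 0 < r ∧ r ≤ r' ∧ r ≤ 1 :=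
    ⟨min r' 1, lt_min hr' one_pos, min_le_left _ _, min_le_right _ _⟩
  have hsol' : ∀ m, 1 ≤ m → m ≤ 3 → ∀ z : ℂ, ‖z - 1‖ < r → z ≠ 1 →
      a.SolvesAt (fun x => (x - 1) ^ m * u m x) z := by
    intro m h1 h3 z hz hz1
    obtain ⟨b1, b2, b3, -⟩ := hb z (by rw [mem_ball_iff_norm]; exact hz.trans_le hrr)
    interval_cases m
    exacts [b1 hz1, b2 hz1, b3 hz1]
  have hlog' := fun (z : ℂ) (hz : ‖z - 1‖ < r) =>
    (hb z (by rw [mem_ball_iff_norm]; exact hz.trans_le hrr)).2.2.2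
  have hS : IsOpen {z : ℂ | z - 1 ∈ slitDisc r} := (isOpen_slitDisc r).preimage (by fun_prop)
  have hS' : IsOpen {z : ℂ | 1 - z ∈ slitDisc r} := (isOpen_slitDisc r).preimage (by fun_prop)
  have hSc : IsPreconnected {z : ℂ | z - 1 ∈ slitDisc r} :=
    isPreconnected_preimage_slitDisc hr (f := fun z => z - 1) (g := fun z => z + 1) (by fun_prop)
      (fun z => by simp) (fun z => by simp)
  have hSc' : IsPreconnected {z : ℂ | 1 - z ∈ slitDisc r} :=
    isPreconnected_preimage_slitDisc hr (f := fun z => 1 - z) (g := fun z => 1 - z) (by fun_prop)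
      (fun z => by simp) (fun z => by simp)
  have hSD : {z : ℂ | z - 1 ∈ slitDisc r} ⊆ domPos := fun z hz => hz.1
  have hSD' : {z : ℂ | 1 - z ∈ slitDisc r} ⊆ domMid := by
    intro z hz
    obtain ⟨hz1, hz2⟩ := mem_slitDisc.1 hz
    refine ⟨?_, hz1⟩
    rw [Complex.mem_slitPlane_iff]
    left
    have := (abs_lt.1 ((Complex.abs_re_le_norm _).trans_lt hz2)).2
    simp at this; linarith
  have hne : ∀ z : ℂ, z - 1 ∈ slitDisc r → z ≠ 1 ∧ ‖z - 1‖ < r ∧ z - 1 ∈ Complex.slitPlane :=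
    fun z hz => ⟨sub_ne_zero.1 (Complex.slitPlane_ne_zero hz.1), (mem_slitDisc.1 hz).2, hz.1⟩
  have hne' : ∀ z : ℂ, 1 - z ∈ slitDisc r → z ≠ 1 ∧ ‖z - 1‖ < r ∧ 1 - z ∈ Complex.slitPlane :=
    fun z hz => ⟨(sub_ne_zero.1 (Complex.slitPlane_ne_zero hz.1)).symm,
      by rw [norm_sub_rev]; exact (mem_slitDisc.1 hz).2, hz.1⟩
  have hx1 : ((r / 2 : ℝ) : ℂ) * Complex.I ∈ slitDisc r :=
    mul_I_mem_slitDisc (half_pos hr).ne' (by rw [abs_of_pos (half_pos hr)]; linarith)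
  have hx2 : ((-(r / 2) : ℝ) : ℂ) * Complex.I ∈ slitDisc r :=
    mul_I_mem_slitDisc (neg_ne_zero.2 (half_pos hr).ne')
      (by rw [abs_neg, abs_of_pos (half_pos hr)]; linarith)
  obtain ⟨z₁, h1, h1', hi1⟩ : ∃ z : ℂ, z - 1 ∈ slitDisc r ∧ 1 - z ∈ slitDisc r ∧ 0 < z.im := by
    refine ⟨1 + ((r / 2 : ℝ) : ℂ) * Complex.I, ?_, ?_, by simpa using hr⟩
    · rwa [add_sub_cancel_left]
    · convert hx2 using 1; push_cast; ring
  obtain ⟨z₂, h2, h2', hi2⟩ : ∃ z : ℂ, z - 1 ∈ slitDisc r ∧ 1 - z ∈ slitDisc r ∧ z.im < 0 := by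
    refine ⟨1 + ((-(r / 2) : ℝ) : ℂ) * Complex.I, ?_, ?_, by simpa using hr⟩
    · rwa [add_sub_cancel_left]
    · convert hx1 using 1; push_cast; ring
  have hs : ∀ m : ℕ, ∃ s : Fin 4 → ℂ, 1 ≤ m → m ≤ 3 → M.mulVec s = s ∧
      ∀ z, z - 1 ∈ slitDisc r → (z - 1) ^ m * u m z = ∑ i, s i * f i z := by
    intro m
    by_cases hm : 1 ≤ m ∧ m ≤ 3
    swap
    · exact ⟨0, fun a b => absurd ⟨a, b⟩ hm⟩
    obtain ⟨s, hs1, hs2⟩ := h.exists_coeff hS' hS hSc' hSc hSD' hSD h1' h1 h2' hi1 hi2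
      (fun z hz => hsol' m hm.1 hm.2 z (hne' z hz).2.1 (hne' z hz).1)
      (fun z hz => hsol' m hm.1 hm.2 z (hne z hz).2.1 (hne z hz).1) EventuallyEq.rfl
    refine ⟨s, fun _ _ => ⟨(h.basis z₂ (hSD h2)).coeff_unique ?_, hs1⟩⟩
    filter_upwards [hs2, hS.eventually_mem h2] with z b1 b2
    rw [← b1, hs1 z b2]
  choose s hs using hs
  set w : ℂ → ℂ := fun x => R 1 * ((x - 1) ^ 1 * u 1 x)
          + R 2 * ((x - 1) ^ 2 * u 2 x) + R 3 * ((x - 1) ^ 3 * u 3 x) with hw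
  set q : Fin 4 → ℂ := (2 * Real.pi * Complex.I) • (R 1 • s 1 + R 2 • s 2 + R 3 • s 3) with hq
  have hqz : ∀ z, z - 1 ∈ slitDisc r → 2 * Real.pi * Complex.I * w z = ∑ i, q i * f i z := by
    intro z hz
    have a1 := (hs 1 le_rfl (by norm_num)).2 z hz
    have a2 := (hs 2 (by norm_num) (by norm_num)).2 z hz
    have a3 := (hs 3 (by norm_num) le_rfl).2 z hz
    simp only [hw]
    rw [a1, a2, a3]
    simp only [hq, Pi.smul_apply, Pi.add_apply, smul_eq_mul, Finset.mul_sum,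
      ← Finset.sum_add_distrib]
    exact Finset.sum_congr rfl fun i _ => by ring
  have hMq : M.mulVec q = q := by
    simp only [hq, Matrix.mulVec_smul, Matrix.mulVec_add, (hs 1 le_rfl (by norm_num)).1,
      (hs 2 (by norm_num) (by norm_num)).1, (hs 3 (by norm_num) le_rfl).1]
  -- The branch `log (1 - x) + πi` agrees with `log (x - 1)` above the real axis and exceeds it by
  -- `2πi` below.
  obtain ⟨s₄, hs4, hs4'⟩ := h.exists_coeff hS' hS hSc' hSc hSD' hSD h1' h1 h2' hi1 hi2
    (e' := fun x => v x + (Complex.log (1 - x) + Real.pi * Complex.I) * w x)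
    (e := fun x => v x + Complex.log (x - 1) * w x)
    (fun z hz => hlog' z (hne' z hz).2.1 (hne' z hz).1 _
      (isLogGerm_log_sub_left _ (hne' z hz).2.2))
    (fun z hz => hlog' z (hne z hz).2.1 (hne z hz).1 _ (isLogGerm_log_sub (hne z hz).2.2))
    (by
      filter_upwards [isOpen_im_pos.eventually_mem hi1] with z hz
      have : 0 < (z - 1).im := by simpa using hz
      have := log_neg_of_im_pos this
      rw [neg_sub] at this
      rw [this]; ring)
  have hM4 : M.mulVec s₄ = q + s₄ := by
    refine (h.basis z₂ (hSD h2)).coeff_unique ?_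
    filter_upwards [hs4', hS.eventually_mem h2, isOpen_im_neg.eventually_mem hi2] with z b1 b2 b3
    have : (z - 1).im < 0 := by simpa using b3
    have := log_neg_of_im_neg this
    rw [neg_sub] at this
    rw [← b1, this]
    have e1 := hs4 z b2
    have e2 := hqz z b2
    simp only [Pi.add_apply, add_mul, Finset.sum_add_distrib]
    rw [← e1, ← e2]; ring
  refine isConj_jordan112_of_mulVec (c := ![s 2, s 3, q, s₄]) ?_
    (hs 2 (by norm_num) (by norm_num)).1 (hs 3 (by norm_num) le_rfl).1 hMq hM4
  rw [Fintype.linearIndependent_iff]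
  intro g hg
  have hrel : ∀ z, z - 1 ∈ slitDisc r → g 0 * ((z - 1) ^ 2 * u 2 z) + g 1 * ((z - 1) ^ 3 * u 3 z)
      + g 2 * (2 * Real.pi * Complex.I * w z) + g 3 * (v z + Complex.log (z - 1) * w z) = 0 := by
    intro z hz
    rw [(hs 2 (by norm_num) (by norm_num)).2 z hz, (hs 3 (by norm_num) le_rfl).2 z hz, hqz z hz,
      hs4 z hz]
    simp only [Finset.mul_sum, ← Finset.sum_add_distrib]
    refine Finset.sum_eq_zero fun i _ => ?_
    have := congrFun hg i
    simp [Fin.sum_univ_four] at this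
    linear_combination f i z * this
  have hu1 := (hu 1).1.continuousAt
  have hu2 := (hu 2).1.continuousAt
  have hu3 := (hu 3).1.continuousAt
  have hvc := hv.continuousAt
  -- Independence is read off from the orders at `1`: the value there gives `g 3 = 0`, and division
  -- by `z - 1`, `(z - 1)^2`, `(z - 1)^3` in turn gives `g 2`, `g 0` and `g 1`.
  have g3 : g 3 = 0 := by
    have := eq_zero_of_add_log_eqOn_slitDisc hr (z₀ := 1)
      (k := fun z => g 0 * ((z - 1) ^ 2 * u 2 z) + g 1 * ((z - 1) ^ 3 * u 3 z)
        + g 2 * (2 * Real.pi * Complex.I * w z) + g 3 * v z)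
      (w := fun z => g 3 * (R 1 * u 1 z + R 2 * ((z - 1) * u 2 z) + R 3 * ((z - 1) ^ 2 * u 3 z)))
      (by fun_prop) (by fun_prop) (fun z hz => by
        rw [← hrel z hz]; simp only [hw]; ring)
    simpa [hw, hv1] using this
  have g2 : g 2 = 0 := by
    have := eq_zero_of_eqOn_slitDisc hr (z₀ := 1)
      (k := fun z => g 0 * ((z - 1) * u 2 z) + g 1 * ((z - 1) ^ 2 * u 3 z)
        + g 2 * (2 * Real.pi * Complex.I *
          (R 1 * u 1 z + R 2 * ((z - 1) * u 2 z) + R 3 * ((z - 1) ^ 2 * u 3 z))))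
      (by fun_prop) (fun z hz => by
        have h0 : z - 1 ≠ 0 := sub_ne_zero.2 (hne z hz).1
        apply mul_left_cancel₀ h0
        have := hrel z hz
        rw [g3] at this
        simp only [hw] at this
        linear_combination this)
    simpa [hR, (hu 1).2, Real.pi_ne_zero] using this
  have g0 : g 0 = 0 := by
    have := eq_zero_of_eqOn_slitDisc hr (z₀ := 1)
      (k := fun z => g 0 * u 2 z + g 1 * ((z - 1) * u 3 z))
      (by fun_prop) (fun z hz => by
        have h0 : z - 1 ≠ 0 := sub_ne_zero.2 (hne z hz).1
        apply mul_left_cancel₀ (pow_ne_zero 2 h0)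
        have := hrel z hz
        rw [g3, g2] at this
        linear_combination this)
    simpa [(hu 2).2] using this
  have g1 : g 1 = 0 := by
    have := eq_zero_of_eqOn_slitDisc hr (z₀ := 1) (k := fun z => g 1 * u 3 z)
      (by fun_prop) (fun z hz => by
        have h0 : z - 1 ≠ 0 := sub_ne_zero.2 (hne z hz).1
        apply mul_left_cancel₀ (pow_ne_zero 3 h0)
        have := hrel z hz
        rw [g3, g2, g0] at this
        linear_combination this)
    simpa [(hu 3).2] using this
  intro i
  fin_cases i
  exacts [g0, g1, g2, g3]

end ODE4

/-! ### Local data of matrices -/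

theorem isConj_iff_conj {n : ℕ} {A B : Matrix (Fin n) (Fin n) ℂ} (h : IsConj A B) :
    ∃ U : (Matrix (Fin n) (Fin n) ℂ)ˣ, B = U * A * (U⁻¹ : (Matrix (Fin n) (Fin n) ℂ)ˣ) := by
  obtain ⟨U, hU⟩ := h
  exact ⟨U, by rw [hU.eq, mul_assoc, Units.mul_inv, mul_one]⟩

theorem isConj_of_mulVec {n : ℕ} {M J : Matrix (Fin n) (Fin n) ℂ} {c : Fin n → Fin n → ℂ}
    (hc : LinearIndependent ℂ c) (h : ∀ j, M.mulVec (c j) = fun i => ∑ k, c k i * J k j) :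
    IsConj M J := by
  have hu : IsUnit (Matrix.of c).transpose := by
    rw [← Matrix.linearIndependent_cols_iff_isUnit]
    exact hc
  obtain ⟨U, hU⟩ := hu
  refine IsConj.symm ⟨U, ?_⟩
  rw [hU]
  ext i j
  exact (congrFun (h j) i).symm

theorem isConj_diagonal_of_eigenvectors {n : ℕ} {M : Matrix (Fin n) (Fin n) ℂ} {d : Fin n → ℂ}
    (hd : Function.Injective d) (h : ∀ i, ∃ s : Fin n → ℂ, s ≠ 0 ∧ M.mulVec s = d i • s) :
    IsConj M (Matrix.diagonal d) := by
  choose s hs0 hs using h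
  refine isConj_of_mulVec (c := s) (Module.End.eigenvectors_linearIndependent' M.mulVecLin d hd s
    fun i => ⟨Module.End.mem_eigenspace_iff.2 (hs i), hs0 i⟩) fun j => ?_
  rw [hs]
  ext i
  simp [Matrix.diagonal_apply, mul_comm]

theorem centralizerDim_eq_of_isConj {n : ℕ} {A B : Matrix (Fin n) (Fin n) ℂ} (h : IsConj A B) :
    centralizerDim A = centralizerDim B := by
  obtain ⟨U, rfl⟩ := isConj_iff_conj h
  let V : Matrix (Fin n) (Fin n) ℂ := (U⁻¹ : (Matrix (Fin n) (Fin n) ℂ)ˣ)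
  have hVU : V * U = 1 := Units.inv_mul U
  have hUV : (U : Matrix (Fin n) (Fin n) ℂ) * V = 1 := Units.mul_inv U
  have hl : ∀ X, V * (U * X) = X := fun X => by rw [← mul_assoc, hVU, one_mul]
  have hr : ∀ X, U * (V * X) = X := fun X => by rw [← mul_assoc, hUV, one_mul]
  refine LinearEquiv.finrank_eq (LinearEquiv.mk
    ⟨⟨fun X => ⟨U * X.1 * V, ?_⟩, ?_⟩, ?_⟩ (fun X => ⟨V * X.1 * U, ?_⟩) ?_ ?_)
  · have := (Subalgebra.mem_centralizer_iff ℂ).1 X.2 A rfl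
    rw [Subalgebra.mem_centralizer_iff]
    rintro _ rfl
    change U * A * V * (U * X.1 * V) = U * X.1 * V * (U * A * V)
    simp only [mul_assoc, hl]
    rw [← mul_assoc A, this, mul_assoc]
  · intro X Y
    ext1
    simp [mul_add, add_mul]
  · intro c X
    ext1
    simp
  · have := (Subalgebra.mem_centralizer_iff ℂ).1 X.2 _ rfl
    change U * A * V * X.1 = X.1 * (U * A * V) at this
    rw [Subalgebra.mem_centralizer_iff]
    rintro _ rfl
    have h2 := congrArg (fun Y => V * Y * U) this
    simp only [mul_assoc, hl] at h2 ⊢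
    rw [hVU, mul_one] at h2
    exact h2
  · intro X
    ext1
    change V * (U * X.1 * V) * U = X.1
    simp only [mul_assoc, hl]
    rw [hVU, mul_one]
  · intro X
    ext1
    change U * (V * X.1 * U) * V = X.1
    simp only [mul_assoc, hr]
    rw [hUV, mul_one]

theorem centralizerDim_diagonal {n : ℕ} {d : Fin n → ℂ} (hd : Function.Injective d) :
    centralizerDim (Matrix.diagonal d) = n := by
  have key : centralizerDim (Matrix.diagonal d) = Module.finrank ℂ (Fin n → ℂ) := by
    refine LinearEquiv.finrank_eq (LinearEquiv.mk
      ⟨⟨fun X => X.1.diag, fun X Y => rfl⟩, fun c X => rfl⟩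
      (fun c => ⟨Matrix.diagonal c, ?_⟩) ?_ ?_)
    · rw [Subalgebra.mem_centralizer_iff]
      rintro _ rfl
      simp [mul_comm]
    · intro X
      ext i j
      by_cases hij : i = j
      · subst hij; simp
      · have := congrFun₂ ((Subalgebra.mem_centralizer_iff ℂ).1 X.2 _ rfl) i j
        rw [Matrix.diagonal_mul, Matrix.mul_diagonal] at this
        have h2 : (d i - d j) * X.1 i j = 0 := by linear_combination this
        rw [(mul_eq_zero.1 h2).resolve_left (sub_ne_zero.2 (hd.ne hij))]
        simp [hij]
    · intro c
      ext i
      simp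
  rw [key, Module.finrank_fin_fun]

/-- Subtracting the identity leaves the matrix unit at `(2, 3)`. Commuting with it forces the
entries `(0,2)`, `(1,2)`, `(3,0)`, `(3,1)`, `(3,2)` to vanish and `(3,3)` to equal `(2,2)`: six
conditions on sixteen entries. -/
theorem centralizerDim_jordan112 : centralizerDim jordan112 = 10 := by
  have key : centralizerDim jordan112 = Module.finrank ℂ (Fin 10 → ℂ) := by
    refine LinearEquiv.finrank_eq (LinearEquiv.mk
      ⟨⟨fun X => ![X.1 0 0, X.1 0 1, X.1 0 3, X.1 1 0, X.1 1 1, X.1 1 3, X.1 2 0, X.1 2 1, X.1 2 2,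
        X.1 2 3], fun X Y => by ext i; fin_cases i <;> rfl⟩,
        fun c X => by ext i; fin_cases i <;> rfl⟩
      (fun c => ⟨!![c 0, c 1, 0, c 2; c 3, c 4, 0, c 5; c 6, c 7, c 8, c 9; 0, 0, 0, c 8], ?_⟩)
      ?_ ?_)
    · rw [Subalgebra.mem_centralizer_iff]
      rintro _ rfl
      ext i j
      fin_cases i <;> fin_cases j <;>
        simp [jordan112, Matrix.mul_apply, Fin.sum_univ_four, add_comm]
    · intro X
      have h : ∀ i j, (jordan112 * X.1) i j = (X.1 * jordan112) i j :=
        fun i j => congrFun₂ ((Subalgebra.mem_centralizer_iff ℂ).1 X.2 _ rfl) i j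
      simp only [Matrix.mul_apply, Fin.sum_univ_four] at h
      have h03 := h 0 3
      have h13 := h 1 3
      have h20 := h 2 0
      have h21 := h 2 1
      have h22 := h 2 2
      have h23 := h 2 3
      simp [jordan112] at h03 h13 h20 h21 h22 h23
      rw [add_comm] at h23
      have h23' := add_right_cancel h23
      ext i j
      fin_cases i <;> fin_cases j <;> simp [h03, h13, h20, h21, h22, h23']
    · intro c
      ext i
      fin_cases i <;> rfl
  rw [key, Module.finrank_fin_fun]

theorem spectralType_eq_of_isConj {n : ℕ} {A B : Matrix (Fin n) (Fin n) ℂ} (h : IsConj A B) :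
    spectralType A = spectralType B := by
  obtain ⟨U, rfl⟩ := isConj_iff_conj h
  have hrank : ∀ (μ : ℂ) (k : ℕ), ((U * A * (U⁻¹ : (Matrix (Fin n) (Fin n) ℂ)ˣ)
      - Matrix.scalar (Fin n) μ) ^ k).rank = ((A - Matrix.scalar (Fin n) μ) ^ k).rank := by
    intro μ k
    have h1 : U * A * (U⁻¹ : (Matrix (Fin n) (Fin n) ℂ)ˣ) - Matrix.scalar (Fin n) μ =
        U * (A - Matrix.scalar (Fin n) μ) * (U⁻¹ : (Matrix (Fin n) (Fin n) ℂ)ˣ) := by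
      rw [mul_sub, sub_mul, ← (Matrix.scalar_commute μ (fun r => mul_comm _ _) _).eq,
        mul_assoc (Matrix.scalar (Fin n) μ), Units.mul_inv, mul_one]
    rw [h1, Units.conj_pow, Matrix.rank_mul_eq_left_of_isUnit_det _ _
      ((Matrix.isUnit_iff_isUnit_det _).1 (U⁻¹).isUnit),
      Matrix.rank_mul_eq_right_of_isUnit_det _ _ ((Matrix.isUnit_iff_isUnit_det _).1 U.isUnit)]
  have hc : (U * A * (U⁻¹ : (Matrix (Fin n) (Fin n) ℂ)ˣ)).charpoly = A.charpoly := by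
    rw [Matrix.charpoly_mul_comm, ← mul_assoc, Units.inv_mul, one_mul]
  simp only [spectralType, hc, hrank]

theorem spectralType_diagonal {d : Fin 4 → ℂ} (hd : Function.Injective d) :
    spectralType (Matrix.diagonal d) = {1, 1, 1, 1} := by
  have hr : (Matrix.diagonal d).charpoly.roots.toFinset = Finset.univ.image d := by
    ext μ
    rw [Matrix.charpoly_diagonal, Multiset.mem_toFinset,
      Polynomial.mem_roots (Polynomial.monic_prod_X_sub_C _ _).ne_zero, Polynomial.IsRoot,
      Polynomial.eval_prod, Finset.prod_eq_zero_iff]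
    simp [sub_eq_zero, eq_comm]
  rw [spectralType, hr, Finset.sum_image (fun i _ j _ h => hd h)]
  have hk : ∀ i : Fin 4, ∀ k : ℕ, ((Matrix.diagonal d - Matrix.scalar (Fin 4) (d i)) ^ k).rank =
      if k = 0 then 4 else 3 := by
    intro i k
    have h1 : (Matrix.diagonal d - Matrix.scalar (Fin 4) (d i)) ^ k =
        Matrix.diagonal fun j => (d j - d i) ^ k := by
      rw [Matrix.scalar_apply, Matrix.diagonal_sub, Matrix.diagonal_pow]
      rfl
    rw [h1, Matrix.rank_diagonal]
    split_ifs with hk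
    · simp [hk]
    · have : ∀ j, (d j - d i) ^ k ≠ 0 ↔ j ≠ i := fun j => by
        rw [pow_ne_zero_iff hk, sub_ne_zero, hd.ne_iff]
      rw [Fintype.card_congr (Equiv.subtypeEquivRight this)]
      simp
  simp only [hk]
  have : ((Multiset.range 4).map fun k => (if k = 0 then 4 else 3) -
      (if k + 1 = 0 then 4 else 3)).filter (0 < ·) = {1} := by decide
  simp only [this]
  rfl

theorem spectralType_jordan112 : spectralType jordan112 = {3, 1} := by
  have hr : jordan112.charpoly.roots.toFinset = {1} := by
    rw [Matrix.charpoly_of_isUpperTriangular]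
    · have : ∏ i, (X - C (jordan112 i i)) = (X - C 1 : ℂ[X]) ^ 4 := by
        rw [Fin.prod_univ_four]
        simp [jordan112]; ring
      rw [this, Polynomial.roots_pow, Polynomial.roots_X_sub_C, Multiset.toFinset_nsmul _ _ (by norm_num)]
      rfl
    · intro i j hij
      fin_cases i <;> fin_cases j <;> simp_all [jordan112]
  -- A diagonal matrix times a permutation matrix, so the rank is the number of non-zero diagonal
  -- entries.
  have e1 : jordan112 - Matrix.scalar (Fin 4) 1 = Matrix.diagonal ![0, 0, 1, 0] *
      !![1, 0, 0, 0; 0, 1, 0, 0; 0, 0, 0, 1; 0, 0, 1, 0] := by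
    ext i j
    fin_cases i <;> fin_cases j <;> simp [jordan112]
  have e2 : (jordan112 - Matrix.scalar (Fin 4) 1) ^ 2 = 0 := by
    rw [pow_two]
    ext i j
    fin_cases i <;> fin_cases j <;> simp [jordan112, Matrix.mul_apply, Fin.sum_univ_four]
  have r1 : (jordan112 - Matrix.scalar (Fin 4) 1).rank = 1 := by
    rw [e1, Matrix.rank_mul_eq_left_of_isUnit_det, Matrix.rank_diagonal]
    · rw [Fintype.card_subtype, Finset.card_eq_one]
      refine ⟨2, ?_⟩
      ext i
      fin_cases i <;> simp
    · simp [Matrix.det_succ_row_zero, Fin.sum_univ_succ, Fin.succAbove]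
  have hk : ∀ k : ℕ, ((jordan112 - Matrix.scalar (Fin 4) 1) ^ k).rank =
      if k = 0 then 4 else if k = 1 then 1 else 0 := by
    intro k
    match k with
    | 0 => simp
    | 1 => rw [pow_one, r1]; rfl
    | k + 2 =>
      rw [pow_add, e2, mul_zero, Matrix.rank_zero]
      simp
  rw [spectralType, hr, Finset.sum_singleton]
  simp only [hk]
  decide

/-! ### Rigidity -/

/-- The determinant of a diagonal matrix minus a rank-one matrix is `∏ e - ∑ x i y i ∏_{j ≠ i} e j`;
if `e i = 0`, a single term survives. Applied with `e j = α i - α j` it isolates `x i * y i` in a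
characteristic polynomial. -/
theorem det_diagonal_sub_vecMulVec (e x y : Fin 4 → ℂ) (i : Fin 4) (hi : e i = 0) :
    (Matrix.diagonal e - Matrix.vecMulVec x y).det =
      -(x i * y i) * ∏ j ∈ Finset.univ.erase i, e j := by
  have h : (Matrix.diagonal e - Matrix.vecMulVec x y).det = e 0 * e 1 * e 2 * e 3
      - x 0 * y 0 * (e 1 * e 2 * e 3) - x 1 * y 1 * (e 0 * e 2 * e 3)
      - x 2 * y 2 * (e 0 * e 1 * e 3) - x 3 * y 3 * (e 0 * e 1 * e 2) := by
    simp [Matrix.det_succ_row_zero, Fin.sum_univ_succ, Fin.succAbove, Matrix.vecMulVec_apply,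
      Matrix.diagonal_apply]
    ring
  rw [h]
  have e0 : Finset.univ.erase (0 : Fin 4) = {1, 2, 3} := by decide
  have e1 : Finset.univ.erase (1 : Fin 4) = {0, 2, 3} := by decide
  have e2 : Finset.univ.erase (2 : Fin 4) = {0, 1, 3} := by decide
  have e3 : Finset.univ.erase (3 : Fin 4) = {0, 1, 2} := by decide
  fin_cases i <;> simp at hi <;> simp [e0, e1, e2, e3, hi] <;> left <;> ring

theorem det_smul_sub_one_of_isConj {n : ℕ} {A B : Matrix (Fin n) (Fin n) ℂ} (h : IsConj A B)
    (t s : ℂ) : (t • A - s • 1).det = (t • B - s • 1).det := by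
  obtain ⟨U, rfl⟩ := isConj_iff_conj h
  have : t • (U * A * (U⁻¹ : (Matrix (Fin n) (Fin n) ℂ)ˣ)) - s • (1 : Matrix (Fin n) (Fin n) ℂ) =
      U * (t • A - s • 1) * (U⁻¹ : (Matrix (Fin n) (Fin n) ℂ)ˣ) := by
    simp [mul_sub, sub_mul]
  rw [this, Matrix.det_units_conj]

/-- `det M * det (t - B) = det (t M - 1)`: the characteristic polynomial of the inverse `B` is
obtained from the eigenvalues of `M`. -/
theorem prod_mul_det_sub {n : ℕ} {B M : Matrix (Fin n) (Fin n) ℂ} {δ : Fin n → ℂ}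
    (hMB : M * B = 1) (hM : IsConj M (Matrix.diagonal δ)) (t : ℂ) :
    (∏ j, δ j) * (t • 1 - B).det = ∏ j, (t * δ j - 1) := by
  have h1 := det_smul_sub_one_of_isConj hM 1 0
  have h2 := det_smul_sub_one_of_isConj hM t 1
  simp only [one_smul, zero_smul, sub_zero, Matrix.det_diagonal] at h1 h2
  rw [← h1, ← Matrix.det_mul, mul_sub, hMB, mul_smul_comm, mul_one, h2, ← Matrix.diagonal_one,
    ← Matrix.diagonal_smul, Matrix.diagonal_sub, Matrix.det_diagonal]
  rfl

theorem jordan112_eq :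
    jordan112 = 1 + Matrix.vecMulVec (Pi.single 2 1) (Pi.single 3 1) := by
  ext i j
  fin_cases i <;> fin_cases j <;> simp [jordan112, Matrix.vecMulVec_apply]

/-- Two matrices, the second a multiple of the first by a matrix conjugate to `jordan112`, can be
brought simultaneously to the form diagonal, diagonal plus rank one. -/
theorem exists_diagonal_add_vecMulVec {M₀ M₁ : Matrix (Fin 4) (Fin 4) ℂ} {α : Fin 4 → ℂ}
    (h0 : IsConj M₀ (Matrix.diagonal α)) (h1 : IsConj M₁ jordan112) :
    ∃ (U : (Matrix (Fin 4) (Fin 4) ℂ)ˣ) (x y : Fin 4 → ℂ),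
      SemiconjBy (U : Matrix (Fin 4) (Fin 4) ℂ) M₀ (Matrix.diagonal α) ∧
      SemiconjBy (U : Matrix (Fin 4) (Fin 4) ℂ) (M₁ * M₀)
        (Matrix.diagonal α + Matrix.vecMulVec x y) := by
  obtain ⟨U, hU⟩ := h0
  obtain ⟨V, hV⟩ := h1.symm.trans (show IsConj M₁ (U * M₁ * (U⁻¹ : (Matrix (Fin 4) (Fin 4) ℂ)ˣ)) from
      ⟨U, by rw [SemiconjBy, Units.inv_mul_cancel_right]⟩)
  have hU1 : SemiconjBy (U : Matrix (Fin 4) (Fin 4) ℂ) M₁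
      (V * jordan112 * (V⁻¹ : (Matrix (Fin 4) (Fin 4) ℂ)ˣ)) := by
    rw [hV.eq, Units.mul_inv_cancel_right, SemiconjBy, Units.inv_mul_cancel_right]
  -- With `e 2`, `e 3` unit vectors, the transported `M₁` is `1 + (V e₂)(e₃ᵀ V⁻¹)`; multiplying by
  -- the diagonal on the right only changes the covector.
  refine ⟨U, (V : Matrix (Fin 4) (Fin 4) ℂ).mulVec (Pi.single 2 1),
    Matrix.vecMul (Pi.single 3 1)
      (((V⁻¹ : (Matrix (Fin 4) (Fin 4) ℂ)ˣ) : Matrix (Fin 4) (Fin 4) ℂ) * Matrix.diagonal α),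
    hU, ?_⟩
  have := hU1.mul_right hU
  suffices h : (V : Matrix (Fin 4) (Fin 4) ℂ) * jordan112 * ((V⁻¹ : (Matrix (Fin 4) (Fin 4) ℂ)ˣ) : Matrix (Fin 4) (Fin 4) ℂ) * Matrix.diagonal α =
      Matrix.diagonal α + Matrix.vecMulVec _ _ by rwa [h] at this
  rw [jordan112_eq, mul_add, add_mul, mul_one, Units.mul_inv, add_mul, one_mul,
    Matrix.mul_vecMulVec, Matrix.vecMulVec_mul, Matrix.vecMulVec_mul, Matrix.vecMul_vecMul]

theorem semiconjBy_det_sub {n : ℕ} {U : (Matrix (Fin n) (Fin n) ℂ)ˣ} {B B' : Matrix (Fin n) (Fin n) ℂ}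
    (h : SemiconjBy (U : Matrix (Fin n) (Fin n) ℂ) B B') (t : ℂ) :
    (t • 1 - B).det = (t • 1 - B').det := by
  have h1 : U * (t • 1 - B) = (t • 1 - B') * (U : Matrix (Fin n) (Fin n) ℂ) := by
    rw [mul_sub, sub_mul, h.eq]; simp
  have h2 := congrArg Matrix.det h1
  rw [Matrix.det_mul, Matrix.det_mul, mul_comm] at h2
  exact mul_right_cancel₀ ((Matrix.isUnit_iff_isUnit_det _).1 U.isUnit).ne_zero h2

/-- A diagonal change of basis `d` sends `x i` to `d i * x i` and `y i` to `y i / d i`. The products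
are its invariants, and they are complete when none vanishes: take `d = x' / x`. -/
theorem exists_semiconjBy_diagonal {α x y x' y' : Fin 4 → ℂ} (hx : ∀ i, x i * y i ≠ 0)
    (hxy : ∀ i, x i * y i = x' i * y' i) :
    ∃ D : (Matrix (Fin 4) (Fin 4) ℂ)ˣ,
      SemiconjBy (D : Matrix (Fin 4) (Fin 4) ℂ) (Matrix.diagonal α) (Matrix.diagonal α) ∧
      SemiconjBy (D : Matrix (Fin 4) (Fin 4) ℂ) (Matrix.diagonal α + Matrix.vecMulVec x y)
        (Matrix.diagonal α + Matrix.vecMulVec x' y') := by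
  have h1 : ∀ i, x i ≠ 0 := fun i => left_ne_zero_of_mul (hx i)
  have h2 : ∀ i, x' i ≠ 0 := fun i => left_ne_zero_of_mul (hxy i ▸ hx i)
  have hu : IsUnit (Matrix.diagonal fun i => x' i / x i) := by
    rw [Matrix.isUnit_diagonal, Pi.isUnit_iff]
    exact fun i => (div_ne_zero (h2 i) (h1 i)).isUnit
  obtain ⟨D, hD⟩ := hu
  refine ⟨D, ?_, ?_⟩
  · rw [hD, SemiconjBy, Matrix.diagonal_mul_diagonal, Matrix.diagonal_mul_diagonal]
    simp only [mul_comm]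
  · rw [hD, SemiconjBy]
    ext i j
    rw [Matrix.diagonal_mul, Matrix.mul_diagonal]
    simp only [Matrix.add_apply, Matrix.vecMulVec_apply]
    have h3 : x' i / x i * (x i * y j) = x' i * y' j * (x' j / x j) := by
      have := h1 i
      have := h1 j
      field_simp
      linear_combination x' i * hxy j
    have h4 : x' i / x i * Matrix.diagonal α i j = Matrix.diagonal α i j * (x' j / x j) := by
      by_cases hij : i = j
      · subst hij; ring
      · simp [hij]
    rw [mul_add, add_mul, h3, h4]

/-- Both triples are brought to the normal form `diag α`, `diag α + x yᵀ`. The products `x i * y i`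
depend only on `α` and `δ`, so the normal forms are conjugate by a diagonal matrix. Conjugating `M
0` and `M 1 * M 0` conjugates all three, as `M 1` and `M 2` are recovered from these two. -/
theorem isRigidTriple_of_isConj {M : Fin 3 → Matrix (Fin 4) (Fin 4) ℂ} {α δ : Fin 4 → ℂ}
    (hα : Function.Injective α) (hαδ : ∀ i j, α i * δ j ≠ 1) (h : M 2 * M 1 * M 0 = 1)
    (h0 : IsConj (M 0) (Matrix.diagonal α)) (h1 : IsConj (M 1) jordan112)
    (h2 : IsConj (M 2) (Matrix.diagonal δ)) : IsRigidTriple M := by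
  intro N hN hMN
  rw [mul_assoc] at h hN
  obtain ⟨U, x, y, hU0, hU1⟩ := exists_diagonal_add_vecMulVec h0 h1
  obtain ⟨U', x', y', hU0', hU1'⟩ :=
    exists_diagonal_add_vecMulVec ((hMN 0).symm.trans h0) ((hMN 1).symm.trans h1)
  -- The characteristic polynomial of `B` at `α i`, computed once from the eigenvalues of its
  -- inverse and once from the rank-one form.
  have key : ∀ {B C : Matrix (Fin 4) (Fin 4) ℂ} {W : (Matrix (Fin 4) (Fin 4) ℂ)ˣ} {p q : Fin 4 → ℂ},
      C * B = 1 → IsConj C (Matrix.diagonal δ) →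
      SemiconjBy (W : Matrix (Fin 4) (Fin 4) ℂ) B (Matrix.diagonal α + Matrix.vecMulVec p q) →
      ∀ i, (∏ j, δ j) * (-(p i * q i) * ∏ j ∈ Finset.univ.erase i, (α i - α j)) =
        ∏ j, (α i * δ j - 1) := by
    intro B C W p q hCB hC hW i
    rw [← prod_mul_det_sub hCB hC, semiconjBy_det_sub hW, ← sub_sub, ← Matrix.diagonal_one,
      ← Matrix.diagonal_smul, Matrix.diagonal_sub, det_diagonal_sub_vecMulVec _ _ _ i (by simp)]
    simp
  have k1 := key h h2 hU1
  have k2 := key hN ((hMN 2).symm.trans h2) hU1'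
  have hne : ∀ i, ∏ j, (α i * δ j - 1) ≠ 0 := fun i =>
    Finset.prod_ne_zero_iff.2 fun j _ => sub_ne_zero.2 (hαδ i j)
  -- Non-vanishing of the right-hand side `∏ j, (α i * δ j - 1)` makes every factor on the left
  -- non-zero; in particular `x i * y i ≠ 0`.
  have hδ : (∏ j, δ j) ≠ 0 := fun h0 => hne 0 (by rw [← k1 0, h0, zero_mul])
  obtain ⟨D, hD0, hD1⟩ := exists_semiconjBy_diagonal (α := α) (x := x) (y := y) (x' := x') (y' := y')
    (fun i hi => hne i (by rw [← k1 i, hi]; simp))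
    (fun i => by
      have e := mul_left_cancel₀ hδ ((k1 i).trans (k2 i).symm)
      have hp : ∏ j ∈ Finset.univ.erase i, (α i - α j) ≠ 0 := Finset.prod_ne_zero_iff.2 fun j hj =>
        sub_ne_zero.2 (hα.ne (Finset.ne_of_mem_erase hj).symm)
      exact neg_inj.1 (mul_right_cancel₀ hp e))
  set P := U'⁻¹ * D * U with hP
  have hinv : ∀ {A B : Matrix (Fin 4) (Fin 4) ℂ}, SemiconjBy (U' : Matrix (Fin 4) (Fin 4) ℂ) A B →
      SemiconjBy ((U'⁻¹ : (Matrix (Fin 4) (Fin 4) ℂ)ˣ) : Matrix (Fin 4) (Fin 4) ℂ) B A := by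
    intro A B hAB
    exact hAB.units_inv_symm_left
  have hP0 : SemiconjBy (P : Matrix (Fin 4) (Fin 4) ℂ) (M 0) (N 0) :=
    ((hinv hU0').mul_left hD0).mul_left hU0
  have hP1 : SemiconjBy (P : Matrix (Fin 4) (Fin 4) ℂ) (M 1 * M 0) (N 1 * N 0) :=
    ((hinv hU1').mul_left hD1).mul_left hU1
  have hM0 : M 0 * (M 2 * M 1) = 1 := mul_eq_one_comm.1 (by rw [mul_assoc]; exact h)
  have hM2 : M 1 * M 0 * M 2 = 1 := mul_eq_one_comm.1 h
  refine ⟨P, fun j => ?_⟩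
  fin_cases j
  · exact hP0
  · change P * M 1 = N 1 * P
    calc P * M 1 = P * (M 1 * M 0) * (M 2 * M 1) := by
          rw [mul_assoc, mul_assoc (M 1), hM0, mul_one]
      _ = N 1 * (N 0 * P) * (M 2 * M 1) := by rw [hP1.eq, mul_assoc (N 1)]
      _ = N 1 * P := by rw [← hP0.eq, mul_assoc, mul_assoc, hM0, mul_one]
  · change P * M 2 = N 2 * P
    calc P * M 2 = N 2 * (N 1 * N 0) * P * M 2 := by rw [hN, one_mul]
      _ = N 2 * (P * (M 1 * M 0)) * M 2 := by rw [hP1.eq, mul_assoc (N 2)]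
      _ = N 2 * P := by rw [mul_assoc, mul_assoc, hM2, mul_one]

theorem rigidityIndex_eq_two {M : Fin 3 → Matrix (Fin 4) (Fin 4) ℂ} (h0 : centralizerDim (M 0) = 4)
    (h1 : centralizerDim (M 1) = 10) (h2 : centralizerDim (M 2) = 4) : rigidityIndex M = 2 := by
  rw [rigidityIndex, Fin.sum_univ_three, h0, h1, h2]
  norm_num

/-! ### Fuchsian points -/

namespace ODE4

variable {a : ODE4} {z₀ : ℂ} {b : ℕ → ℂ → ℂ}

/-- Near `z₀` the equation is `∑ k, (z - z₀)^k b k f⁽ᵏ⁾ = 0` with `b k` holomorphic and `b 4 = 1`. -/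
structure HasFuchsianForm (a : ODE4) (z₀ : ℂ) (b : ℕ → ℂ → ℂ) : Prop where
  analytic : ∀ k, AnalyticAt ℂ (b k) z₀
  four : ∀ z, b 4 z = 1
  eq : ∀ᶠ z in 𝓝 z₀, z ≠ z₀ → ∀ k : Fin 4, b k z = (z - z₀) ^ (4 - (k : ℕ)) * a k z

theorem HasFuchsianForm.solvesAt (h : a.HasFuchsianForm z₀ b) :
    ∀ᶠ z in 𝓝 z₀, z ≠ z₀ → ∀ f : ℂ → ℂ, AnalyticAt ℂ f z → fuchsOp z₀ b f z = 0 →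
      a.SolvesAt f z := by
  filter_upwards [h.eq] with z hz hne f hf hf0
  exact (solvesAt_iff_fuchsOp hne (hz hne) (h.four z)).2 ⟨hf, hf0⟩

theorem HasFuchsianForm.tendsto (h : a.HasFuchsianForm z₀ b) (k : Fin 4) :
    Tendsto (fun z => (z - z₀) ^ (4 - (k : ℕ)) * a k z) (𝓝[≠] z₀) (𝓝 (b k z₀)) := by
  refine ((h.analytic k).continuousAt.tendsto.mono_left nhdsWithin_le_nhds).congr' ?_
  filter_upwards [nhdsWithin_le_nhds h.eq, self_mem_nhdsWithin] with z hz hne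
  exact hz hne k

theorem not_isOrdinary_of_pole {k : Fin 4} {m : ℕ} (hm : m ≠ 0) {c : ℂ} (hc : c ≠ 0)
    (h : Tendsto (fun z => (z - z₀) ^ m * a k z) (𝓝[≠] z₀) (𝓝 c)) : ¬ a.IsOrdinary z₀ := by
  intro ho
  obtain ⟨f, hf, hf'⟩ := ho k
  have h1 : Tendsto (fun z => (z - z₀) ^ m * f z) (𝓝[≠] z₀) (𝓝 0) := by
    have h2 : ContinuousAt (fun z => (z - z₀) ^ m * f z) z₀ := by
      have := hf.continuousAt
      fun_prop
    have := h2.tendsto.mono_left (nhdsWithin_le_nhds (s := {z₀}ᶜ))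
    simpa [hm] using this
  refine hc (tendsto_nhds_unique h (h1.congr' ?_))
  filter_upwards [hf'] with z hz
  rw [hz]

theorem HasFuchsianForm.isRegularSingular (h : a.HasFuchsianForm z₀ b) (hs : ¬ a.IsOrdinary z₀) :
    a.IsRegularSingular z₀ := by
  refine ⟨hs, fun k => ⟨b k, h.analytic k, ?_⟩⟩
  filter_upwards [nhdsWithin_le_nhds h.eq, self_mem_nhdsWithin] with z hz hne
  exact (hz hne k).symm

/-- The indicial polynomial. -/
def indicial (β : ℕ → ℂ) : ℂ[X] :=
  descPochhammer ℂ 4 + ∑ k : Fin 4, C (β k) * descPochhammer ℂ k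

theorem eval_indicial {β : ℕ → ℂ} (h4 : β 4 = 1) (x : ℂ) :
    (indicial β).eval x = fallingSum β x := by
  simp only [indicial, fallingSum, Finset.sum_range_succ, Finset.sum_range_zero, Fin.sum_univ_four,
    h4, eval_add, eval_mul, eval_C]
  simp
  ring

theorem indicial_ne_zero (β : ℕ → ℂ) : indicial β ≠ 0 := by
  intro h
  -- `indicial` never reads `β 4`, so it may be set to `1`, as `eval_indicial` requires.
  set γ : ℕ → ℂ := fun k => if k = 4 then 1 else β k with hγ
  have e : indicial γ = indicial β := by
    refine congrArg (descPochhammer ℂ 4 + ·) (Finset.sum_congr rfl fun k _ => ?_)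
    have : (k : ℕ) ≠ 4 := by omega
    simp [hγ, this]
  have key : ∀ x, fallingSum γ x = 0 := fun x => by
    rw [← eval_indicial (by simp [hγ]), e, h, eval_zero]
  simp only [fallingSum_eq] at key
  have h0 := key 0
  have h1 := key 1
  have h2 := key 2
  have h3 := key 3
  have h4 := key 4
  have e4 : γ 4 = 1 := by simp [hγ]
  rw [e4] at h4 h3 h2 h1 h0
  -- The fourth difference of a monic quartic is `4! = 24`.
  have : (24 : ℂ) = 0 := by linear_combination h4 - 4 * h3 + 6 * h2 - 4 * h1 + h0
  norm_num at this

theorem HasFuchsianForm.hasExponents (h : a.HasFuchsianForm z₀ b) :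
    a.HasExponents z₀ (indicial fun k => b k z₀).roots :=
  ⟨fun k => b k z₀, h.tendsto, rfl⟩

theorem HasFuchsianForm.mem_roots_indicial (h : a.HasFuchsianForm z₀ b) {x : ℂ} :
    x ∈ (indicial fun k => b k z₀).roots ↔ fallingSum (fun k => b k z₀) x = 0 := by
  rw [mem_roots (indicial_ne_zero _), IsRoot, eval_indicial (h.four z₀)]

/-- Nonresonance excludes every `ρ + 1 + n` as an exponent, for its difference to `ρ` would be a
non-zero integer. -/
theorem HasFuchsianForm.exists_power_solution (h : a.HasFuchsianForm z₀ b)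
    (hn : Nonresonant (indicial fun k => b k z₀).roots) {ρ : ℂ}
    (hρ : ρ ∈ (indicial fun k => b k z₀).roots) :
    ∃ g : ℂ → ℂ, AnalyticAt ℂ g z₀ ∧ g z₀ = 1 ∧ ∀ᶠ z in 𝓝 z₀, z ≠ z₀ → ∀ φ,
      IsPowerGerm z₀ ρ φ z → a.SolvesAt (fun x => φ x * g x) z := by
  obtain ⟨g, hg, hg1, hsol⟩ := _root_.exists_power_solution (b := b) h.analytic
    (by rw [h.four]; exact one_ne_zero) (h.mem_roots_indicial.1 hρ) (fun n hn0 => by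
      have := hn.2 _ (h.mem_roots_indicial.2 hn0) _ hρ (n + 1) (by push_cast; ring)
      have h1 : ((n + 1 : ℕ) : ℂ) = 0 := by push_cast; linear_combination this
      exact Nat.succ_ne_zero n (Nat.cast_eq_zero.1 h1))
  refine ⟨g, hg, hg1, ?_⟩
  filter_upwards [hsol, h.solvesAt, hg.eventually_analyticAt] with z h1 h2 h3 hne φ hφ
  exact h2 hne _ (hφ.1.mul h3) (h1 hne φ hφ)

theorem HasFuchsianForm.hasPowerSolution (h : a.HasFuchsianForm z₀ b)
    (hn : Nonresonant (indicial fun k => b k z₀).roots) {ρ : ℂ}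
    (hρ : ρ ∈ (indicial fun k => b k z₀).roots) : a.HasPowerSolution z₀ ρ := by
  obtain ⟨g, hg, hg1, hsol⟩ := h.exists_power_solution hn hρ
  refine ⟨g, hg, hg1, ?_⟩
  filter_upwards [hsol] with z hz hs
  exact hz (sub_ne_zero.1 (Complex.slitPlane_ne_zero hs)) _ (.cpow ρ hs)

/-- Rescaling the variable rescales the roots and keeps multiplicities; this is how wave numbers
become exponents. -/
theorem roots_map_eq_of_comp {P Q : ℂ[X]} {r e : ℂ} (hr : r ≠ 0) (he : e ≠ 0)
    (h : ∀ x, P.eval (r * x) = e * Q.eval x) : Q.roots = P.roots.map fun k => r⁻¹ * k := by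
  have h1 : P.comp (C r * X + C 0) = C e * Q :=
    Polynomial.funext fun x => by simp [h]
  have h2 := roots_comp_C_mul_X_add_C P r 0 hr.isUnit
  rw [h1, roots_C_mul _ he] at h2
  simpa using h2

end ODE4

/-! ### The equation of the model -/

namespace Medium

variable (p : Medium)

/-- `Ω / V` -/
def w : ℂ := p.Ω / p.V
/-- The residue datum `Λ / (V² γ²)` of the point `1`. -/
def L : ℂ := p.Λ / (p.V ^ 2 * p.γ ^ 2)
/-- `M² / (V² γ²)` -/
def mm : ℂ := p.M ^ 2 / (p.V ^ 2 * p.γ ^ 2)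
/-- `G² / (V⁴ γ²)` -/
def gg : ℂ := p.G ^ 2 / (p.V ^ 4 * p.γ ^ 2)

/-- The constant parts of the coefficients with respect to `1 / (1 - z)`. -/
def bConst : ℕ → ℂ
  | 0 => -p.gg * p.V ^ 4 * p.w ^ 2 + p.w ^ 2 * p.mm + p.w ^ 4
  | 1 => 2 * Complex.I * p.gg * p.V ^ 2 * p.w + p.gg - p.mm - 2 * Complex.I * p.w * p.mm
      - 6 * p.w ^ 2 + 4 * Complex.I * p.w + 1 - 4 * Complex.I * p.w ^ 3
  | 2 => p.gg - p.mm - 6 * p.w ^ 2 + 12 * Complex.I * p.w + 7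
  | 3 => 6 + 4 * Complex.I * p.w
  | _ => 1

/-- The coefficients of the equation in the form `∑ k, z^k b k f⁽ᵏ⁾ = 0`. -/
def bZero : ℕ → ℂ → ℂ
  | 0 => fun z => p.bConst 0 + p.L * (-p.w ^ 2 / (1 - z) + (1 + 2 * Complex.I * p.w) * (z / (1 - z) ^ 2)
      + 2 * (z ^ 2 / (1 - z) ^ 3))
  | 1 => fun z => p.bConst 1 + p.L * ((1 + 2 * Complex.I * p.w) / (1 - z) + 2 * (z / (1 - z) ^ 2))
  | 2 => fun z => p.bConst 2 + p.L / (1 - z)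
  | 3 => fun _ => p.bConst 3
  | _ => fun _ => 1

/-- The coefficients of the equation in the form `∑ k, (z - 1)^k b k f⁽ᵏ⁾ = 0`. -/
def bOne : ℕ → ℂ → ℂ
  | 0 => fun z => (z - 1) * (((z - 1) ^ 3 * p.bConst 0 + p.L * ((z - 1) ^ 2 * p.w ^ 2
      + (z - 1) * ((1 + 2 * Complex.I * p.w) * z) - 2 * z ^ 2)) / z ^ 4)
  | 1 => fun z => (z - 1) * (((z - 1) ^ 2 * p.bConst 1
      + p.L * (-(z - 1) * (1 + 2 * Complex.I * p.w) + 2 * z)) / z ^ 3)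
  | 2 => fun z => (z - 1) * (((z - 1) * p.bConst 2 - p.L) / z ^ 2)
  | 3 => fun z => (z - 1) * (p.bConst 3 / z)
  | _ => fun _ => 1

/-- The coefficients of the equation at infinity in the form `∑ k, t^k b k f⁽ᵏ⁾ = 0`. -/
def bInf : ℕ → ℂ → ℂ
  | 0 => fun t => p.bConst 0 + p.L * (p.w ^ 2 * (t / (1 - t))
      + (1 + 2 * Complex.I * p.w) * (t / (1 - t) ^ 2) - 2 * (t / (1 - t) ^ 3))
  | 1 => fun t => 24 - 6 * p.bConst 3 + 2 * p.bConst 2 - p.bConst 1 + p.L * (-2 * (t / (1 - t))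
      + (1 + 2 * Complex.I * p.w) * (t / (1 - t)) - 2 * (t / (1 - t) ^ 2))
  | 2 => fun t => 36 - 6 * p.bConst 3 + p.bConst 2 - p.L * (t / (1 - t))
  | 3 => fun _ => 12 - p.bConst 3
  | _ => fun _ => 1

variable {p}

theorem Admissible.γ_pos (hp : p.Admissible) : 0 < p.γ := by
  have hV := abs_lt.mp hp.V_lt
  have : 0 < 1 - p.V ^ 2 := by nlinarith [hV.1, hV.2]
  unfold γ; positivity

theorem Admissible.βt_ne (hp : p.Admissible) : p.βt ≠ 0 := div_ne_zero hp.β_ne hp.γ_pos.ne'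

theorem Admissible.L_ne (hp : p.Admissible) : p.L ≠ 0 := by
  have h1 : p.Λ ≠ 0 := div_ne_zero hp.lam_ne (mul_ne_zero four_ne_zero (pow_ne_zero 2 hp.βt_ne))
  exact div_ne_zero (by exact_mod_cast h1) (mul_ne_zero (pow_ne_zero 2 (by exact_mod_cast hp.V_ne))
    (pow_ne_zero 2 (by exact_mod_cast hp.γ_pos.ne')))

theorem equation_eq (hp : p.Admissible) (k : Fin 4) (z : ℂ) :
    p.equation k z = p.bZero k z / z ^ (4 - (k : ℕ)) := by
  have hV : (p.V : ℂ) ≠ 0 := by exact_mod_cast hp.V_ne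
  have hγ : (p.γ : ℂ) ≠ 0 := by exact_mod_cast hp.γ_pos.ne'
  -- At `z = 0` both sides are quotients by zero, hence zero.
  by_cases hz : z = 0
  · subst hz
    have : (4 - (k : ℕ)) ≠ 0 := by omega
    simp [equation, fuchsCoeff, this]
  have key : p.fuchsCoeff k.castSucc z = (p.V : ℂ) ^ 4 * p.γ ^ 4 * z ^ (k : ℕ) * p.bZero k z := by
    fin_cases k <;> simp [fuchsCoeff, bZero, bConst, w, L, mm, gg] <;>
    · try simp only [div_eq_mul_inv _ (1 - z), div_eq_mul_inv _ ((1 - z) ^ 2),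
        div_eq_mul_inv _ ((1 - z) ^ 3), ← inv_pow]
      -- With `(1 - z)⁻¹` as an indeterminate the identity is polynomial, so it also holds at `z =
      -- 1`.
      generalize (1 - z)⁻¹ = u
      field_simp
      try ring
  have h4 : p.fuchsCoeff 4 z = (p.V : ℂ) ^ 4 * p.γ ^ 4 * z ^ 4 := rfl
  have hsplit : z ^ 4 = z ^ (k : ℕ) * z ^ (4 - (k : ℕ)) := by
    rw [← pow_add]; congr 1; omega
  rw [equation, key, h4, hsplit]
  field_simp

theorem hasFuchsianForm_zero (hp : p.Admissible) : p.equation.HasFuchsianForm 0 p.bZero where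
  analytic k := by
    match k with
    | 0 => unfold bZero; fun_prop (disch := simp)
    | 1 => unfold bZero; fun_prop (disch := simp)
    | 2 => unfold bZero; fun_prop (disch := simp)
    | 3 => unfold bZero; fun_prop (disch := simp)
    | k + 4 => unfold bZero; fun_prop (disch := simp)
  four z := rfl
  eq := Eventually.of_forall fun z hz k => by
    rw [equation_eq hp, sub_zero, mul_div_cancel₀ _ (pow_ne_zero _ hz)]

theorem hasFuchsianForm_one (hp : p.Admissible) : p.equation.HasFuchsianForm 1 p.bOne where
  analytic k := by
    match k with
    | 0 => unfold bOne; fun_prop (disch := simp)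
    | 1 => unfold bOne; fun_prop (disch := simp)
    | 2 => unfold bOne; fun_prop (disch := simp)
    | 3 => unfold bOne; fun_prop (disch := simp)
    | k + 4 => unfold bOne; fun_prop (disch := simp)
  four z := rfl
  eq := by
    filter_upwards [isOpen_ne.eventually_mem (one_ne_zero (α := ℂ))] with z hz0 hz1 k
    obtain ⟨s, rfl⟩ : ∃ s, z = 1 + s := ⟨z - 1, by ring⟩
    have h1 : s ≠ 0 := fun h => hz1 (by simp [h])
    have hz0' : 1 + s ≠ 0 := hz0
    rw [equation_eq hp]
    fin_cases k <;> simp [bOne, bZero] <;> field_simp <;> ring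

theorem hasFuchsianForm_infinity (hp : p.Admissible) :
    p.equation.atInfinity.HasFuchsianForm 0 p.bInf where
  analytic k := by
    match k with
    | 0 => unfold bInf; fun_prop (disch := simp)
    | 1 => unfold bInf; fun_prop (disch := simp)
    | 2 => unfold bInf; fun_prop (disch := simp)
    | 3 => unfold bInf; fun_prop (disch := simp)
    | k + 4 => unfold bInf; fun_prop (disch := simp)
  four z := rfl
  eq := by
    filter_upwards [isOpen_ne.eventually_mem (zero_ne_one (α := ℂ))] with t ht1 ht0 k
    have ht1' : t ≠ 1 := ht1
    have h1 : 1 - t ≠ 0 := sub_ne_zero.2 ht1'.symm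
    have h2 : 1 - t⁻¹ = -((1 - t) / t) := by field_simp; ring
    fin_cases k <;> simp [ODE4.atInfinity, equation_eq hp, bInf, bZero, h2] <;> field_simp <;> ring

theorem analyticAt_equation (hp : p.Admissible) {z : ℂ} (hz0 : z ≠ 0) (hz1 : z ≠ 1) (k : Fin 4) :
    AnalyticAt ℂ (p.equation k) z := by
  have h1 : 1 - z ≠ 0 := sub_ne_zero.2 hz1.symm
  rw [show p.equation k = fun z => p.bZero k z / z ^ (4 - (k : ℕ)) from
    funext fun z => equation_eq hp k z]
  refine AnalyticAt.div ?_ (by fun_prop) (pow_ne_zero _ hz0)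
  fin_cases k <;> simp only [bZero] <;> fun_prop (disch := simp [h1])

end Medium

theorem Multiset.exists_eq_map_univ {s : Multiset ℂ} {n : ℕ} (h : s.card = n) :
    ∃ e : Fin n → ℂ, s = Finset.univ.val.map e := by
  subst h
  induction s using Quotient.inductionOn with
  | h l =>
    refine ⟨fun i => l.get i, ?_⟩
    rw [Fin.univ_val_map]
    exact congrArg _ (List.ofFn_get l).symm

theorem exp_two_pi_eq_exp_iff {x y : ℂ} (h : Complex.exp (2 * Real.pi * Complex.I * x) =
    Complex.exp (2 * Real.pi * Complex.I * y)) : ∃ n : ℤ, x - y = n := by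
  obtain ⟨n, hn⟩ := Complex.exp_eq_exp_iff_exists_int.1 h
  refine ⟨n, ?_⟩
  have := Complex.two_pi_I_ne_zero
  apply mul_left_cancel₀ this
  linear_combination hn

namespace ODE4

theorem natDegree_indicial (β : ℕ → ℂ) : (indicial β).natDegree = 4 := by
  have hlt : (∑ k : Fin 4, C (β k) * descPochhammer ℂ k).natDegree < (descPochhammer ℂ 4).natDegree := by
    rw [descPochhammer_natDegree]
    refine lt_of_le_of_lt (natDegree_sum_le_of_forall_le _ _ fun k _ => ?_) (show 3 < 4 by norm_num)
    refine (natDegree_C_mul_le _ _).trans ?_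
    rw [descPochhammer_natDegree]
    omega
  rw [indicial, natDegree_add_eq_left_of_natDegree_lt hlt, descPochhammer_natDegree]

theorem card_roots_indicial (β : ℕ → ℂ) : (indicial β).roots.card = 4 := by
  rw [← natDegree_indicial β]
  exact (IsAlgClosed.splits (indicial β)).natDegree_eq_card_roots.symm

end ODE4

namespace Medium

variable {p : Medium}

/-- At `z = 0` the background term `Λ/(1 - z)` is `Λ`, which turns `μ²` into `μ² - λ`. On `z^ρ` with
`ρ = i k/(2β̃)` the operator `V θ + iΩ` acts as `i (kV + ω)/(2β̃)`, so the indicial polynomial is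
`DR₀` up to a constant. -/
theorem roots_indicial_zero (hp : p.Admissible) :
    (ODE4.indicial fun k => p.bZero k 0).roots = p.exponentsZero := by
  have hb : (p.βt : ℂ) ≠ 0 := by exact_mod_cast hp.βt_ne
  have hV : (p.V : ℂ) ≠ 0 := by exact_mod_cast hp.V_ne
  have hγ : (p.γ : ℂ) ≠ 0 := by exact_mod_cast hp.γ_pos.ne'
  have hI := Complex.I_ne_zero
  rw [ODE4.roots_map_eq_of_comp (P := p.DR₀) (r := -2 * Complex.I * p.βt)
    (e := 16 * p.βt ^ 4 * p.γ ^ 4 * p.V ^ 4) (by simp [hb]) (by simp [hb, hV, hγ])]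
  · refine Multiset.map_congr rfl fun k _ => ?_
    field_simp
    linear_combination -k * Complex.I_sq
  · intro x
    rw [ODE4.eval_indicial rfl, fallingSum_eq]
    simp [DR₀, dispersion, bZero, bConst, w, L, mm, gg, G, M, Ω, Λ]
    have hI3 : Complex.I ^ 3 = -Complex.I := by rw [pow_succ, Complex.I_sq]; ring
    have hI4 : Complex.I ^ 4 = 1 := Complex.I_pow_four
    field_simp
    ring_nf
    simp only [Complex.I_sq, hI3, hI4]
    ring

/-- At `z = ∞` the background term `Λ/(1 - z)` tends to zero, which leaves `μ²`; and `t d/dt = -θ`,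
whence the opposite sign of the substitution. -/
theorem roots_indicial_infinity (hp : p.Admissible) :
    (ODE4.indicial fun k => p.bInf k 0).roots = p.exponentsInfinity := by
  have hb : (p.βt : ℂ) ≠ 0 := by exact_mod_cast hp.βt_ne
  have hV : (p.V : ℂ) ≠ 0 := by exact_mod_cast hp.V_ne
  have hγ : (p.γ : ℂ) ≠ 0 := by exact_mod_cast hp.γ_pos.ne'
  have hI := Complex.I_ne_zero
  rw [ODE4.roots_map_eq_of_comp (P := p.DR) (r := 2 * Complex.I * p.βt)
    (e := 16 * p.βt ^ 4 * p.γ ^ 4 * p.V ^ 4) (by simp [hb]) (by simp [hb, hV, hγ])]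
  · refine Multiset.map_congr rfl fun k _ => ?_
    field_simp
    linear_combination k * Complex.I_sq
  · intro x
    rw [ODE4.eval_indicial rfl, fallingSum_eq]
    simp [DR, dispersion, bInf, bConst, w, L, mm, gg, G, M, Ω, Λ]
    have hI3 : Complex.I ^ 3 = -Complex.I := by rw [pow_succ, Complex.I_sq]; ring
    have hI4 : Complex.I ^ 4 = 1 := Complex.I_pow_four
    field_simp
    ring_nf
    simp only [Complex.I_sq, hI3, hI4]
    ring

theorem bOne_center {k : ℕ} (hk : k < 4) : p.bOne k 1 = 0 := by
  interval_cases k <;> simp [bOne]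

theorem roots_indicial_one : (ODE4.indicial fun k => p.bOne k 1).roots = {0, 1, 2, 3} := by
  have h : (ODE4.indicial fun k => p.bOne k 1) =
      ((({0, 1, 2, 3} : Multiset ℂ)).map fun a => X - C a).prod := by
    refine Polynomial.funext fun x => ?_
    rw [ODE4.eval_indicial rfl, fallingSum_eq]
    simp only [bOne_center (p := p) (show 0 < 4 by norm_num), bOne_center (p := p) (show 1 < 4 by norm_num),
      bOne_center (p := p) (show 2 < 4 by norm_num), bOne_center (p := p) (show 3 < 4 by norm_num)]
    simp [bOne]
    ring
  rw [h, roots_multiset_prod_X_sub_C]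

/-- The coefficient of `f‴` has residue `6 + 4iΩ/V`. As `Ω/V` is real, its real part is `6`, so the
pole is genuine for all parameters. At infinity the residue is `12 - (6 + 4iΩ/V)`, again with real
part `6`. -/
theorem isRegularSingular_zero (hp : p.Admissible) : p.equation.IsRegularSingular 0 := by
  have h := hasFuchsianForm_zero hp
  refine h.isRegularSingular (ODE4.not_isOrdinary_of_pole (m := 1) one_ne_zero (c := p.bZero 3 0) ?_
    (h.tendsto 3))
  intro h0
  have := congrArg Complex.re h0
  simp [bZero, bConst, w, ← Complex.ofReal_div] at this

theorem isRegularSingular_infinity (hp : p.Admissible) :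
    p.equation.atInfinity.IsRegularSingular 0 := by
  have h := hasFuchsianForm_infinity hp
  refine h.isRegularSingular (ODE4.not_isOrdinary_of_pole (m := 1) one_ne_zero (c := p.bInf 3 0) ?_
    (h.tendsto 3))
  intro h0
  have := congrArg Complex.re h0
  simp [bInf, bConst, w, ← Complex.ofReal_div] at this
  norm_num at this

/-- The quotient of `bOne 0` by `z - 1`. -/
def kappa (p : Medium) (z : ℂ) : ℂ := ((z - 1) ^ 3 * p.bConst 0 + p.L * ((z - 1) ^ 2 * p.w ^ 2
      + (z - 1) * ((1 + 2 * Complex.I * p.w) * z) - 2 * z ^ 2)) / z ^ 4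

theorem analyticAt_kappa : AnalyticAt ℂ p.kappa 1 := by
  unfold kappa; fun_prop (disch := simp)

theorem kappa_one : p.kappa 1 = -2 * p.L := by simp [kappa]; ring

/-- The coefficient of `f` has a triple pole at `1` with leading coefficient `-2Λ/(V²γ²)`, which is
where `λ ≠ 0` enters. -/
theorem isRegularSingular_one (hp : p.Admissible) : p.equation.IsRegularSingular 1 := by
  have h := hasFuchsianForm_one hp
  refine h.isRegularSingular (ODE4.not_isOrdinary_of_pole (m := 3) three_ne_zero (c := p.kappa 1)
    (k := 0) (by rw [kappa_one]; simpa using hp.L_ne) ?_)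
  refine (analyticAt_kappa.continuousAt.tendsto.mono_left nhdsWithin_le_nhds).congr' ?_
  filter_upwards [nhdsWithin_le_nhds h.eq, self_mem_nhdsWithin] with z hz hne
  have h1 : z - 1 ≠ 0 := sub_ne_zero.2 hne
  apply mul_left_cancel₀ h1
  change p.bOne 0 z = _
  refine (hz hne 0).trans ?_
  change (z - 1) ^ 4 * _ = _
  ring

/-- The only singular ingredient of the equation at `1` is the product `Λ f/(1 - z)`, and for `f =
(z - 1)^m` with `m ≥ 1` it is holomorphic. So the equation applied to `(z - 1)^m` is holomorphic at
`1`, and the Fuchsian operator, which carries an extra `(z - 1)^4`, gives a multiple of `(z - 1)^4`.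
-/
theorem bOne_compatible (m : ℕ) (h1 : 1 ≤ m) (h3 : m ≤ 3) : ∃ κ : ℂ → ℂ, AnalyticAt ℂ κ 1 ∧
    ∀ᶠ z in 𝓝 1, fallingSum (fun k => p.bOne k z) m = (z - 1) ^ (4 - m) * κ z := by
  have hne : ∀ᶠ z : ℂ in 𝓝 1, z ≠ 0 := isOpen_ne.eventually_mem one_ne_zero
  interval_cases m
  · refine ⟨fun z => ((z - 1) * p.bConst 0 + p.L * p.w ^ 2) / z ^ 4 + p.bConst 1 / z ^ 3,
      by fun_prop (disch := simp), ?_⟩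
    filter_upwards [hne] with z hz
    rw [fallingSum_eq]
    simp [bOne]
    field_simp
    ring
  · refine ⟨fun z => ((z - 1) ^ 2 * p.bConst 0 + (z - 1) * p.L * p.w ^ 2) / z ^ 4
      + (2 * (z - 1) * p.bConst 1 - p.L * (1 + 2 * Complex.I * p.w)) / z ^ 3
      + 2 * p.bConst 2 / z ^ 2, by fun_prop (disch := simp), ?_⟩
    filter_upwards [hne] with z hz
    rw [fallingSum_eq]
    simp [bOne]
    field_simp
    ring
  · refine ⟨fun z => p.kappa z + 3 * (((z - 1) ^ 2 * p.bConst 1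
      + p.L * (-(z - 1) * (1 + 2 * Complex.I * p.w) + 2 * z)) / z ^ 3)
      + 6 * (((z - 1) * p.bConst 2 - p.L) / z ^ 2) + 6 * (p.bConst 3 / z), ?_, ?_⟩
    · have := analyticAt_kappa (p := p)
      fun_prop (disch := simp)
    filter_upwards [hne] with z hz
    rw [fallingSum_eq]
    simp [bOne, kappa]
    field_simp
    ring

theorem exists_local_solutions_one (hp : p.Admissible) :
    ∃ (u : ℕ → ℂ → ℂ) (v : ℂ → ℂ) (R : ℕ → ℂ), (∀ m, AnalyticAt ℂ (u m) 1 ∧ u m 1 = 1) ∧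
      AnalyticAt ℂ v 1 ∧ v 1 = 1 ∧ R 1 = p.L ∧
      (∀ m, 1 ≤ m → m ≤ 3 → ∀ᶠ z in 𝓝 1, z ≠ 1 →
        p.equation.SolvesAt (fun x => (x - 1) ^ m * u m x) z) ∧
      ∀ᶠ z in 𝓝 1, z ≠ 1 → ∀ ℓ, IsLogGerm 1 ℓ z →
        p.equation.SolvesAt (fun x => v x + ℓ x * (R 1 * ((x - 1) ^ 1 * u 1 x)
          + R 2 * ((x - 1) ^ 2 * u 2 x) + R 3 * ((x - 1) ^ 3 * u 3 x))) z := by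
  have h := hasFuchsianForm_one hp
  obtain ⟨u, v, R, hu, hv, hv1, hR, hsol, hlog⟩ := exists_log_solution h.analytic (h.four 1)
    (fun k hk => bOne_center hk) analyticAt_kappa (Eventually.of_forall fun z => rfl) kappa_one
    bOne_compatible
  refine ⟨u, v, R, hu, hv, hv1, hR, fun m h1 h3 => ?_, ?_⟩
  · filter_upwards [hsol m h1 h3, h.solvesAt, (hu m).1.eventually_analyticAt] with z a1 a2 a3 hne
    exact a2 hne _ (by fun_prop) (a1 hne)
  · filter_upwards [hlog, h.solvesAt, hv.eventually_analyticAt, (hu 1).1.eventually_analyticAt,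
      (hu 2).1.eventually_analyticAt, (hu 3).1.eventually_analyticAt] with z a1 a2 a3 b1 b2 b3 hne ℓ hℓ
    have := hℓ.1
    exact a2 hne _ (by fun_prop) (a1 hne ℓ hℓ)

theorem hasHolomorphicSolution_one (hp : p.Admissible) (m : ℕ) (h1 : 1 ≤ m) (h3 : m ≤ 3) :
    p.equation.HasHolomorphicSolution 1 m := by
  obtain ⟨u, v, R, hu, hv, hv1, hR, hsol, hlog⟩ := exists_local_solutions_one hp
  exact ⟨u m, (hu m).1, (hu m).2, eventually_nhdsWithin_iff.2 (hsol m h1 h3)⟩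

theorem hasLogSolution_one (hp : p.Admissible) :
    p.equation.HasLogSolution 1 ((p.Λ / (p.V ^ 2 * p.γ ^ 2) : ℝ) : ℂ) := by
  obtain ⟨u, v, R, hu, hv, hv1, hR, hsol, hlog⟩ := exists_local_solutions_one hp
  have hu1 := (hu 1).1
  have hu2 := (hu 2).1
  have hu3 := (hu 3).1
  refine ⟨v, _, hv, ?_, hv1, ?_, ?_, ?_, hlog.mono fun z hz hs =>
    hz (sub_ne_zero.1 (Complex.slitPlane_ne_zero hs)) _ (isLogGerm_log_sub hs)⟩
  · fun_prop
  · simp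
  · have e : (fun x => R 1 * ((x - 1) ^ 1 * u 1 x) + R 2 * ((x - 1) ^ 2 * u 2 x)
        + R 3 * ((x - 1) ^ 3 * u 3 x)) = fun x => (x - 1) * (R 1 * u 1 x + R 2 * ((x - 1) * u 2 x)
        + R 3 * ((x - 1) ^ 2 * u 3 x)) := by ext x; ring
    have hd : DifferentiableAt ℂ (fun x => R 1 * u 1 x + R 2 * ((x - 1) * u 2 x)
        + R 3 * ((x - 1) ^ 2 * u 3 x)) 1 := AnalyticAt.differentiableAt (by fun_prop)
    rw [e]
    refine (((hasDerivAt_id (1 : ℂ)).sub_const 1).mul hd.hasDerivAt).deriv.trans ?_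
    simp [(hu 1).2, hR, L]
  · rw [eventually_nhdsWithin_iff]
    filter_upwards [hsol 1 le_rfl (by norm_num), hsol 2 (by norm_num) (by norm_num),
      hsol 3 (by norm_num) le_rfl] with z a1 a2 a3 hne
    exact (((a1 hne).const_mul _).add ((a2 hne).const_mul _)).add ((a3 hne).const_mul _)

/-- The coefficients `bOne k`, `k < 4`, are divisible by `z - 1`. Dividing the equation by `z - 1`
and letting `z → 1` leaves `κ(1) f(1) = 0`, where `κ(1) = -2Λ/(V²γ²) ≠ 0`. -/
theorem eq_zero_of_solvesAt_one (hp : p.Admissible) {f : ℂ → ℂ} (hf : AnalyticAt ℂ f 1)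
    (hs : ∀ᶠ z in 𝓝[≠] (1 : ℂ), p.equation.SolvesAt f z) : f 1 = 0 := by
  have h := hasFuchsianForm_one hp
  have hd := hf.iteratedDeriv_analyticAt
  have hk := analyticAt_kappa (p := p)
  set E : ℂ → ℂ := fun z => p.kappa z * f z + (z - 1) * ((((z - 1) ^ 2 * p.bConst 1
      + p.L * (-(z - 1) * (1 + 2 * Complex.I * p.w) + 2 * z)) / z ^ 3) * iteratedDeriv 1 f z
      + (z - 1) * (((z - 1) * p.bConst 2 - p.L) / z ^ 2) * iteratedDeriv 2 f z
      + (z - 1) ^ 2 * (p.bConst 3 / z) * iteratedDeriv 3 f z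
      + (z - 1) ^ 2 * iteratedDeriv 4 f z) with hE
  have hEc : AnalyticAt ℂ E 1 := by
    have h1 := hd 1
    have h2 := hd 2
    have h3 := hd 3
    have h4 := hd 4
    fun_prop (disch := simp)
  have hE0 : ∀ᶠ z in 𝓝[≠] (1 : ℂ), E z = 0 := by
    filter_upwards [hs, nhdsWithin_le_nhds h.eq, self_mem_nhdsWithin] with z a1 a2 hne
    have h1 : z - 1 ≠ 0 := sub_ne_zero.2 hne
    have := ((ODE4.solvesAt_iff_fuchsOp hne (a2 hne) (h.four z)).1 a1).2
    apply mul_left_cancel₀ h1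
    rw [mul_zero, ← this]
    simp only [fuchsOp, Finset.sum_range_succ, Finset.sum_range_zero, bOne, hE, kappa,
      iteratedDeriv_zero]
    ring
  have := tendsto_nhds_unique (hEc.continuousAt.tendsto.mono_left (nhdsWithin_le_nhds (s := {1}ᶜ)))
    (tendsto_const_nhds.congr' (hE0.mono fun z hz => hz.symm))
  simpa [hE, kappa_one, hp.L_ne] using this

end Medium

theorem Nonresonant.exists_multipliers {s : Multiset ℂ} (hs : Nonresonant s) (h4 : s.card = 4) :
    ∃ e : Fin 4 → ℂ, s = Finset.univ.val.map e ∧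
      Function.Injective fun i => Complex.exp (2 * Real.pi * Complex.I * e i) := by
  obtain ⟨e, he⟩ := Multiset.exists_eq_map_univ h4
  have hmem : ∀ i, e i ∈ s := fun i => by rw [he]; exact Multiset.mem_map_of_mem _ (Finset.mem_univ i)
  have hinj : Function.Injective e := by
    have := hs.1
    rw [he, Fin.univ_val_map, Multiset.coe_nodup, List.nodup_ofFn] at this
    exact this
  refine ⟨e, he, fun i j hij => hinj ?_⟩
  obtain ⟨n, hn⟩ := exp_two_pi_eq_exp_iff hij
  exact hs.2 _ (hmem i) _ (hmem j) n hn

namespace Medium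

variable {p : Medium}

theorem exists_isLocalBasis_basePoint (hp : p.Admissible) :
    ∃ u, p.equation.IsLocalBasis basePoint u := by
  obtain ⟨e, -, he⟩ := ODE4.exists_basis_of_starConvex (a := p.equation) isOpen_domMid
    starConvex_domMid (mem_domMid.2 (.inl (by norm_num)))
    (fun z hz k => analyticAt_equation hp (ne_of_mem_domMid hz).1 (ne_of_mem_domMid hz).2 k)
    (z := basePoint) (mem_domMid.2 (.inr (by rw [basePoint_im]; norm_num)))
  exact ⟨e, he⟩

theorem exists_monodromy (hp : p.Admissible) {u : Fin 4 → ℂ → ℂ}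
    (hu : p.equation.IsLocalBasis basePoint u) :
    ∃ M : Fin 3 → Matrix (Fin 4) (Fin 4) ℂ,
      p.equation.IsMonodromyTriple u M ∧
      (∀ N, p.equation.IsMonodromyTriple u N → N = M) ∧
      M 2 * M 1 * M 0 = 1 ∧
      IsConj (M 1) jordan112 ∧
      (Nonresonant p.exponentsZero → Nonresonant p.exponentsInfinity →
        (∃ d : Fin 4 → ℂ, Function.Injective d ∧ IsConj (M 0) (Matrix.diagonal d) ∧
          Finset.univ.val.map d =
            p.exponentsZero.map fun ρ => Complex.exp (2 * Real.pi * Complex.I * ρ)) ∧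
        (∃ d : Fin 4 → ℂ, Function.Injective d ∧ IsConj (M 2) (Matrix.diagonal d) ∧
          Finset.univ.val.map d =
            p.exponentsInfinity.map fun ρ => Complex.exp (2 * Real.pi * Complex.I * ρ)) ∧
        spectralType (M 0) = {1, 1, 1, 1} ∧
        spectralType (M 1) = {3, 1} ∧
        spectralType (M 2) = {1, 1, 1, 1} ∧
        centralizerDim (M 0) = 4 ∧ centralizerDim (M 1) = 10 ∧ centralizerDim (M 2) = 4 ∧
        rigidityIndex M = 2 ∧
        (NonresonantPair p.exponentsZero p.exponentsInfinity → IsRigidTriple M)) := by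
  obtain ⟨M, n, m, q, c0, c1, c2, hn, hm, hq⟩ :=
    ODE4.exists_crossings (fun z h0 h1 k => analyticAt_equation hp h0 h1 k) hu
  have hM := ODE4.isMonodromyTriple_of_crossings c0 c1 c2 hn hm hq
  have hprod := ODE4.monodromy_mul_eq_one c0 c1 c2
  obtain ⟨y, v, R, hy, hv, hv1, hR, hsol, hlog⟩ := exists_local_solutions_one hp
  have hJ := c1.isConj_jordan hy hv hv1 (by rw [hR]; exact hp.L_ne) hsol hlog
  refine ⟨M, hM, fun N hN => ODE4.IsMonodromyTriple.unique hu hM hN, hprod, hJ, fun n0 nI => ?_⟩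
  have e0 := roots_indicial_zero hp
  have eI := roots_indicial_infinity hp
  obtain ⟨ρ, hρ, hρi⟩ := n0.exists_multipliers (by rw [← e0, ODE4.card_roots_indicial])
  obtain ⟨σ, hσ, hσi⟩ := nI.exists_multipliers (by rw [← eI, ODE4.card_roots_indicial])
  have hρm : ∀ i, ρ i ∈ p.exponentsZero := fun i => by
    rw [hρ]; exact Multiset.mem_map_of_mem _ (Finset.mem_univ i)
  have hσm : ∀ i, σ i ∈ p.exponentsInfinity := fun i => by
    rw [hσ]; exact Multiset.mem_map_of_mem _ (Finset.mem_univ i)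
  have h0 : IsConj (M 0) (Matrix.diagonal fun i => Complex.exp (2 * Real.pi * Complex.I * ρ i)) :=
    isConj_diagonal_of_eigenvectors hρi fun i => by
      obtain ⟨g, hg, hg0, hs⟩ := (hasFuchsianForm_zero hp).exists_power_solution (by rwa [e0])
        (by rw [e0]; exact hρm i)
      exact c0.eigenvector_zero hg hg0 hs
  have h2 : IsConj (M 2) (Matrix.diagonal fun i => Complex.exp (2 * Real.pi * Complex.I * σ i)) :=
    isConj_diagonal_of_eigenvectors hσi fun i => by
      obtain ⟨g, hg, hg0, hs⟩ := (hasFuchsianForm_infinity hp).exists_power_solution (by rwa [eI])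
        (by rw [eI]; exact hσm i)
      exact c2.eigenvector_infinity hg hg0 hs
  have d0 : centralizerDim (M 0) = 4 := by
    rw [centralizerDim_eq_of_isConj h0, centralizerDim_diagonal hρi]
  have d1 : centralizerDim (M 1) = 10 := by
    rw [centralizerDim_eq_of_isConj hJ, centralizerDim_jordan112]
  have d2 : centralizerDim (M 2) = 4 := by
    rw [centralizerDim_eq_of_isConj h2, centralizerDim_diagonal hσi]
  refine ⟨⟨_, hρi, h0, by rw [hρ, Multiset.map_map]; rfl⟩,
    ⟨_, hσi, h2, by rw [hσ, Multiset.map_map]; rfl⟩,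
    (spectralType_eq_of_isConj h0).trans (spectralType_diagonal hρi),
    (spectralType_eq_of_isConj hJ).trans spectralType_jordan112,
    (spectralType_eq_of_isConj h2).trans (spectralType_diagonal hσi),
    d0, d1, d2, rigidityIndex_eq_two d0 d1 d2, fun hpair => ?_⟩
  refine isRigidTriple_of_isConj hρi (fun i j hij => ?_) hprod h0 hJ h2
  rw [← Complex.exp_add, ← mul_add] at hij
  obtain ⟨k, hk⟩ := exp_two_pi_eq_exp_iff (x := ρ i + σ j) (y := 0) (by rw [hij]; simp)
  exact hpair _ (hρm i) _ (hσm j) k (by simpa using hk)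

end Medium

/-! ### Genericity -/

open MeasureTheory in
-- Fubini's theorem along the lines of direction `i`: a countable subset of a line is null.
theorem ae_notMem_of_countable_slices {S : Set (Fin 6 → ℝ)} (hS : MeasurableSet S) (i : Fin 6)
    (h : ∀ x : Fin 6 → ℝ, {t : ℝ | x + t • Pi.single i 1 ∈ S}.Countable) : ∀ᵐ x : Fin 6 → ℝ, x ∉ S := by
  refine ae_mem_of_ae_add_linearMap_mem (LinearMap.toSpanSingleton ℝ (Fin 6 → ℝ) (Pi.single i 1))
    (μ := volume) volume (s := Sᶜ) hS.compl fun x => ?_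
  filter_upwards [(h x).ae_notMem volume] with t ht
  exact ht

/-- The set is the projection along `ℂ` of a closed set. A closed set of a proper space is a
countable union of compact pieces, and these have compact projections. -/
theorem measurableSet_exists_zero {F G : (Fin 6 → ℝ) × ℂ → ℂ} (hF : Continuous F)
    (hG : Continuous G) : MeasurableSet {x | ∃ k, F (x, k) = 0 ∧ G (x, k) = 0} := by
  have hC : IsClosed {y | F y = 0 ∧ G y = 0} :=
    (isClosed_eq hF continuous_const).inter (isClosed_eq hG continuous_const)
  have h : {x | ∃ k, F (x, k) = 0 ∧ G (x, k) = 0} =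
      ⋃ n : ℕ, Prod.fst '' ({y | F y = 0 ∧ G y = 0} ∩ Metric.closedBall 0 n) := by
    ext x
    simp only [Set.mem_ofPred_eq, Set.mem_iUnion, Set.mem_image]
    constructor
    · rintro ⟨k, hk⟩
      obtain ⟨n, hn⟩ := exists_nat_ge ‖(x, k)‖
      exact ⟨n, (x, k), ⟨hk, by simpa using hn⟩, rfl⟩
    · rintro ⟨n, ⟨x', k⟩, ⟨hk, -⟩, rfl⟩
      exact ⟨k, hk⟩
  rw [h]
  refine MeasurableSet.iUnion fun n => IsClosed.measurableSet ?_
  exact (((isCompact_closedBall (0 : (Fin 6 → ℝ) × ℂ) n).inter_left hC).image continuous_fst).isClosed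

/-- Eliminating `m` from the two equations gives `(P' Q - P Q')(k) = 0`, so `k` takes finitely many
values; each fixes `m = Q/P`, because `P` and `Q` have no common zero. Here `P'` and `Q'` are
arbitrary polynomials: translates in one application, derivatives in the other. -/
theorem finite_setOf_elimination {P Q P' Q' : ℂ[X]} (hE : P' * Q - P * Q' ≠ 0)
    (h0 : ∀ k, P.eval k = 0 → Q.eval k ≠ 0) :
    {m : ℂ | ∃ k, m * P.eval k - Q.eval k = 0 ∧ m * P'.eval k - Q'.eval k = 0}.Finite := by
  refine ((P' * Q - P * Q').roots.toFinset.image fun k => Q.eval k / P.eval k).finite_toSet.subset ?_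
  rintro m ⟨k, h1, h2⟩
  have hP : P.eval k ≠ 0 := fun hP => h0 k hP (by rw [hP] at h1; linear_combination -h1)
  simp only [Finset.coe_image, Set.mem_image, Finset.mem_coe, Multiset.mem_toFinset, mem_roots hE,
    IsRoot, eval_sub, eval_mul]
  refine ⟨k, by linear_combination P.eval k * h2 - P'.eval k * h1, ?_⟩
  rw [div_eq_iff hP]
  linear_combination -h1

/-! ### Elimination of the mass parameter from the resonance conditions -/

namespace Medium

/-- The dispersion relation is `m * genericP - genericQ`, up to a factor. -/
def genericP (V ω : ℝ) : ℂ[X] := C (1 - V ^ 2 : ℂ) * (C (V : ℂ) * X + C (ω : ℂ)) ^ 2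

/-- The part of the dispersion relation that is free of `m`. -/
def genericQ (V ω g : ℝ) : ℂ[X] :=
  C ((1 - V ^ 2) * g ^ 2 : ℂ) * (X + C (V * ω : ℂ)) ^ 2 - (C (V : ℂ) * X + C (ω : ℂ)) ^ 4

/-- Beyond admissibility, `g ≠ 0` and `ω ≠ 0` are required: then `genericQ` does not vanish at
`-ω/V`, the only zero of `genericP`. The parameters excluded in this way lie on two hyperplanes. -/
structure Regular (V g ω : ℝ) : Prop where
  V_ne : V ≠ 0
  V_lt : |V| < 1
  g_ne : g ≠ 0
  ω_ne : ω ≠ 0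

variable {V g ω : ℝ}

theorem Regular.one_sub_pos (h : Regular V g ω) : 0 < 1 - V ^ 2 := by
  have := abs_lt.1 h.V_lt; nlinarith

theorem Regular.one_sub_ne (h : Regular V g ω) : (1 - V ^ 2 : ℂ) ≠ 0 := by
  exact_mod_cast h.one_sub_pos.ne'

theorem Regular.genericP_eq_zero_iff (h : Regular V g ω) {k : ℂ} :
    (genericP V ω).eval k = 0 ↔ k = -ω / V := by
  have hV : (V : ℂ) ≠ 0 := by exact_mod_cast h.V_ne
  simp only [genericP, eval_mul, eval_C, eval_pow, eval_add, eval_X, mul_eq_zero, h.one_sub_ne,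
    false_or, pow_eq_zero_iff two_ne_zero]
  rw [eq_div_iff hV]
  exact ⟨fun h => by linear_combination h, fun h => by linear_combination h⟩

theorem Regular.genericQ_ne_zero (h : Regular V g ω) : (genericQ V ω g).eval (-ω / V : ℂ) ≠ 0 := by
  have hV : (V : ℂ) ≠ 0 := by exact_mod_cast h.V_ne
  have hg : (g : ℂ) ≠ 0 := by exact_mod_cast h.g_ne
  have hω : (ω : ℂ) ≠ 0 := by exact_mod_cast h.ω_ne
  have e : (genericQ V ω g).eval (-ω / V : ℂ) = (1 - V ^ 2) ^ 3 * (g * ω / V) ^ 2 := by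
    simp [genericQ]
    field_simp
    ring
  rw [e]
  exact mul_ne_zero (pow_ne_zero _ h.one_sub_ne) (pow_ne_zero _ (by positivity))

theorem Regular.genericQ_ne_zero_of (h : Regular V g ω) (k : ℂ) (hk : (genericP V ω).eval k = 0) :
    (genericQ V ω g).eval k ≠ 0 := by
  rw [h.genericP_eq_zero_iff.1 hk]; exact h.genericQ_ne_zero

/-- At `-ω/V` the eliminant reduces to `P(-ω/V + δ) Q(-ω/V)`, which is non-zero because `P` has no
other zero. -/
theorem Regular.finite_shift (h : Regular V g ω) {δ : ℂ} (hδ : δ ≠ 0) :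
    {m : ℂ | ∃ k, m * (genericP V ω).eval k - (genericQ V ω g).eval k = 0 ∧
      m * (genericP V ω).eval (k + δ) - (genericQ V ω g).eval (k + δ) = 0}.Finite := by
  have := finite_setOf_elimination (P := genericP V ω) (Q := genericQ V ω g)
    (P' := (genericP V ω).comp (X + C δ)) (Q' := (genericQ V ω g).comp (X + C δ)) (fun h0 => ?_)
    h.genericQ_ne_zero_of
  · simpa using this
  · have h1 := congrArg (eval (-ω / V : ℂ)) h0
    simp only [eval_sub, eval_mul, eval_comp, eval_add, eval_X, eval_C, eval_zero,
      h.genericP_eq_zero_iff.2 rfl, zero_mul, sub_zero, mul_eq_zero, h.genericQ_ne_zero, or_false]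
      at h1
    rw [h.genericP_eq_zero_iff] at h1
    exact hδ (by linear_combination h1)

/-- `P` has a double zero at `-ω/V`, so the eliminant `P' Q - P Q'` vanishes there. Its derivative
is `P'' Q - P Q''`, whose value there is `P'' Q ≠ 0`. -/
theorem Regular.finite_double (h : Regular V g ω) :
    {m : ℂ | ∃ k, m * (genericP V ω).eval k - (genericQ V ω g).eval k = 0 ∧
      m * (derivative (genericP V ω)).eval k - (derivative (genericQ V ω g)).eval k = 0}.Finite := by
  refine finite_setOf_elimination (fun h0 => ?_) h.genericQ_ne_zero_of
  have hV : (V : ℂ) ≠ 0 := by exact_mod_cast h.V_ne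
  have h1 := congrArg (fun p : ℂ[X] => (derivative p).eval (-ω / V : ℂ)) h0
  have h2 : (derivative (derivative (genericP V ω))).eval (-ω / V : ℂ) = 2 * V ^ 2 * (1 - V ^ 2) := by
    simp [genericP, derivative_pow]
    ring
  simp only [derivative_sub, derivative_mul, eval_sub, eval_mul, eval_add, h2,
    h.genericP_eq_zero_iff.2 rfl, derivative_zero, eval_zero] at h1
  have h3 : 2 * (V : ℂ) ^ 2 * (1 - V ^ 2) * (genericQ V ω g).eval (-ω / V : ℂ) = 0 := by
    linear_combination h1
  exact mul_ne_zero (mul_ne_zero (mul_ne_zero two_ne_zero (pow_ne_zero 2 hV)) h.one_sub_ne)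
    h.genericQ_ne_zero h3

/-- The first equation does not involve `m`: it leaves finitely many `k`, and each determines `m`
through the second. -/
theorem Regular.finite_pair (h : Regular V g ω) {D : ℂ[X]} (hD : D ≠ 0) (δ : ℂ) :
    {m : ℂ | ∃ k, D.eval k = 0 ∧
      m * (genericP V ω).eval (k + δ) - (genericQ V ω g).eval (k + δ) = 0}.Finite := by
  refine (D.roots.toFinset.image fun k => (genericQ V ω g).eval (k + δ) /
    (genericP V ω).eval (k + δ)).finite_toSet.subset ?_
  rintro m ⟨k, h1, h2⟩
  have hP : (genericP V ω).eval (k + δ) ≠ 0 := fun hP =>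
    h.genericQ_ne_zero_of _ hP (by rw [hP] at h2; linear_combination -h2)
  simp only [Finset.coe_image, Set.mem_image, Finset.mem_coe, Multiset.mem_toFinset, mem_roots hD]
  refine ⟨k, h1, ?_⟩
  rw [div_eq_iff hP]
  linear_combination -h2

theorem measurableSet_regular : MeasurableSet {x : Fin 6 → ℝ | Regular (x 0) (x 2) (x 4)} := by
  have : {x : Fin 6 → ℝ | Regular (x 0) (x 2) (x 4)} =
      {x | x 0 ≠ 0} ∩ {x | |x 0| < 1} ∩ {x | x 2 ≠ 0} ∩ {x | x 4 ≠ 0} := by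
    ext x
    exact ⟨fun ⟨a, b, c, d⟩ => ⟨⟨⟨a, b⟩, c⟩, d⟩, fun ⟨⟨⟨a, b⟩, c⟩, d⟩ => ⟨a, b, c, d⟩⟩
  rw [this]
  refine IsOpen.measurableSet (((IsOpen.inter ?_ ?_).inter ?_).inter ?_)
  · exact isOpen_ne_fun (continuous_apply 0) continuous_const
  · exact isOpen_lt (continuous_apply 0).abs continuous_const
  · exact isOpen_ne_fun (continuous_apply 2) continuous_const
  · exact isOpen_ne_fun (continuous_apply 4) continuous_const

/-- Along a line of direction `i` the exceptional values of `m` lie in one finite set, and `m` takes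
each value countably often, so the slices of the exceptional set are countable. `hBi` makes `B`
empty on a line as soon as the base point of the line is outside `B`. -/
theorem ae_forall_ne_zero {i : Fin 6} {m : (Fin 6 → ℝ) → ℝ}
    (hm : ∀ x c, {t : ℝ | m (x + t • Pi.single i 1) = c}.Countable)
    {F G : (Fin 6 → ℝ) × ℂ → ℂ} (hF : Continuous F) (hG : Continuous G) {B : Set (Fin 6 → ℝ)}
    (hB : MeasurableSet B) (hBi : ∀ x (t : ℝ), x + t • Pi.single i 1 ∈ B → x ∈ B)
    (hfin : ∀ x ∈ B, ∃ s : Set ℂ, s.Finite ∧ ∀ (t : ℝ) (k : ℂ),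
      F (x + t • Pi.single i 1, k) = 0 → G (x + t • Pi.single i 1, k) = 0 →
        (m (x + t • Pi.single i 1) : ℂ) ∈ s) :
    ∀ᵐ x : Fin 6 → ℝ, x ∈ B → ∀ k, F (x, k) = 0 → G (x, k) ≠ 0 := by
  have h := ae_notMem_of_countable_slices (hB.inter (measurableSet_exists_zero hF hG)) i fun x => by
    by_cases hx : x ∈ B
    · obtain ⟨s, hs, hs'⟩ := hfin x hx
      -- The finite set is complex while `m` is real, hence the real part.
      refine (hs.countable.biUnion fun c _ => (hm x c.re)).mono ?_
      rintro t ⟨-, k, h1, h2⟩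
      simp only [Set.mem_iUnion]
      exact ⟨_, hs' t k h1 h2, by simp⟩
    · refine Set.Countable.mono ?_ Set.countable_empty
      rintro t ⟨h1, -⟩
      exact hx (hBi x t h1)
  filter_upwards [h] with x hx hxB k hF0 hG0
  exact hx ⟨hxB, k, hF0, hG0⟩

/-- The dispersion relation as a function of parameters and wave number. -/
def disp (m : (Fin 6 → ℝ) → ℝ) (y : (Fin 6 → ℝ) × ℂ) : ℂ :=
  m y.1 * (genericP (y.1 0) (y.1 4)).eval y.2 - (genericQ (y.1 0) (y.1 4) (y.1 2)).eval y.2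

/-- The difference of wave numbers that corresponds to the difference `n` of exponents. -/
def gap (n : ℤ) (x : Fin 6 → ℝ) : ℂ := 2 * Complex.I * (x 1 * √(1 - x 0 ^ 2) : ℝ) * n

theorem continuous_disp {m : (Fin 6 → ℝ) → ℝ} (hm : Continuous m) : Continuous (disp m) := by
  unfold disp genericP genericQ
  simp only [eval_mul, eval_C, eval_pow, eval_add, eval_sub, eval_X]
  fun_prop

theorem continuous_gap (n : ℤ) : Continuous (gap n) := by
  unfold gap; fun_prop

theorem gap_ne_zero {n : ℤ} (hn : n ≠ 0) {x : Fin 6 → ℝ} (hx : Regular (x 0) (x 2) (x 4))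
    (hb : x 1 ≠ 0) : gap n x ≠ 0 := by
  have h : x 1 * √(1 - x 0 ^ 2) ≠ 0 := mul_ne_zero hb (Real.sqrt_pos.2 hx.one_sub_pos).ne'
  have : ((x 1 * √(1 - x 0 ^ 2) : ℝ) : ℂ) ≠ 0 := by exact_mod_cast h
  exact mul_ne_zero (mul_ne_zero (mul_ne_zero two_ne_zero Complex.I_ne_zero) this)
    (Int.cast_ne_zero.2 hn)

/-- The `k`-derivative of `disp`. -/
def dispDeriv (m : (Fin 6 → ℝ) → ℝ) (y : (Fin 6 → ℝ) × ℂ) : ℂ :=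
  m y.1 * (derivative (genericP (y.1 0) (y.1 4))).eval y.2
    - (derivative (genericQ (y.1 0) (y.1 4) (y.1 2))).eval y.2

theorem continuous_dispDeriv {m : (Fin 6 → ℝ) → ℝ} (hm : Continuous m) :
    Continuous (dispDeriv m) := by
  unfold dispDeriv genericP genericQ
  simp only [derivative_mul, derivative_sub, derivative_add, derivative_pow, derivative_C,
    derivative_X, eval_mul, eval_C, eval_pow, eval_add, eval_sub, eval_X, eval_zero, eval_one]
  fun_prop

/-- The parameters for which the dispersion relation is not degenerate. -/
def regularSet : Set (Fin 6 → ℝ) := {x | Regular (x 0) (x 2) (x 4)} ∩ {x | x 1 ≠ 0}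

theorem measurableSet_regularSet : MeasurableSet regularSet :=
  measurableSet_regular.inter (isOpen_ne_fun (continuous_apply 1) continuous_const).measurableSet

/-- Coordinates `3` and `5` are `μ` and `λ`. Moving along either one leaves `V`, `β`, `g`, `ω`, and
with them `gap`, unchanged, so the dispersion relation varies through `m` only. -/
theorem add_single_apply {i : Fin 6} (hi : i = 3 ∨ i = 5) (x : Fin 6 → ℝ) (t : ℝ) :
    (x + t • Pi.single i (1 : ℝ) : Fin 6 → ℝ) 0 = x 0 ∧ (x + t • Pi.single i (1 : ℝ) : Fin 6 → ℝ) 1 = x 1 ∧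
    (x + t • Pi.single i (1 : ℝ) : Fin 6 → ℝ) 2 = x 2 ∧
    (x + t • Pi.single i (1 : ℝ) : Fin 6 → ℝ) 4 = x 4 := by
  rcases hi with rfl | rfl <;> simp

theorem mem_regularSet_of_add_single {i : Fin 6} (hi : i = 3 ∨ i = 5) (x : Fin 6 → ℝ) (t : ℝ)
    (h : x + t • Pi.single i 1 ∈ regularSet) : x ∈ regularSet := by
  obtain ⟨e0, e1, e2, e4⟩ := add_single_apply hi x t
  obtain ⟨h1, h2⟩ := h
  simp only [Set.mem_ofPred_eq, e0, e1, e2, e4] at h1 h2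
  exact ⟨h1, h2⟩

variable {i : Fin 6} {m : (Fin 6 → ℝ) → ℝ}

theorem ae_disp_add_gap_ne_zero (hi : i = 3 ∨ i = 5) (hmc : Continuous m)
    (hm : ∀ x c, {t : ℝ | m (x + t • Pi.single i 1) = c}.Countable) :
    ∀ᵐ x : Fin 6 → ℝ, x ∈ regularSet → ∀ n : ℤ, n ≠ 0 → ∀ k, disp m (x, k) = 0 →
      disp m (x, k + gap n x) ≠ 0 := by
  have h : ∀ n : ℤ, n ≠ 0 → ∀ᵐ x : Fin 6 → ℝ, x ∈ regularSet → ∀ k, disp m (x, k) = 0 →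
      disp m (x, k + gap n x) ≠ 0 := by
    intro n hn
    refine ae_forall_ne_zero (G := fun y => disp m (y.1, y.2 + gap n y.1)) hm (continuous_disp hmc)
      ((continuous_disp hmc).comp (continuous_fst.prodMk
        (continuous_snd.add ((continuous_gap n).comp continuous_fst))))
      measurableSet_regularSet (mem_regularSet_of_add_single hi) fun x hx => ?_
    refine ⟨_, hx.1.finite_shift (gap_ne_zero hn hx.1 hx.2), fun t k h1 h2 => ⟨k, ?_⟩⟩
    obtain ⟨e0, e1, e2, e4⟩ := add_single_apply hi x t
    simp only [disp, gap, e0, e1, e2, e4] at h1 h2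
    exact ⟨h1, h2⟩
  have h' := MeasureTheory.ae_all_iff.2 fun n : {n : ℤ // n ≠ 0} => h n.1 n.2
  filter_upwards [h'] with x hx hxB n hn
  exact hx ⟨n, hn⟩ hxB

theorem ae_dispDeriv_ne_zero (hi : i = 3 ∨ i = 5) (hmc : Continuous m)
    (hm : ∀ x c, {t : ℝ | m (x + t • Pi.single i 1) = c}.Countable) :
    ∀ᵐ x : Fin 6 → ℝ, x ∈ regularSet → ∀ k, disp m (x, k) = 0 → dispDeriv m (x, k) ≠ 0 := by
  refine ae_forall_ne_zero hm (continuous_disp hmc) (continuous_dispDeriv hmc)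
    measurableSet_regularSet (mem_regularSet_of_add_single hi) fun x hx => ?_
  refine ⟨_, hx.1.finite_double, fun t k h1 h2 => ⟨k, ?_⟩⟩
  obtain ⟨e0, e1, e2, e4⟩ := add_single_apply hi x t
  simp only [disp, dispDeriv, e0, e2, e4] at h1 h2
  exact ⟨h1, h2⟩

/-- The direction `i` moves `m` and not `m'`: one dispersion relation stays fixed while the other
sweeps past its shifted roots. -/
theorem ae_disp_add_gap_ne_zero_of_disp (hi : i = 3 ∨ i = 5) (hmc : Continuous m)
    (hm : ∀ x c, {t : ℝ | m (x + t • Pi.single i 1) = c}.Countable) {m' : (Fin 6 → ℝ) → ℝ}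
    (hmc' : Continuous m') (hm' : ∀ x (t : ℝ), m' (x + t • Pi.single i 1) = m' x) :
    ∀ᵐ x : Fin 6 → ℝ, x ∈ regularSet → ∀ n : ℤ, ∀ k, disp m' (x, k) = 0 →
      disp m (x, k + gap n x) ≠ 0 := by
  have h : ∀ n : ℤ, ∀ᵐ x : Fin 6 → ℝ, x ∈ regularSet → ∀ k, disp m' (x, k) = 0 →
      disp m (x, k + gap n x) ≠ 0 := by
    intro n
    refine ae_forall_ne_zero (G := fun y => disp m (y.1, y.2 + gap n y.1)) hm (continuous_disp hmc')
      ((continuous_disp hmc).comp (continuous_fst.prodMk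
        (continuous_snd.add ((continuous_gap n).comp continuous_fst))))
      measurableSet_regularSet (mem_regularSet_of_add_single hi) fun x hx => ?_
    refine ⟨_, hx.1.finite_pair (D := C (m' x : ℂ) * genericP (x 0) (x 4) - genericQ (x 0) (x 4) (x 2))
      (fun h0 => ?_) (gap n x), fun t k h1 h2 => ⟨k, ?_⟩⟩
    · have := congrArg (eval (-x 4 / x 0 : ℂ)) h0
      simp [hx.1.genericP_eq_zero_iff.2 rfl, hx.1.genericQ_ne_zero] at this
    obtain ⟨e0, e1, e2, e4⟩ := add_single_apply hi x t
    simp only [disp, gap, e0, e1, e2, e4, hm'] at h1 h2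
    exact ⟨by simpa using h1, h2⟩
  have h' := MeasureTheory.ae_all_iff.2 h
  filter_upwards [h'] with x hx hxB n
  exact hx n hxB

/-- Distinct exponents mean simple roots, and an integer difference `n` of exponents means that two
roots differ by `n / c`. -/
theorem nonresonant_map_roots {T : ℂ[X]} {c : ℂ} (hc : c ≠ 0)
    (h2 : ∀ k, T.eval k = 0 → (derivative T).eval k ≠ 0)
    (h1 : ∀ n : ℤ, n ≠ 0 → ∀ k, T.eval k = 0 → T.eval (k + n / c) ≠ 0) :
    Nonresonant (T.roots.map fun k => c * k) := by
  by_cases hT : T = 0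
  · exact absurd (by simp [hT]) (h2 0 (by simp [hT]))
  refine ⟨Multiset.Nodup.map (mul_right_injective₀ hc) ?_, ?_⟩
  · classical
    rw [Multiset.nodup_iff_count_le_one]
    intro k
    rw [count_roots]
    by_contra! hk
    obtain ⟨a, b⟩ := (one_lt_rootMultiplicity_iff_isRoot hT).1 hk
    exact h2 k a b
  · intro x hx y hy n hn
    obtain ⟨k, hk, rfl⟩ := Multiset.mem_map.1 hx
    obtain ⟨k', hk', rfl⟩ := Multiset.mem_map.1 hy
    rw [mem_roots hT] at hk hk'
    by_cases hn0 : n = 0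
    · subst hn0
      rw [Int.cast_zero, sub_eq_zero] at hn
      exact hn
    · refine absurd ?_ (h1 n hn0 k' hk')
      rw [show k' + n / c = k by rw [← hn]; field_simp; ring]
      exact hk

/-- As `γ² (1 - V²) = 1`, a factor `γ⁴` comes out and leaves coefficients polynomial in the
parameters, hence continuous on the whole parameter space. -/
theorem dispersion_eq {p : Medium} (hp : p.Admissible) (m : ℝ) :
    p.dispersion m = C (p.γ ^ 4 : ℂ) * (C (m : ℂ) * genericP p.V p.ω - genericQ p.V p.ω p.g) := by
  have hV := abs_lt.mp hp.V_lt
  have h0 : 0 < 1 - p.V ^ 2 := by nlinarith [hV.1, hV.2]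
  have h1 : p.γ ^ 2 * (1 - p.V ^ 2) = 1 := by
    rw [γ, div_pow, one_pow, Real.sq_sqrt h0.le, one_div_mul_cancel h0.ne']
  have h2 : (p.γ : ℂ) ^ 2 * (1 - p.V ^ 2) = 1 := by exact_mod_cast h1
  refine Polynomial.funext fun k => ?_
  simp [dispersion, genericP, genericQ]
  linear_combination -(p.γ : ℂ) ^ 2 * (m * (k * p.V + p.ω) ^ 2 - p.g ^ 2 * (k + p.V * p.ω) ^ 2) * h2

theorem roots_dispersion {p : Medium} (hp : p.Admissible) (m : ℝ) :
    (p.dispersion m).roots = (C (m : ℂ) * genericP p.V p.ω - genericQ p.V p.ω p.g).roots := by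
  have : (p.γ : ℂ) ^ 4 ≠ 0 := pow_ne_zero _ (by exact_mod_cast hp.γ_pos.ne')
  rw [dispersion_eq hp, roots_C_mul _ this]

theorem countable_setOf_sq_sub_eq (x : Fin 6 → ℝ) (c : ℝ) :
    {t : ℝ | (x + t • Pi.single 5 (1 : ℝ) : Fin 6 → ℝ) 3 ^ 2
      - (x + t • Pi.single 5 (1 : ℝ) : Fin 6 → ℝ) 5 = c}.Countable := by
  refine (Set.countable_singleton (x 3 ^ 2 - x 5 - c)).mono fun t ht => ?_
  simp at ht
  simp
  linarith

theorem countable_setOf_sq_eq (x : Fin 6 → ℝ) (c : ℝ) :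
    {t : ℝ | (x + t • Pi.single 3 (1 : ℝ) : Fin 6 → ℝ) 3 ^ 2 = c}.Countable := by
  refine ((Set.countable_singleton (√c - x 3)).union (Set.countable_singleton (-√c - x 3))).mono
    fun t ht => ?_
  simp at ht
  rcases abs_eq (Real.sqrt_nonneg c) |>.1 (show |x 3 + t| = √c by rw [← ht, Real.sqrt_sq_eq_abs])
    with h | h
  · left; simp; linarith
  · right; simp; linarith

theorem ae_apply_ne_zero (i : Fin 6) : ∀ᵐ x : Fin 6 → ℝ, x i ≠ 0 := by
  refine ae_notMem_of_countable_slices (S := {x | x i = 0})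
    (isClosed_eq (continuous_apply i) continuous_const).measurableSet i fun x => ?_
  refine (Set.countable_singleton (-x i)).mono fun t ht => ?_
  simp at ht
  simp
  linarith

theorem gap_ofVector (n : ℤ) (x : Fin 6 → ℝ) : gap n x = 2 * Complex.I * (ofVector x).βt * n := by
  simp only [gap, βt, γ, ofVector, one_div, div_inv_eq_mul]

/-- Resonances at `0` are avoided by moving `λ`, those at `∞` by moving `μ`, and those of a pair by
moving `λ` again, which changes the roots of `DR₀` and leaves those of `DR` in place. -/
theorem ae_generic : ∀ᵐ x : Fin 6 → ℝ, (ofVector x).Admissible →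
      Nonresonant (ofVector x).exponentsZero ∧
      Nonresonant (ofVector x).exponentsInfinity ∧
      NonresonantPair (ofVector x).exponentsZero (ofVector x).exponentsInfinity := by
  have c0 : Continuous fun x : Fin 6 → ℝ => x 3 ^ 2 - x 5 := by fun_prop
  have cI : Continuous fun x : Fin 6 → ℝ => x 3 ^ 2 := by fun_prop
  filter_upwards [ae_apply_ne_zero 2, ae_apply_ne_zero 4,
    ae_disp_add_gap_ne_zero (.inr rfl) c0 countable_setOf_sq_sub_eq,
    ae_dispDeriv_ne_zero (.inr rfl) c0 countable_setOf_sq_sub_eq,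
    ae_disp_add_gap_ne_zero (.inl rfl) cI countable_setOf_sq_eq,
    ae_dispDeriv_ne_zero (.inl rfl) cI countable_setOf_sq_eq,
    ae_disp_add_gap_ne_zero_of_disp (.inr rfl) c0 countable_setOf_sq_sub_eq cI
      (fun x t => by simp)] with x hg hω z1 z2 i1 i2 hpair hp
  have hB : x ∈ regularSet := ⟨⟨hp.V_ne, hp.V_lt, hg, hω⟩, hp.β_ne⟩
  have hb : ((ofVector x).βt : ℂ) ≠ 0 := by exact_mod_cast hp.βt_ne
  have hI := Complex.I_ne_zero
  set T₀ : ℂ[X] := C ((x 3 ^ 2 - x 5 : ℝ) : ℂ) * genericP (x 0) (x 4) - genericQ (x 0) (x 4) (x 2)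
    with hT₀
  set T : ℂ[X] := C ((x 3 ^ 2 : ℝ) : ℂ) * genericP (x 0) (x 4) - genericQ (x 0) (x 4) (x 2)
    with hT
  have v0 : ∀ k, T₀.eval k = disp (fun x => x 3 ^ 2 - x 5) (x, k) := fun k => by
    simp only [hT₀, eval_sub, eval_mul, eval_C]; rfl
  have vI : ∀ k, T.eval k = disp (fun x => x 3 ^ 2) (x, k) := fun k => by
    simp only [hT, eval_sub, eval_mul, eval_C]; rfl
  have d0 : ∀ k, (derivative T₀).eval k = dispDeriv (fun x => x 3 ^ 2 - x 5) (x, k) := fun k => by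
    simp only [hT₀, derivative_sub, derivative_C_mul, eval_sub, eval_mul, eval_C]; rfl
  have dI : ∀ k, (derivative T).eval k = dispDeriv (fun x => x 3 ^ 2) (x, k) := fun k => by
    simp only [hT, derivative_sub, derivative_C_mul, eval_sub, eval_mul, eval_C]; rfl
  have r0 : (ofVector x).exponentsZero =
      T₀.roots.map fun k => Complex.I / (2 * (ofVector x).βt) * k := by
    rw [exponentsZero, DR₀, roots_dispersion hp]
    exact Multiset.map_congr rfl fun k _ => by ring
  have rI : (ofVector x).exponentsInfinity =
      T.roots.map fun k => -(Complex.I / (2 * (ofVector x).βt)) * k := by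
    rw [exponentsInfinity, DR, roots_dispersion hp]
    exact Multiset.map_congr rfl fun k _ => by ring
  have hc : Complex.I / (2 * (ofVector x).βt : ℂ) ≠ 0 := div_ne_zero hI (mul_ne_zero two_ne_zero hb)
  have hgap : ∀ n : ℤ, (n : ℂ) / -(Complex.I / (2 * (ofVector x).βt)) = gap n x := fun n => by
    rw [gap_ofVector]
    field_simp
    linear_combination (-n : ℂ) * Complex.I_sq
  refine ⟨?_, ?_, ?_⟩
  · rw [r0]
    refine nonresonant_map_roots hc (fun k hk => ?_) fun n hn k hk => ?_
    · rw [d0]; exact z2 hB k (by rwa [← v0])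
    -- `gap n` is the difference of wave numbers for the exponents at infinity; at zero the scaling
    -- factor has the opposite sign, hence `-n`.
    · have := z1 hB (-n) (neg_ne_zero.2 hn) k (by rwa [← v0])
      rw [← hgap, Int.cast_neg, neg_div_neg_eq] at this
      rwa [v0]
  · rw [rI]
    refine nonresonant_map_roots (neg_ne_zero.2 hc) (fun k hk => ?_) fun n hn k hk => ?_
    · rw [dI]; exact i2 hB k (by rwa [← vI])
    · have := i1 hB n hn k (by rwa [← vI])
      rw [← hgap] at this
      rwa [vI]
  · rw [r0, rI]
    intro y hy z hz n hn
    obtain ⟨k, hk, rfl⟩ := Multiset.mem_map.1 hy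
    obtain ⟨k', hk', rfl⟩ := Multiset.mem_map.1 hz
    have hk0 := (mem_roots'.1 hk).2
    have hk0' := (mem_roots'.1 hk').2
    -- A sum `n` of exponents says `i (k - k')/(2β̃) = n`, that is, `k = k' + gap (-n)`.
    refine hpair hB (-n) k' (by rwa [← vI]) ?_
    rw [← v0, ← hgap, Int.cast_neg, neg_div_neg_eq, ← hn]
    have : k' + (Complex.I / (2 * (ofVector x).βt) * k + -(Complex.I / (2 * (ofVector x).βt)) * k')
        / (Complex.I / (2 * (ofVector x).βt)) = k := by
      field_simp
      ring
    rw [this]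
    exact hk0

end Medium

end

/-! ### Assembly of the local, global and generic statements -/

theorem mainTheorem3 :
    (∀ p : Medium, p.Admissible →
      -- regular singular points at `0`, `1`, `∞`, and no other singular point
      (∀ z : ℂ, z ≠ 0 → z ≠ 1 → p.equation.IsOrdinary z) ∧
      p.equation.IsRegularSingular 0 ∧
      p.equation.IsRegularSingular 1 ∧
      p.equation.atInfinity.IsRegularSingular 0 ∧
      -- the local exponents
      p.equation.HasExponents 0 p.exponentsZero ∧
      p.equation.HasExponents 1 {0, 1, 2, 3} ∧
      p.equation.atInfinity.HasExponents 0 p.exponentsInfinity ∧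
      -- the local solutions
      (Nonresonant p.exponentsZero →
        ∀ ρ ∈ p.exponentsZero, p.equation.HasPowerSolution 0 ρ) ∧
      (Nonresonant p.exponentsInfinity →
        ∀ ρ ∈ p.exponentsInfinity, p.equation.atInfinity.HasPowerSolution 0 ρ) ∧
      (∀ m : ℕ, 1 ≤ m → m ≤ 3 → p.equation.HasHolomorphicSolution 1 m) ∧
      p.equation.HasLogSolution 1 ((p.Λ / (p.V ^ 2 * p.γ ^ 2) : ℝ) : ℂ) ∧
      (∀ f : ℂ → ℂ, AnalyticAt ℂ f 1 → (∀ᶠ z in 𝓝[≠] (1 : ℂ), p.equation.SolvesAt f z) →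
        f 1 = 0) ∧
      -- the monodromy
      (∃ u, p.equation.IsLocalBasis basePoint u) ∧
      (∀ u, p.equation.IsLocalBasis basePoint u →
        ∃ M : Fin 3 → Matrix (Fin 4) (Fin 4) ℂ,
          p.equation.IsMonodromyTriple u M ∧
          (∀ N, p.equation.IsMonodromyTriple u N → N = M) ∧
          M 2 * M 1 * M 0 = 1 ∧
          IsConj (M 1) jordan112 ∧
          (Nonresonant p.exponentsZero → Nonresonant p.exponentsInfinity →
            (∃ d : Fin 4 → ℂ, Function.Injective d ∧ IsConj (M 0) (Matrix.diagonal d) ∧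
              Finset.univ.val.map d =
                p.exponentsZero.map fun ρ => Complex.exp (2 * Real.pi * Complex.I * ρ)) ∧
            (∃ d : Fin 4 → ℂ, Function.Injective d ∧ IsConj (M 2) (Matrix.diagonal d) ∧
              Finset.univ.val.map d =
                p.exponentsInfinity.map fun ρ => Complex.exp (2 * Real.pi * Complex.I * ρ)) ∧
            spectralType (M 0) = {1, 1, 1, 1} ∧
            spectralType (M 1) = {3, 1} ∧
            spectralType (M 2) = {1, 1, 1, 1} ∧
            centralizerDim (M 0) = 4 ∧ centralizerDim (M 1) = 10 ∧ centralizerDim (M 2) = 4 ∧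
            rigidityIndex M = 2 ∧
            (NonresonantPair p.exponentsZero p.exponentsInfinity → IsRigidTriple M)))) ∧
    -- the genericity conditions hold almost everywhere in the space of parameters
    (∀ᵐ x : Fin 6 → ℝ, (Medium.ofVector x).Admissible →
      Nonresonant (Medium.ofVector x).exponentsZero ∧
      Nonresonant (Medium.ofVector x).exponentsInfinity ∧
      NonresonantPair (Medium.ofVector x).exponentsZero
        (Medium.ofVector x).exponentsInfinity) := by
  refine ⟨fun p hp => ?_, Medium.ae_generic⟩
  have e0 := Medium.roots_indicial_zero hp
  have eI := Medium.roots_indicial_infinity hp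
  have f0 := Medium.hasFuchsianForm_zero hp
  have fI := Medium.hasFuchsianForm_infinity hp
  have x0 := f0.hasExponents
  have x1 := (Medium.hasFuchsianForm_one hp).hasExponents
  have xI := fI.hasExponents
  rw [e0] at x0
  rw [Medium.roots_indicial_one] at x1
  rw [eI] at xI
  refine ⟨fun z hz0 hz1 k => ⟨_, Medium.analyticAt_equation hp hz0 hz1 k, EventuallyEq.rfl⟩,
    Medium.isRegularSingular_zero hp, Medium.isRegularSingular_one hp,
    Medium.isRegularSingular_infinity hp, x0, x1, xI, fun hn ρ hρ => ?_, fun hn ρ hρ => ?_,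
    Medium.hasHolomorphicSolution_one hp, Medium.hasLogSolution_one hp,
    fun f hf hs => Medium.eq_zero_of_solvesAt_one hp hf hs,
    Medium.exists_isLocalBasis_basePoint hp, fun u hu => Medium.exists_monodromy hp hu⟩
  · exact f0.hasPowerSolution (by rwa [e0]) (by rwa [e0])
  · exact fI.hasPowerSolution (by rwa [eI]) (by rwa [eI])
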